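/- **Theorem (strong factorization of Jack polynomials).** A partition is a weakly decreasing sequence $\lambda=(\lambda_1\ge\lambda_2\ge\cdots)$ of nonnegative integers with finitely many nonzero terms; $|\lambda|=\sum_i\lambda_i$, $\ell(\lambda)$ is the number of nonzero terms, $\lambda^t$ is the conjugate partition, and $b(\lambda)=\sum_i\binom{\lambda_i}{2}$. Write $<$ for the strict dominance order on partitions of the same size and $m_\nu$ for the monomial symmetric functions. Let $$\mathrm{hook}_\alpha(\lambda)=\prod_{\square\in\lambda}\bigl(\alpha\,a(\square)+\ell(\square)+1\bigr),$$ where $a(\square)$ and $\ell(\square)$ are the arm- and leg-length of the box $\square$ of the Young diagram of $\lambda$. The Jack symmetric function $J^{(\alpha)}_\lambda$ is the unique symmetric function over $\mathbb{Q}(\alpha)$ such that for every $N\ge\ell(\lambda)$ its restriction to $N$ variables has the form $$J^{(\alpha)}_\lambda=\mathrm{hook}_\alpha(\lambda)\,m_\lambda+\sum_{\nu<\lambda}a^\lambda_\nu m_\nu,\qquad a^\lambda_\nu\in\mathbb{Q}(\alpha),$$ and is an eigenvector of the Laplace--Beltrami operator $$D_\alpha=\sum_{i\le N}\sum_{j\ne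 i}\frac{x_i^2}{x_i-x_j}\frac{\partial}{\partial x_i}+\frac{\alpha}{2}\sum_{i\le N}x_i^2\frac{\partial^2}{\partial x_i^2}$$ with eigenvalue $\alpha\, b(\lambda)-b(\lambda^t)+(N-1)|\lambda|$. The restriction $J^{(\alpha)}_\lambda(x_1,\dots,x_N)$ is the Jack polynomial in $N$ variables. Let $r\ge 0$ and let $\lambda^1,\dots,\lambda^r$ be partitions. For $I\subseteq[r]=\{1,\dots,r\}$ let $\lambda^I=\bigoplus_{i\in I}\lambda^i$ be the entry-wise sum. Then $$\prod_{I\subseteq[r]}\bigl(J^{(\alpha)}_{\lambda^I}\bigr)^{(-1)^{|I|}}=1+O(\alpha^{r-1})\qquad(\alpha\to0).$$ Here the product is taken in $R(\alpha)$, where $R$ is the field of fractions of the ring of symmetric functions over $\mathbb{Q}$, and for $f\in R(\alpha)$ and $k\in\mathbb{Z}$, $f=O(\alpha^k)$ means that the rational function $f\cdot\alpha^{-k}$ of $\alpha$ has no pole at $0$. The same holds for the Jack polynomials $J^{(\alpha)}_{\lambda^I}(x_1,\dots,x_N)$ in any finite number $N\ge\max_i\ell(\lambda^i)$ of variables, with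 $R=\mathbb{Q}(x_1,\dots,x_N)$. -/

import Mathlib

noncomputable section

namespace Jack

/-- The weakly decreasing, finitely supported sequences of natural numbers, under entry-wise
addition. -/
def partitionMonoid : AddSubmonoid (ℕ →₀ ℕ) where
  carrier := {f | Antitone f}
  zero_mem' := fun _ _ _ => le_rfl
  add_mem' := fun hf hg _ _ h => add_le_add (hf h) (hg h)

/-- Integer partitions, as weakly decreasing, finitely supported sequences of natural numbers
`lam 0 ≥ lam 1 ≥ …` (the sequence of parts, completed by zeros; the part usually written
`lam_{i+1}` is `lam.1 i`). Addition is the entry-wise sum of partitions, and `0` is the empty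
partition. -/
abbrev IntPartition : Type := partitionMonoid

namespace IntPartition

/-- The size `|lam|`. -/
def size (lam : IntPartition) : ℕ := lam.1.sum fun _ k => k

/-- The length, i.e. the number of nonzero parts. -/
def length (lam : IntPartition) : ℕ := lam.1.support.card

/-- The conjugate partition: its part number `j` (counted from `0`) is the number of `i` with
`lam i ≥ j + 1`. -/
def conj (lam : IntPartition) : IntPartition :=
  ⟨Finsupp.onFinset (Finset.range (lam.1 0))
      (fun j => (lam.1.support.filter fun i => j < lam.1 i).card)
      (by
        intro j hj
        obtain ⟨i, hi⟩ := Finset.card_pos.1 (Nat.pos_of_ne_zero hj)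
        exact Finset.mem_range.2
          (lt_of_lt_of_le (Finset.mem_filter.1 hi).2 (lam.2 (Nat.zero_le i)))),
    by
      intro j k hjk
      exact Finset.card_le_card fun i hi =>
        Finset.mem_filter.2 ⟨(Finset.mem_filter.1 hi).1,
          lt_of_le_of_lt hjk (Finset.mem_filter.1 hi).2⟩⟩

/-- The boxes of the Young diagram, as pairs (row, column) counted from `0`. -/
def boxes (lam : IntPartition) : Finset (Σ _ : ℕ, ℕ) :=
  lam.1.support.sigma fun i => Finset.range (lam.1 i)

/-- The arm-length of a box of the Young diagram. -/
def arm (lam : IntPartition) (s : Σ _ : ℕ, ℕ) : ℕ := lam.1 s.1 - (s.2 + 1)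

/-- The leg-length of a box of the Young diagram. -/
def leg (lam : IntPartition) (s : Σ _ : ℕ, ℕ) : ℕ := lam.conj.1 s.2 - (s.1 + 1)

/-- `b(lam) = ∑ i, binomial (lam i) 2`. -/
def b (lam : IntPartition) : ℕ := lam.1.sum fun _ k => k.choose 2

/-- The dominance order `nu ≤ lam` on partitions of the same size. -/
def DominatedBy (nu lam : IntPartition) : Prop :=
  nu.size = lam.size ∧
    ∀ k : ℕ, ∑ i ∈ Finset.range k, nu.1 i ≤ ∑ i ∈ Finset.range k, lam.1 i

end IntPartition

open IntPartition

/-- The multiset of nonzero values of a finitely supported function: for a partition, its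
multiset of parts; for the exponent of a monomial, its multiset of nonzero exponents. -/
def parts {ι : Type*} (e : ι →₀ ℕ) : Multiset ℕ := e.support.val.map e

/-- The field `ℚ(α)`; the Jack parameter `α` is `RatFunc.X`. -/
abbrev QAlpha : Type := RatFunc ℚ

/-- The hook polynomial `∏ (α * arm + leg + 1)`, the product being over the boxes of `lam`. -/
def hook (lam : IntPartition) : QAlpha :=
  ∏ s ∈ lam.boxes, (RatFunc.X * (lam.arm s : QAlpha) + (lam.leg s : QAlpha) + 1)

/-- The eigenvalue `α * b(lam) - b(conj lam) + (N - 1) * |lam|`. -/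
def eigenvalue (N : ℕ) (lam : IntPartition) : QAlpha :=
  RatFunc.X * (lam.b : QAlpha) - (lam.conj.b : QAlpha) + ((N : QAlpha) - 1) * (lam.size : QAlpha)

/-- The monomial symmetric polynomial `m_nu(x_1, …, x_N)`: the sum of all distinct monomials whose
nonzero exponents are, up to order, the parts of `nu`. (It is `0` if `nu` has length `> N`.) -/
def monomialPoly (N : ℕ) (K : Type*) [CommSemiring K] (nu : IntPartition) :
    MvPolynomial (Fin N) K :=
  ∑ e ∈ (Finset.finsuppAntidiag (Finset.univ : Finset (Fin N)) nu.size).filter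
      (fun e => parts e = parts nu.1),
    MvPolynomial.monomial e 1

/-- The Laplace–Beltrami operator in `N` variables over `ℚ(α)`,
`∑ i, ∑ j ≠ i, x_i ^ 2 / (x_i - x_j) * ∂_i + (α / 2) * ∑ i, x_i ^ 2 * ∂_i ^ 2`,
with values in the field of rational functions in `x_1, …, x_N`. -/
def laplaceBeltrami (N : ℕ) (f : MvPolynomial (Fin N) QAlpha) :
    FractionRing (MvPolynomial (Fin N) QAlpha) :=
  let ι := algebraMap (MvPolynomial (Fin N) QAlpha) (FractionRing (MvPolynomial (Fin N) QAlpha))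
  (∑ i : Fin N, ∑ j ∈ Finset.univ.erase i,
      ι (MvPolynomial.X i) ^ 2 / (ι (MvPolynomial.X i) - ι (MvPolynomial.X j)) *
        ι (MvPolynomial.pderiv i f)) +
    ι (MvPolynomial.C (RatFunc.X / 2) *
      ∑ i : Fin N, MvPolynomial.X i ^ 2 * MvPolynomial.pderiv i (MvPolynomial.pderiv i f))

/-- The two conditions that characterize the Jack polynomial `J_lam` in `N ≥ length lam` variables:
it is an eigenvector of the Laplace–Beltrami operator with the prescribed eigenvalue, and
it has the form `hook lam * m_lam + ∑_{nu < lam} a nu * m_nu` with `a nu` in `ℚ(α)`, where `<` is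
the strict dominance order. (The second condition implies that `f` is symmetric.) -/
def IsJackPoly (N : ℕ) (lam : IntPartition) (f : MvPolynomial (Fin N) QAlpha) : Prop :=
  laplaceBeltrami N f = algebraMap _ _ (MvPolynomial.C (eigenvalue N lam) * f) ∧
  ∃ a : IntPartition →₀ QAlpha,
    (∀ nu ∈ a.support, DominatedBy nu lam ∧ nu ≠ lam) ∧
    f = MvPolynomial.C (hook lam) * monomialPoly N QAlpha lam +
      a.sum fun nu c => MvPolynomial.C c * monomialPoly N QAlpha nu

/-- `a` is the family of coefficients, in the basis of monomial symmetric functions, of the Jack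
symmetric function `J_lam`: its restriction to any number `N ≥ length lam` of variables is the Jack
polynomial `J_lam(x_1, …, x_N)`. -/
def IsJackExpansion (lam : IntPartition) (a : IntPartition →₀ QAlpha) : Prop :=
  ∀ N : ℕ, lam.length ≤ N →
    IsJackPoly N lam (a.sum fun nu c => MvPolynomial.C c * monomialPoly N QAlpha nu)

open Classical in
/-- The coefficients of the Jack symmetric function `J_lam` in the basis of monomial symmetric
functions. (There is exactly one such family; the `else` branch never occurs.) -/
def jackCoeff (lam : IntPartition) : IntPartition →₀ QAlpha :=
  if h : ∃ a, IsJackExpansion lam a then h.choose else 0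

/-- The field homomorphism `ℚ(α) → R(α)` that fixes `α`, for a field `R` that contains `ℚ`. -/
def extendScalars (R : Type*) [Field R] [Algebra ℚ R] : QAlpha →+* RatFunc R :=
  RatFunc.mapRingHom (Polynomial.mapRingHom (algebraMap ℚ R))
    (nonZeroDivisors_le_comap_nonZeroDivisors_of_injective _
      (Polynomial.map_injective _ (algebraMap ℚ R).injective))

/-- The element `∑ nu, (coefficient of m_nu in J_lam) * m_nu` of `R(α)`, where the field `R ⊇ ℚ`
contains the monomial symmetric functions `m nu` (in some alphabet). -/
def jackIn {R : Type*} [Field R] [Algebra ℚ R] (m : IntPartition → R) (lam : IntPartition) :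
    RatFunc R :=
  (jackCoeff lam).sum fun nu c => extendScalars R c * RatFunc.C (m nu)

/-- The Jack polynomial `J_lam(x_1, …, x_N)` as an element of `R(α)`, where `R` is the field
`ℚ(x_1, …, x_N)`. -/
def jackPoly (N : ℕ) (lam : IntPartition) :
    RatFunc (FractionRing (MvPolynomial (Fin N) ℚ)) :=
  jackIn (fun nu => algebraMap (MvPolynomial (Fin N) ℚ) _ (monomialPoly N ℚ nu)) lam

/-- The ring of symmetric functions over `ℚ`: the formal power series in infinitely many variables
`x_0, x_1, …` that have bounded degree and are invariant under all permutations of the variables. -/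
def SymmFun : Subalgebra ℚ (MvPowerSeries ℕ ℚ) where
  carrier := {f | (∃ d : ℕ, ∀ e : ℕ →₀ ℕ, MvPowerSeries.coeff e f ≠ 0 → e.degree ≤ d) ∧
    ∀ σ : Equiv.Perm ℕ, MvPowerSeries.renameEquiv ℚ σ f = f}
  mul_mem' := by
    rintro f g ⟨⟨d, hd⟩, hf⟩ ⟨⟨d', hd'⟩, hg⟩
    refine ⟨⟨d + d', fun e he => ?_⟩, fun σ => by rw [map_mul, hf, hg]⟩
    rw [MvPowerSeries.coeff_mul] at he
    obtain ⟨p, hp, hne⟩ := Finset.exists_ne_zero_of_sum_ne_zero he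
    rw [← Finset.HasAntidiagonal.mem_antidiagonal.1 hp, map_add]
    exact add_le_add (hd _ (left_ne_zero_of_mul hne)) (hd' _ (right_ne_zero_of_mul hne))
  add_mem' := by
    rintro f g ⟨⟨d, hd⟩, hf⟩ ⟨⟨d', hd'⟩, hg⟩
    refine ⟨⟨max d d', fun e he => ?_⟩, fun σ => by rw [map_add, hf, hg]⟩
    by_cases h : MvPowerSeries.coeff e f = 0
    · refine (hd' e fun h' => he ?_).trans (le_max_right _ _)
      rw [map_add, h, h', add_zero]
    · exact (hd e h).trans (le_max_left _ _)
  algebraMap_mem' := by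
    classical
    intro q
    refine ⟨⟨0, fun e he => ?_⟩, fun σ => AlgEquiv.commutes _ q⟩
    by_contra h
    refine he ?_
    rw [MvPowerSeries.algebraMap_apply, MvPowerSeries.coeff_C, if_neg]
    rintro rfl
    exact h (by simp)

open Classical in
/-- The power series `m_nu(x_0, x_1, …)`: the sum of all monomials whose nonzero exponents are, up
to order, the parts of `nu`. -/
def monomialSeries (nu : IntPartition) : MvPowerSeries ℕ ℚ :=
  fun e => if parts e = parts nu.1 then 1 else 0

theorem coeff_monomialSeries (nu : IntPartition) (e : ℕ →₀ ℕ) [Decidable (parts e = parts nu.1)] :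
    MvPowerSeries.coeff e (monomialSeries nu) = if parts e = parts nu.1 then 1 else 0 := by
  rw [MvPowerSeries.coeff_apply, monomialSeries]
  congr

theorem sum_parts {ι : Type*} (e : ι →₀ ℕ) : (parts e).sum = e.degree := rfl

theorem parts_embDomain {ι κ : Type*} (g : ι ↪ κ) (e : ι →₀ ℕ) :
    parts (e.embDomain g) = parts e := by
  simp [parts, Finsupp.support_embDomain, Finset.map_val, Multiset.map_map]

theorem monomialSeries_mem (nu : IntPartition) : monomialSeries nu ∈ SymmFun := by
  classical
  refine ⟨⟨nu.1.degree, fun e he => ?_⟩, fun σ => ?_⟩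
  · rw [coeff_monomialSeries] at he
    have h : parts e = parts nu.1 := by
      by_contra h
      exact he (if_neg h)
    rw [← sum_parts, h, sum_parts]
  · ext e
    obtain ⟨e', rfl⟩ : ∃ e', Finsupp.embDomain σ.toEmbedding e' = e :=
      ⟨Finsupp.embDomain σ.symm.toEmbedding e, by
        ext i
        simp [Finsupp.embDomain_eq_mapDomain, ← Finsupp.mapDomain_comp]⟩
    have h := MvPowerSeries.coeff_embDomain_rename σ.toEmbedding (monomialSeries nu) e'
    rw [coeff_monomialSeries, parts_embDomain, ← coeff_monomialSeries]
    exact h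

/-- The monomial symmetric function `m_nu(x_0, x_1, …)`. -/
def monomialSymm (nu : IntPartition) : SymmFun := ⟨monomialSeries nu, monomialSeries_mem nu⟩

/-- The Jack symmetric function `J_lam` as an element of `R(α)`, where `R` is the field of fractions
of the ring of symmetric functions over `ℚ`. -/
def jackSymm (lam : IntPartition) : RatFunc (FractionRing SymmFun) :=
  jackIn (fun nu => algebraMap SymmFun _ (monomialSymm nu)) lam

/-- For `f` in `R(α)` and an integer `k`: `f = O(α ^ k)`, i.e. the rational function
`f * α ^ (-k)` has no pole at `0`. -/
def IsBigO {R : Type*} [Field R] (f : RatFunc R) (k : ℤ) : Prop :=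
  (f * RatFunc.X ^ (-k)).denom.eval 0 ≠ 0

end Jack

end

/-! Let `L` be the first-order part of the Laplace–Beltrami operator, so that `D_α = L + (α/2) ∑
x_i² ∂_i²`. On symmetric polynomials in `N` variables the eigenvalue at `λ` is `α b(λ) + e(λ)` with
`e` linear and `b` quadratic in `λ`. Write `J_I` for the Jack polynomial of `λ^I` and `u_S = ∏_{I ⊆
S} J_I^{(-1)^{|I|}}`. The claim `u_S ≡ 1 mod α^{|S|-1}` for nonempty `S` is proved by strong
induction on `S` and, for fixed `S`, by raising the exponent `m` of a known congruence by one.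

Divided by `J_I`, the eigenvalue equation becomes a Riccati equation for the logarithmic derivatives
of `J_I`. Alternating sums over `I ⊆ S` turn these into logarithmic derivatives of `u_S`. The
eigenvalues contribute order `|S| - 1`, since linear functions die for `|S| ≥ 2` and quadratic ones
for `|S| ≥ 3`. The squares expand over pairs `(A, B)` with `A ∪ B = S`: two proper subsets give
order at least `|A| + |B| - 2 ≥ |S| - 2`, the other pairs order `m`. As the second-order terms carry
a factor `α`, it follows that `L u_S ≡ 0 mod α^{m+1}` (`dvd_sum_derivation_altProd`).

To return from `L u_S` to `u_S` (`C_X_pow_succ_dvd`), let `P` and `Q` be the products of the `J_I`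
over even and odd `I`, and `P - Q = α^m g`. At `α = 0` the quotient rule makes `g_0` an eigenvector
of the derivation `L` with the eigenvalue of `Q_0`. For `|S| ≥ 2` the even and the odd partitions
have the same sum `μ`, so `g_0` lives on monomials dominated by `μ`. Since `e` is strictly monotone
for dominance, `g_0` vanishes once its coefficient at `μ` does. That coefficient comes from a
difference of products of hook products, and hook products satisfy the factorization by a direct
computation (`altProd_hook_mem`): they are built from products `∏_{a<n} (t + 1 + α a)` with `n`
additive in `λ`.

All of this takes place in power series in `α`: the triangular recursion for the Jack coefficients
has divisors that do not vanish at `α = 0` (`IsJackPoly.coeff_mem_regular`), and the leading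
coefficient is nonzero there, so the `J_I` are units. Symmetric functions are detected by their
restrictions to all large `N`. -/

namespace Jack

open Finset

/-! ### Möbius inversion over subsets -/

section Moebius

variable {ι : Type*} [DecidableEq ι]

/-- The alternating sum over the subsets of `S`. -/
def altSum {M : Type*} [AddCommGroup M] (S : Finset ι) (a : Finset ι → M) : M :=
  ∑ I ∈ S.powerset, (-1 : ℤ) ^ I.card • a I

/-- The alternating product over the subsets of `S`. -/
def altProd {G : Type*} [CommGroup G] (S : Finset ι) (u : Finset ι → G) : G :=
  ∏ I ∈ S.powerset, u I ^ ((-1 : ℤ) ^ I.card)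

/-- Removing `A` identifies the interval from `A` to `S` with the power set of `S \ A`, whose signs
cancel unless it is a point. -/
theorem sum_Icc_neg_one_pow_card {A S : Finset ι} (h : A ⊆ S) :
    ∑ I ∈ S.powerset with A ⊆ I, (-1 : ℤ) ^ I.card = if A = S then (-1) ^ S.card else 0 := by
  have key : ∑ I ∈ S.powerset with A ⊆ I, (-1 : ℤ) ^ I.card =
      ∑ B ∈ (S \ A).powerset, (-1) ^ A.card * (-1 : ℤ) ^ B.card := by
    refine Finset.sum_nbij' (fun I => I \ A) (fun B => B ∪ A) ?_ ?_ ?_ ?_ ?_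
    · intro I hI
      simp only [mem_filter, mem_powerset] at hI ⊢
      exact sdiff_subset_sdiff hI.1 le_rfl
    · intro B hB
      simp only [mem_filter, mem_powerset] at hB ⊢
      exact ⟨union_subset (hB.trans sdiff_subset) h, subset_union_right⟩
    · intro I hI
      simp only [mem_filter, mem_powerset] at hI
      exact sdiff_union_of_subset hI.2
    · intro B hB
      simp only [mem_powerset] at hB
      rw [union_sdiff_right, sdiff_eq_self_of_disjoint]
      exact disjoint_of_subset_left hB sdiff_disjoint
    · intro I hI
      simp only [mem_filter, mem_powerset] at hI
      rw [← pow_add, add_comm, card_sdiff_add_card_eq_card hI.2]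
  rw [key, ← mul_sum, Finset.sum_powerset_neg_one_pow_card]
  by_cases hAS : A = S
  · simp [hAS]
  · rw [if_neg, if_neg hAS, mul_zero]
    intro h'
    exact hAS (h.antisymm (sdiff_eq_empty_iff_subset.1 h'))

/-- After exchanging sums, each index is weighted by the signs of an interval. Hence only terms that
involve all of `S` survive an alternating sum. -/
theorem altSum_sum_subset {M : Type*} [AddCommGroup M] (S : Finset ι) {κ : Type*} (s : Finset κ)
    (A : κ → Finset ι) (hA : ∀ k ∈ s, A k ⊆ S) (f : κ → M) :
    altSum S (fun I => ∑ k ∈ s with A k ⊆ I, f k) =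
      ∑ k ∈ s with A k = S, (-1 : ℤ) ^ S.card • f k := by
  unfold altSum
  simp_rw [sum_filter, smul_sum]
  rw [sum_comm]
  refine sum_congr rfl fun k hk => ?_
  have := sum_Icc_neg_one_pow_card (hA k hk)
  rw [sum_filter] at this
  calc _ = (∑ I ∈ S.powerset, if A k ⊆ I then (-1 : ℤ) ^ I.card else 0) • f k := by
        rw [sum_smul]
        exact sum_congr rfl fun I _ => by split_ifs <;> simp
    _ = _ := by rw [this]; split_ifs <;> simp

theorem altSum_altSum {M : Type*} [AddCommGroup M] (I : Finset ι) (a : Finset ι → M) :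
    altSum I (fun A => altSum A a) = a I := by
  have h : altSum I (fun A => altSum A a) =
      altSum I (fun A => ∑ B ∈ I.powerset with id B ⊆ A, (-1 : ℤ) ^ B.card • a B) := by
    refine sum_congr rfl fun A hA => ?_
    rw [mem_powerset] at hA
    congr 1
    refine sum_congr ?_ fun _ _ => rfl
    ext B
    simp only [mem_powerset, mem_filter, id]
    exact ⟨fun h => ⟨h.trans hA, h⟩, fun h => h.2⟩
  rw [h, altSum_sum_subset I _ id (fun k hk => mem_powerset.1 hk)]
  have : ({k ∈ I.powerset | id k = I} : Finset (Finset ι)) = {I} := by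
    ext B
    simp only [mem_powerset, mem_filter, id, mem_singleton]
    exact ⟨fun h => h.2, fun h => ⟨h.le, h⟩⟩
  rw [this, sum_singleton, smul_smul, ← mul_pow]
  simp

/-- Both factors are expanded by Möbius inversion; of the resulting pairs only those that cover `S`
survive. -/
theorem altSum_mul {O : Type*} [CommRing O] (S : Finset ι) (a b : Finset ι → O) :
    altSum S (fun I => a I * b I) =
      ∑ p ∈ S.powerset ×ˢ S.powerset with p.1 ∪ p.2 = S,
        (-1 : ℤ) ^ S.card • (((-1 : ℤ) ^ p.1.card • altSum p.1 a) *
          ((-1 : ℤ) ^ p.2.card • altSum p.2 b)) := by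
  rw [← altSum_sum_subset S (S.powerset ×ˢ S.powerset) (fun p => p.1 ∪ p.2)]
  · refine sum_congr rfl fun I hI => ?_
    rw [mem_powerset] at hI
    congr 1
    beta_reduce
    conv_lhs => rw [← altSum_altSum I a, ← altSum_altSum I b]
    conv_lhs => unfold altSum
    rw [sum_mul_sum, ← sum_product']
    refine sum_congr ?_ fun _ _ => rfl
    ext p
    simp only [mem_product, mem_powerset, mem_filter, union_subset_iff]
    exact ⟨fun h => ⟨⟨h.1.trans hI, h.2.trans hI⟩, h⟩, fun h => h.2⟩
  · intro p hp
    simp only [mem_product, mem_powerset] at hp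
    exact union_subset hp.1 hp.2

end Moebius

/-! ### Logarithmic derivatives and the Riccati equation -/

section Cumulant

variable {ι k O : Type*} [CommRing k] [CommRing O] [Algebra k O]

/-- The logarithmic derivative of a unit. -/
def dlog (D : Derivation k O O) : Additive Oˣ →+ O where
  toFun u := D (u.toMul : O) * ((u.toMul⁻¹ : Oˣ) : O)
  map_zero' := by simp
  map_add' u v := by
    simp only [toMul_add, Units.val_mul, mul_inv, Derivation.leibniz, smul_eq_mul]
    have hu := u.toMul.mul_inv
    have hv := v.toMul.mul_inv
    linear_combination (D (v.toMul : O) * ((v.toMul⁻¹ : Oˣ) : O)) * hu +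
      (D (u.toMul : O) * ((u.toMul⁻¹ : Oˣ) : O)) * hv

theorem derivation_eq_mul_dlog (D : Derivation k O O) (u : Oˣ) :
    D (u : O) = u * dlog D (Additive.ofMul u) := by
  have := u.mul_inv
  simp only [dlog, AddMonoidHom.coe_mk, ZeroHom.coe_mk, toMul_ofMul]
  linear_combination (- D (u : O)) * this

theorem dlog_altProd (D : Derivation k O O) (S : Finset ι) (J : Finset ι → Oˣ) :
    dlog D (Additive.ofMul (altProd S J)) = altSum S (fun I => dlog D (Additive.ofMul (J I))) := by
  simp only [altProd, altSum, ofMul_prod, ofMul_zpow, map_sum, map_zsmul]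

theorem dvd_dlog (D : Derivation k O O) {α : O} (hα : D α = 0) {n : ℕ} (u : Oˣ)
    (h : α ^ n ∣ (u : O) - 1) : α ^ n ∣ dlog D (Additive.ofMul u) := by
  obtain ⟨v, hv⟩ := h
  refine Dvd.dvd.mul_right ⟨D v, ?_⟩ _
  have : (u : O) = α ^ n * v + 1 := by rw [← hv]; ring
  simp [this, Derivation.leibniz_pow, hα]

/-- With `p = D u / u`, a second-order linear equation for `u` becomes a first-order quadratic one
for `p`. -/
theorem D_dlog (D : Derivation k O O) (u : Oˣ) :
    D (D (u : O)) = u * (D (dlog D (Additive.ofMul u)) + dlog D (Additive.ofMul u) *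
      dlog D (Additive.ofMul u)) := by
  have h := derivation_eq_mul_dlog D u
  set p := dlog D (Additive.ofMul u)
  rw [h, Derivation.leibniz, h]
  simp only [smul_eq_mul]
  ring

theorem altSum_add {M : Type*} [AddCommGroup M] (S : Finset ι) (a b : Finset ι → M) :
    altSum S (fun I => a I + b I) = altSum S a + altSum S b := by
  simp [altSum, sum_add_distrib]

theorem altSum_sum {M κ : Type*} [AddCommGroup M] (S : Finset ι) (s : Finset κ)
    (a : κ → Finset ι → M) :
    altSum S (fun I => ∑ k ∈ s, a k I) = ∑ k ∈ s, altSum S (a k) := by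
  simp only [altSum, smul_sum]
  rw [sum_comm]

theorem altSum_const_mul (S : Finset ι) (c : O) (a : Finset ι → O) :
    altSum S (fun I => c * a I) = c * altSum S a := by
  simp [altSum, mul_sum, mul_left_comm]

theorem map_altSum {M M' F : Type*} [AddCommGroup M] [AddCommGroup M'] [FunLike F M M']
    [AddMonoidHomClass F M M'] (f : F) (S : Finset ι) (a : Finset ι → M) :
    f (altSum S a) = altSum S (fun I => f (a I)) := by
  simp [altSum]

/-- One step of the improvement of the order of vanishing of `altProd S J - 1`. -/
theorem dvd_sum_derivation_altProd [DecidableEq ι] {κ : Type*} [Fintype κ] (α : O) (D : κ → Derivation k O O)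
    (hα : ∀ i, D i α = 0) (w y : κ → O) (J : Finset ι → Oˣ) (E : Finset ι → O) (S : Finset ι)
    (heq : ∀ I ⊆ S, ∑ i, w i * D i (J I) + α * ∑ i, y i * D i (D i (J I)) = E I * J I)
    (hE : α ^ (S.card - 1) ∣ altSum S E)
    (ih : ∀ T ⊂ S, T.Nonempty → α ^ (T.card - 1) ∣ ((altProd T J : Oˣ) : O) - 1)
    {m : ℕ} (hm : m < S.card - 1) (hS : α ^ m ∣ ((altProd S J : Oˣ) : O) - 1) :
    α ^ (m + 1) ∣ ∑ i, w i * D i (altProd S J : Oˣ) := by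
  set ψ : κ → Finset ι → O := fun i I => dlog (D i) (Additive.ofMul (J I)) with hψ
  have hφT (i) (T : Finset ι) (hT : T ⊂ S) (hne : T.Nonempty) :
      α ^ (T.card - 1) ∣ altSum T (ψ i) := by
    rw [hψ, ← dlog_altProd]
    exact dvd_dlog _ (hα i) _ (ih T hT hne)
  have hφS (i) : α ^ m ∣ altSum S (ψ i) := by
    rw [hψ, ← dlog_altProd]
    exact dvd_dlog _ (hα i) _ hS
  -- The only nonlinear term. In a covering pair either one member is `S`, and the known order `m`
  -- applies, or both are proper, hence nonempty, and the induction hypothesis applies to each.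
  have hsq (i) : α ^ m ∣ altSum S (fun I => ψ i I * ψ i I) := by
    rw [altSum_mul]
    refine dvd_sum fun p hp => dvd_smul_of_dvd _ ?_
    simp only [mem_filter, mem_product, mem_powerset] at hp
    obtain ⟨⟨h1, h2⟩, h3⟩ := hp
    rcases eq_or_ne p.1 S with hS1 | hS1
    · rw [hS1]
      exact (dvd_smul_of_dvd _ (hφS i)).mul_right _
    rcases eq_or_ne p.2 S with hS2 | hS2
    · rw [hS2]
      exact (dvd_smul_of_dvd _ (hφS i)).mul_left _
    have ne1 : p.1.Nonempty := by
      rw [nonempty_iff_ne_empty]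
      rintro h
      rw [h, empty_union] at h3
      exact hS2 h3
    have ne2 : p.2.Nonempty := by
      rw [nonempty_iff_ne_empty]
      rintro h
      rw [h, union_empty] at h3
      exact hS1 h3
    -- The cardinalities add up to at least `|S|`, so the orders add up to at least `|S| - 2 ≥ m`.
    refine dvd_trans (pow_dvd_pow α (?_ : m ≤ (p.1.card - 1) + (p.2.card - 1))) ?_
    · have := card_union_le p.1 p.2
      rw [h3] at this
      have := ne1.card_pos
      have := ne2.card_pos
      omega
    · rw [pow_add]
      exact mul_dvd_mul
        (dvd_smul_of_dvd _ (hφT i _ (h1.ssubset_of_ne hS1) ne1))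
        (dvd_smul_of_dvd _ (hφT i _ (h2.ssubset_of_ne hS2) ne2))
  have hd (i) : α ^ m ∣ D i (altSum S (ψ i)) := by
    obtain ⟨v, hv⟩ := hφS i
    refine ⟨D i v, ?_⟩
    simp [hv, Derivation.leibniz_pow, hα]
  have hric (I) (hI : I ⊆ S) : ∑ i, w i * ψ i I +
      α * ∑ i, y i * (D i (ψ i I) + ψ i I * ψ i I) = E I := by
    have h := heq I hI
    have h1 (i) : D i (J I : O) = J I * ψ i I := derivation_eq_mul_dlog _ _
    have h2 (i) := D_dlog (D i) (J I)
    simp_rw [h2, h1] at h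
    apply (J I).isUnit.mul_left_cancel
    rw [mul_comm (J I : O) (E I), ← h, mul_add, mul_left_comm (J I : O) α, mul_sum, mul_sum]
    congr 1
    · exact sum_congr rfl fun i _ => by ring
    · congr 1
      exact sum_congr rfl fun i _ => by ring
  have htot : ∑ i, w i * altSum S (ψ i) +
      α * ∑ i, y i * (D i (altSum S (ψ i)) + altSum S (fun I => ψ i I * ψ i I)) =
      altSum S E := by
    have : altSum S E = altSum S (fun I => ∑ i, w i * ψ i I +
      α * ∑ i, y i * (D i (ψ i I) + ψ i I * ψ i I)) :=
      sum_congr rfl fun I hI => by beta_reduce; rw [hric I (mem_powerset.1 hI)]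
    rw [this]
    simp_rw [altSum_add, altSum_const_mul, altSum_sum, altSum_const_mul, altSum_add, map_altSum]
  -- The order `m` of the second-order part becomes `m + 1` by its explicit factor `α`; the
  -- right-hand side has order `|S| - 1 ≥ m + 1`.
  have hmain : α ^ (m + 1) ∣ ∑ i, w i * altSum S (ψ i) := by
    rw [eq_sub_of_add_eq htot]
    refine dvd_sub ((pow_dvd_pow α (by omega)).trans hE) ?_
    rw [pow_succ']
    exact mul_dvd_mul_left α (dvd_sum fun i _ => ((hd i).add (hsq i)).mul_left _)
  have : ∑ i, w i * D i (altProd S J : Oˣ) = ((altProd S J : Oˣ) : O) * ∑ i, w i * altSum S (ψ i) := by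
    rw [mul_sum]
    refine sum_congr rfl fun i _ => ?_
    rw [hψ, ← dlog_altProd]
    rw [derivation_eq_mul_dlog, mul_left_comm]
  rw [this]
  exact hmain.mul_left _

end Cumulant

end Jack

namespace Jack

open Finset IntPartition

/-! ### Sequences with small iterated differences -/

section SlowlyVarying

variable {O : Type*} [CommRing O] {α : O}

/-- `Slow α k a`: the first `k` iterated differences of the sequence `a`, with arbitrary steps, are
divisible by `α, α ^ 2, …, α ^ k`. -/
def Slow (α : O) : ℕ → (ℕ → O) → Prop
  | 0, _ => True
  | k + 1, a => ∀ d, ∃ b, Slow α k b ∧ ∀ n, a (n + d) = a n + α * b n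

theorem Slow.of_succ {k : ℕ} {a : ℕ → O} (h : Slow α (k + 1) a) : Slow α k a := by
  induction k generalizing a with
  | zero => trivial
  | succ k ih =>
    intro d
    obtain ⟨b, hb, hab⟩ := h d
    exact ⟨b, ih hb, hab⟩

theorem Slow.const (k : ℕ) (c : O) : Slow α k fun _ => c := by
  induction k generalizing c with
  | zero => trivial
  | succ k ih => exact fun d => ⟨fun _ => 0, ih 0, by simp⟩

theorem Slow.add {k : ℕ} {a b : ℕ → O} (ha : Slow α k a) (hb : Slow α k b) :
    Slow α k fun n => a n + b n := by
  induction k generalizing a b with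
  | zero => trivial
  | succ k ih =>
    intro d
    obtain ⟨a', ha', h1⟩ := ha d
    obtain ⟨b', hb', h2⟩ := hb d
    exact ⟨_, ih ha' hb', fun n => by simp only [h1, h2]; ring⟩

theorem Slow.shift {k : ℕ} {a : ℕ → O} (ha : Slow α k a) (d : ℕ) : Slow α k fun n => a (n + d) := by
  induction k generalizing a with
  | zero => trivial
  | succ k ih =>
    intro e
    obtain ⟨a', ha', h1⟩ := ha e
    exact ⟨_, ih ha', fun n => by simp only [← h1, add_right_comm]⟩

/-- Leibniz rule for differences: the difference of `a b` is `α` times `a' n * b (n + d) + a n * b'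
n`. -/
theorem Slow.mul {k : ℕ} {a b : ℕ → O} (ha : Slow α k a) (hb : Slow α k b) :
    Slow α k fun n => a n * b n := by
  induction k generalizing a b with
  | zero => trivial
  | succ k ih =>
    intro d
    obtain ⟨a', ha', h1⟩ := ha d
    obtain ⟨b', hb', h2⟩ := hb d
    refine ⟨_, (ih ha' (hb.shift d).of_succ).add (ih ha.of_succ hb'), fun n => ?_⟩
    simp only [h1, h2]
    ring

theorem Slow.prod {κ : Type*} {k : ℕ} (s : Finset κ) {a : κ → ℕ → O}
    (ha : ∀ i ∈ s, Slow α k (a i)) : Slow α k fun n => ∏ i ∈ s, a i n := by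
  classical
  induction s using Finset.induction with
  | empty => simpa using Slow.const k (1 : O)
  | insert i s hi ih =>
    simp_rw [prod_insert hi]
    exact (ha i (mem_insert_self i s)).mul (ih fun j hj => ha j (mem_insert_of_mem hj))

/-- The difference of `1 / u` is `-α b n / (u n * u (n + d))`, in which inverses are needed one
level lower only. -/
theorem Slow.inv {k : ℕ} {u : ℕ → Oˣ} (ha : Slow α k fun n => (u n : O)) :
    Slow α k fun n => ((u n)⁻¹ : Oˣ) := by
  induction k with
  | zero => trivial
  | succ k ih =>
    intro d
    obtain ⟨b, hb, h⟩ := ha d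
    refine ⟨_, (Slow.const k (-1)).mul ((hb.mul (ih ha.of_succ)).mul ((ih ha.of_succ).shift d)),
      fun n => ?_⟩
    have h1 := (u n).mul_inv
    have h2 := (u (n + d)).mul_inv
    simp only at h ⊢
    linear_combination -(((u n)⁻¹ : Oˣ) : O) * (((u (n + d))⁻¹ : Oˣ) : O) * h n +
      (((u n)⁻¹ : Oˣ) : O) * h2 - (((u (n + d))⁻¹ : Oˣ) : O) * h1

theorem altProd_insert {ι G : Type*} [DecidableEq ι] [CommGroup G] {s : ι} {S : Finset ι}
    (hs : s ∉ S) (u : Finset ι → G) :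
    altProd (insert s S) u = altProd S u / altProd S fun I => u (insert s I) := by
  simp only [altProd]
  rw [prod_powerset_insert hs, div_eq_mul_inv, ← prod_inv_distrib]
  congr 1
  refine prod_congr rfl fun I hI => ?_
  rw [card_insert_of_notMem fun h => hs (mem_powerset.1 hI h), ← zpow_neg, pow_succ]
  simp

/-- Adding `s` to `S` replaces the alternating product `u n` by `u n / u (n + x s)`. If `u = 1 +
α^{|S|-1} h` with `h` slow, this quotient differs from `1` by a difference of `h`, which gains a
factor `α` and loses one level of slowness; hence the level `k` must be arbitrary. Only ratios of
values of `f` are assumed slow, as `f` itself need not be. -/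
theorem Slow.altProd {ι : Type*} [DecidableEq ι] (f : ℕ → Oˣ)
    (hf : ∀ d k, Slow α k fun n => ((f n / f (n + d) : Oˣ) : O)) (x : ι → ℕ) (S : Finset ι)
    (hS : S.Nonempty) (k : ℕ) :
    ∃ h, Slow α k h ∧ ∀ n, ((altProd S fun I => f (n + ∑ i ∈ I, x i) : Oˣ) : O) =
      1 + α ^ (S.card - 1) * h n := by
  induction S using Finset.induction generalizing k with
  | empty => exact absurd rfl hS.ne_empty
  | insert s S hs ih =>
    have key (n : ℕ) : (Jack.altProd (insert s S) fun I => f (n + ∑ i ∈ I, x i)) =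
        (Jack.altProd S fun I => f (n + ∑ i ∈ I, x i)) /
          (Jack.altProd S fun I => f (n + x s + ∑ i ∈ I, x i)) := by
      rw [altProd_insert hs]
      congr 1
      refine prod_congr rfl fun I hI => ?_
      beta_reduce
      rw [sum_insert fun h => hs (mem_powerset.1 hI h), ← add_assoc]
    simp_rw [key, card_insert_of_notMem hs, Nat.add_sub_cancel]
    rcases S.eq_empty_or_nonempty with rfl | hne
    -- For a single element the exponent of `α` is `0`, and the remainder is the ratio minus `1`.
    · refine ⟨_, (hf (x s) k).add (Slow.const k (-1)), fun n => ?_⟩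
      simp [Jack.altProd]
    · obtain ⟨h, hh, hu⟩ := ih hne (k + 1)
      obtain ⟨b, hb, hhb⟩ := hh (x s)
      have hcard : S.card = S.card - 1 + 1 := by have := hne.card_pos; omega
      set u : ℕ → Oˣ := fun n => Jack.altProd S fun I => f (n + ∑ i ∈ I, x i) with hudef
      have hus : Slow α k fun n => (u n : O) := by
        simp_rw [hudef, hu]
        exact (Slow.const k 1).add ((Slow.const k _).mul hh.of_succ)
      refine ⟨_, (Slow.const k (-1)).mul (hb.mul (hus.inv.shift (x s))), fun n => ?_⟩
      change ((u n / u (n + x s) : Oˣ) : O) = _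
      rw [div_eq_mul_inv, Units.val_mul]
      have h1 := hu n
      have h2 := hu (n + x s)
      have h3 := (u (n + x s)).mul_inv
      change (u n : O) = _ at h1
      change (u (n + x s) : O) = _ at h2
      rw [hhb] at h2
      rw [hcard, pow_succ]
      linear_combination (((u (n + x s))⁻¹ : Oˣ) : O) * (h1 - h2) + h3

/-- The units congruent to `1` modulo `α ^ m`. -/
def unitsCongrOne (α : O) (m : ℕ) : Subgroup Oˣ where
  carrier := {u | α ^ m ∣ (u : O) - 1}
  one_mem' := by simp
  mul_mem' := by
    intro u v hu hv
    have : ((u * v : Oˣ) : O) - 1 = ((u : O) - 1) * v + ((v : O) - 1) := by push_cast; ring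
    change α ^ m ∣ _
    rw [this]
    exact (Dvd.dvd.mul_right hu _).add hv
  inv_mem' := by
    intro u hu
    have : ((u⁻¹ : Oˣ) : O) - 1 = ((u : O) - 1) * (-((u⁻¹ : Oˣ) : O)) := by
      linear_combination u.mul_inv
    change α ^ m ∣ _
    rw [this]
    exact Dvd.dvd.mul_right hu _

theorem mem_unitsCongrOne {m : ℕ} {u : Oˣ} : u ∈ unitsCongrOne α m ↔ α ^ m ∣ (u : O) - 1 := Iff.rfl

/-- If `f n = ∏ a < n, (c + α * a)` then the alternating product of `f` over the subset sums of a
nonempty family is congruent to `1` modulo a power of `α`. -/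
theorem altProd_mem_unitsCongrOne {ι : Type*} [DecidableEq ι] {c : O} (g : ℕ → Oˣ)
    (hg : ∀ n, (g n : O) = c + α * n) (x : ι → ℕ) {S : Finset ι} (hS : S.Nonempty) :
    (altProd S fun I => ∏ a ∈ range (∑ i ∈ I, x i), g a) ∈ unitsCongrOne α (S.card - 1) := by
  have hgs (k : ℕ) : Slow α k fun n => (g n : O) := by
    simp_rw [hg]
    cases k with
    | zero => trivial
    | succ k => exact fun d => ⟨_, Slow.const k (d : O), fun n => by push_cast; ring⟩
  -- The ratio of the values at `n` and `n + d` is a product of `d` inverses, a number of slow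
  -- factors that does not depend on `n`.
  obtain ⟨h, -, hu⟩ := Slow.altProd (α := α) (fun n => ∏ a ∈ range n, g a) (fun d k => by
    have (n : ℕ) : ((∏ a ∈ range n, g a) / ∏ a ∈ range (n + d), g a) =
        ∏ a ∈ range d, (g (n + a))⁻¹ := by
      rw [prod_range_add, div_mul_cancel_left, prod_inv_distrib]
    simp_rw [this, Units.coe_prod]
    refine Slow.prod _ fun a _ => ?_
    simp_rw [add_comm _ a]
    have := (hgs k).inv.shift a
    simp_rw [add_comm _ a] at this
    exact this) x S hS 0
  have := hu 0
  simp only [zero_add] at this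
  rw [mem_unitsCongrOne, this]
  exact ⟨h 0, by ring⟩

end SlowlyVarying

/-! ### Strong factorization of hook products -/

section Hook

/-- The hook product of `lam` with parameter `α`. -/
noncomputable def hookProd {K : Type*} [CommSemiring K] (α : K) (lam : IntPartition) : K :=
  ∏ s ∈ lam.boxes, (α * (lam.arm s : K) + (lam.leg s : K) + 1)

theorem map_hookProd {K L : Type*} [CommSemiring K] [CommSemiring L] (φ : K →+* L) (α : K)
    (lam : IntPartition) : φ (hookProd α lam) = hookProd (φ α) lam := by
  simp [hookProd, map_prod]

theorem IntPartition.support_eq_range (lam : IntPartition) : lam.1.support = range lam.length := by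
  have hsub : ∀ i ∈ lam.1.support, range (i + 1) ⊆ lam.1.support := by
    intro i hi j hj
    rw [Finsupp.mem_support_iff] at hi ⊢
    have := lam.2 (Nat.lt_succ_iff.1 (mem_range.1 hj))
    omega
  refine eq_of_subset_of_card_le (fun i hi => ?_) (by simp [length])
  have := card_le_card (hsub i hi)
  rw [card_range] at this
  exact mem_range.2 this

theorem IntPartition.apply_eq_zero {lam : IntPartition} {i : ℕ} (h : lam.length ≤ i) :
    lam.1 i = 0 := by
  by_contra hne
  have : i ∈ lam.1.support := Finsupp.mem_support_iff.2 hne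
  rw [lam.support_eq_range, mem_range] at this
  omega

theorem IntPartition.conj_apply_eq {lam : IntPartition} {t j : ℕ} (h1 : lam.1 (t + 1) ≤ j)
    (h2 : j < lam.1 t) : lam.conj.1 j = t + 1 := by
  change (lam.1.support.filter fun i => j < lam.1 i).card = t + 1
  have : (lam.1.support.filter fun i => j < lam.1 i) = range (t + 1) := by
    ext i
    simp only [mem_filter, Finsupp.mem_support_iff, mem_range]
    constructor
    · rintro ⟨-, h⟩
      by_contra hi
      have := lam.2 (not_lt.1 hi)
      omega
    · intro hi
      have := lam.2 (Nat.lt_succ_iff.1 hi)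
      omega
  rw [this, card_range]

/-- Columns are grouped by their length, which is constant between consecutive parts. -/
theorem prod_range_eq_prod_Ico {M : Type*} [CommMonoid M] (lam : IntPartition) (i n : ℕ)
    (F : ℕ → ℕ → M) :
    ∏ j ∈ Ico (lam.1 (i + n)) (lam.1 i), F j (lam.conj.1 j) =
      ∏ t ∈ range n, ∏ j ∈ Ico (lam.1 (i + t + 1)) (lam.1 (i + t)), F j (i + t + 1) := by
  induction n with
  | zero => simp
  | succ n ih =>
    rw [prod_range_succ, ← ih, mul_comm, ← add_assoc,
      ← prod_Ico_consecutive (fun j => F j (lam.conj.1 j))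
        (lam.2 (Nat.le_succ (i + n))) (lam.2 (Nat.le_add_right i n))]
    congr 1
    refine prod_congr rfl fun j hj => ?_
    rw [mem_Ico] at hj
    rw [conj_apply_eq hj.1 hj.2]

/-- The boxes of row `i` with leg-length `t` are consecutive, so their arm-lengths fill an interval.
Its end points are differences of parts, hence additive in the partition. -/
theorem hookProd_eq {K : Type*} [CommSemiring K] (α : K) (lam : IntPartition) {N : ℕ}
    (hN : lam.length ≤ N) :
    hookProd α lam = ∏ i ∈ range N, ∏ t ∈ range (N - i),
      ∏ a ∈ Ico (lam.1 i - lam.1 (i + t)) (lam.1 i - lam.1 (i + t + 1)),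
        (α * (a : K) + (t : K) + 1) := by
  have h1 : hookProd α lam = ∏ i ∈ range N, ∏ j ∈ range (lam.1 i),
      (α * ((lam.1 i - (j + 1) : ℕ) : K) + ((lam.conj.1 j - (i + 1) : ℕ) : K) + 1) := by
    rw [hookProd, boxes, prod_sigma]
    refine prod_subset ?_ ?_
    · rw [lam.support_eq_range]
      exact range_subset_range.2 hN
    · intro i _ hi
      rw [Finsupp.notMem_support_iff] at hi
      simp [hi]
  rw [h1]
  refine prod_congr rfl fun i hi => ?_
  have h0 : lam.1 (i + (N - i)) = 0 := apply_eq_zero (by omega)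
  have h2 := prod_range_eq_prod_Ico lam i (N - i) fun j t =>
    (α * ((lam.1 i - (j + 1) : ℕ) : K) + ((t - (i + 1) : ℕ) : K) + 1)
  rw [h0, ← range_eq_Ico] at h2
  rw [h2]
  refine prod_congr rfl fun t _ => ?_
  have hle : lam.1 (i + t + 1) ≤ lam.1 (i + t) := lam.2 (Nat.le_succ _)
  have hle' : lam.1 (i + t) ≤ lam.1 i := lam.2 (Nat.le_add_right _ _)
  refine prod_nbij' (fun j => lam.1 i - (j + 1)) (fun a => lam.1 i - (a + 1)) ?_ ?_ ?_ ?_ ?_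
  · intro j hj
    simp only [mem_Ico] at hj ⊢
    omega
  · intro j hj
    simp only [mem_Ico] at hj ⊢
    omega
  · intro j hj
    simp only [mem_Ico] at hj ⊢
    omega
  · intro j hj
    simp only [mem_Ico] at hj ⊢
    omega
  · intro j hj
    rw [show i + t + 1 - (i + 1) = t by omega]

/-- The hook products of the sums of subfamilies of a nonempty family of partitions have the strong
factorization property. -/
theorem altProd_hook_mem {O ι : Type*} [CommRing O] [DecidableEq ι] {α : O} (g : ℕ → ℕ → Oˣ)
    (hg : ∀ t n, (g t n : O) = (t : O) + 1 + α * n) (lam : ι → IntPartition) {S : Finset ι}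
    (hS : S.Nonempty) (H : Finset ι → Oˣ)
    (hH : ∀ I ⊆ S, (H I : O) = hookProd α (∑ i ∈ I, lam i)) :
    altProd S H ∈ unitsCongrOne α (S.card - 1) := by
  -- A common bound on the lengths makes the index set of the product independent of `I`.
  set N := S.powerset.sup fun I => (∑ i ∈ I, lam i).length with hNdef
  have hcoe (I : Finset ι) (k : ℕ) : (∑ i ∈ I, lam i).1 k = ∑ i ∈ I, (lam i).1 k := by
    have h := map_sum partitionMonoid.subtype lam I
    simp only [AddSubmonoid.subtype_apply] at h
    rw [h, Finsupp.finsetSum_apply]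
  -- Truncated subtraction is additive here because each partition is weakly decreasing.
  have hsub (I : Finset ι) {k l : ℕ} (hkl : k ≤ l) :
      (∑ i ∈ I, lam i).1 k - (∑ i ∈ I, lam i).1 l = ∑ i ∈ I, ((lam i).1 k - (lam i).1 l) := by
    rw [hcoe, hcoe, sum_tsub_distrib I fun i _ => (lam i).2 hkl]
  have key (I) (hI : I ∈ S.powerset) : H I = ∏ i ∈ range N, ∏ t ∈ range (N - i),
      (∏ a ∈ range (∑ j ∈ I, ((lam j).1 i - (lam j).1 (i + t + 1))), g t a) /
      (∏ a ∈ range (∑ j ∈ I, ((lam j).1 i - (lam j).1 (i + t))), g t a) := by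
    apply Units.ext
    rw [hH I (mem_powerset.1 hI),
      hookProd_eq α _ (Finset.le_sup (f := fun I => (∑ i ∈ I, lam i).length) hI), Units.coe_prod]
    refine prod_congr rfl fun i _ => ?_
    rw [Units.coe_prod]
    refine prod_congr rfl fun t _ => ?_
    rw [← hsub I (by omega : i ≤ i + t + 1), ← hsub I (by omega : i ≤ i + t),
      ← prod_Ico_eq_div, Units.coe_prod]
    · exact prod_congr rfl fun a _ => by rw [hg]; ring
    · exact Nat.sub_le_sub_left ((∑ i ∈ I, lam i).2 (Nat.le_succ _)) _
  have h2 : altProd S H = ∏ i ∈ range N, ∏ t ∈ range (N - i),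
      (altProd S fun I => ∏ a ∈ range (∑ j ∈ I, ((lam j).1 i - (lam j).1 (i + t + 1))), g t a) /
      (altProd S fun I => ∏ a ∈ range (∑ j ∈ I, ((lam j).1 i - (lam j).1 (i + t))), g t a) := by
    simp only [altProd]
    rw [prod_congr rfl fun I hI => by rw [key I hI]]
    simp_rw [← prod_div_distrib, ← div_zpow, ← prod_zpow]
    rw [prod_comm]
    refine prod_congr rfl fun i _ => ?_
    rw [prod_comm]
  rw [h2]
  refine Subgroup.prod_mem _ fun i _ => Subgroup.prod_mem _ fun t _ => Subgroup.div_mem _ ?_ ?_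
  · exact altProd_mem_unitsCongrOne (c := (t : O) + 1) (g t) (hg t) _ hS
  · exact altProd_mem_unitsCongrOne (c := (t : O) + 1) (g t) (hg t) _ hS

end Hook

end Jack

namespace Jack

open Finset MvPolynomial

/-! ### The two-variable operator `(x_i² ∂_i - x_j² ∂_j) / (x_i - x_j)` -/

section PairOp

variable {σ K : Type*}

/-- The exponent `e` with its entries at `i` and `j` replaced by `a` and `e i + e j - a`. -/
noncomputable def move (e : σ →₀ ℕ) (i j : σ) (a : ℕ) : σ →₀ ℕ :=
  (e.update i a).update j (e i + e j - a)

theorem move_apply [DecidableEq σ] (e : σ →₀ ℕ) (i j : σ) (a : ℕ) (k : σ) :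
    move e i j a k = if k = j then e i + e j - a else if k = i then a else e k := by
  simp [move, Function.update_apply]

theorem update_update_eq_iff {e m : σ →₀ ℕ} {i j : σ} (hij : i ≠ j) {a b : ℕ} :
    (e.update i a).update j b = m ↔ m i = a ∧ m j = b ∧ ∀ k, k ≠ i → k ≠ j → m k = e k := by
  classical
  constructor
  · rintro rfl
    refine ⟨by simp [hij], by simp, fun k h1 h2 => ?_⟩
    simp [h1, h2]
  · rintro ⟨h1, h2, h3⟩
    ext k
    by_cases hj : k = j
    · simp [hj, h2]
    by_cases hi : k = i
    · simp [hi, hij, h1]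
    simp [hi, hj, h3]

variable [CommRing K]

/-- The linear operator on polynomials that agrees on symmetric polynomials with
`(x_i ^ 2 * ∂_i - x_j ^ 2 * ∂_j) / (x_i - x_j)`. -/
noncomputable def pairOp (i j : σ) : MvPolynomial σ K →ₗ[K] MvPolynomial σ K :=
  (basisMonomials σ K).constr K fun m =>
    monomial m (m i : K) + ∑ a ∈ range (m i), monomial (move m i j a) ((m i : K) - m j)

/-- The obstruction to `pairOp` being `(x_i ^ 2 * ∂_i - x_j ^ 2 * ∂_j) / (x_i - x_j)`. -/
noncomputable def pairDefect (i j : σ) : MvPolynomial σ K →ₗ[K] MvPolynomial σ K :=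
  (basisMonomials σ K).constr K fun m =>
    monomial ((m.update i 0).update j (m i + m j + 1)) ((m i : K) - m j)

theorem pairOp_monomial (i j : σ) (m : σ →₀ ℕ) (c : K) :
    pairOp i j (monomial m c) = monomial m (c * m i) +
      ∑ a ∈ range (m i), monomial (move m i j a) (c * ((m i : K) - m j)) := by
  have h : monomial m c = c • basisMonomials σ K m := by simp [smul_monomial]
  rw [h, map_smul, pairOp, Module.Basis.constr_basis, smul_add, smul_monomial, smul_sum]
  simp only [smul_monomial, smul_eq_mul]

theorem pairDefect_monomial (i j : σ) (m : σ →₀ ℕ) (c : K) :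
    pairDefect i j (monomial m c) =
      monomial ((m.update i 0).update j (m i + m j + 1)) (c * ((m i : K) - m j)) := by
  have h : monomial m c = c • basisMonomials σ K m := by simp [smul_monomial]
  rw [h, map_smul, pairDefect, Module.Basis.constr_basis, smul_monomial, smul_eq_mul]

/-- A monomial contributes only to itself and to exponents with a smaller entry at `i`. Read
backwards, the coefficient at `e` involves only exponents in which entry `i` is raised at the
expense of entry `j`; this triangularity drives the later inductions. -/
theorem coeff_pairOp {i j : σ} (hij : i ≠ j) (f : MvPolynomial σ K) (e : σ →₀ ℕ) :
    coeff e (pairOp i j f) = e i * coeff e f +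
      ∑ a ∈ Ioc (e i) (e i + e j), (2 * a - e i - e j) * coeff (move e i j a) f := by
  classical
  induction f using MvPolynomial.induction_on' with
  | add p q hp hq =>
    simp only [map_add, coeff_add, hp, hq, mul_add, sum_add_distrib]
    ring
  | monomial m c =>
    rw [pairOp_monomial, coeff_add, coeff_sum]
    simp only [coeff_monomial]
    congr 1
    · split_ifs with h
      · rw [h, mul_comm]
      · simp
    · simp_rw [mul_ite, mul_zero, ← sum_filter]
      have h1 (a) : move m i j a = e ↔ e i = a ∧ e j = m i + m j - a ∧
        ∀ k, k ≠ i → k ≠ j → e k = m k := update_update_eq_iff hij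
      have h2 (a) : m = move e i j a ↔ m i = a ∧ m j = e i + e j - a ∧
        ∀ k, k ≠ i → k ≠ j → m k = e k := by rw [eq_comm]; exact update_update_eq_iff hij
      refine sum_nbij' (fun _ => m i) (fun _ => e i) ?_ ?_ ?_ ?_ ?_
      · intro a ha
        simp only [mem_filter, mem_range, mem_Ioc, h1, h2] at ha ⊢
        obtain ⟨h, h', h'', h3⟩ := ha
        exact ⟨by omega, trivial, by omega, fun k hi hj => (h3 k hi hj).symm⟩
      · intro a ha
        simp only [mem_filter, mem_range, mem_Ioc, h1, h2] at ha ⊢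
        obtain ⟨h, h', h'', h3⟩ := ha
        exact ⟨by omega, trivial, by omega, fun k hi hj => (h3 k hi hj).symm⟩
      · intro a ha
        simp only [mem_filter, h1] at ha
        exact ha.2.1
      · intro a ha
        simp only [mem_filter, h2] at ha
        exact ha.2.1
      · intro a ha
        simp only [mem_filter, mem_range, h1] at ha
        obtain ⟨h, h', h'', h3⟩ := ha
        have : ((e i + e j : ℕ) : K) = ((m i + m j : ℕ) : K) := by congr 1; omega
        push_cast at this
        linear_combination c * this

theorem monomial_update_update (m : σ →₀ ℕ) {i j : σ} (hij : i ≠ j) (a b : ℕ) (c : K) :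
    monomial ((m.update i a).update j b) c =
      monomial ((m.update i 0).update j 0) c * X i ^ a * X j ^ b := by
  classical
  rw [X_pow_eq_monomial, X_pow_eq_monomial, monomial_mul, monomial_mul, mul_one, mul_one]
  congr 2
  rw [update_update_eq_iff hij]
  refine ⟨?_, ?_, fun k h1 h2 => ?_⟩
  · simp [hij]
  · simp [hij.symm]
  · simp [h1, h2]

/-- On a monomial the sum over `a` is a geometric sum; multiplied by `x_i - x_j` it telescopes, and
the end term in `x_j^{m_i + m_j + 1}` is the defect. -/
theorem sub_mul_pairOp {i j : σ} (hij : i ≠ j) (f : MvPolynomial σ K) :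
    (X i - X j) * pairOp i j f =
      X i ^ 2 * pderiv i f - X j ^ 2 * pderiv j f - pairDefect i j f := by
  induction f using MvPolynomial.induction_on' with
  | add p q hp hq =>
    simp only [map_add, mul_add, hp, hq]
    ring
  | monomial m c =>
    have hself : m = (m.update i (m i)).update j (m j) := by simp
    obtain ⟨M, hM⟩ : ∃ M : MvPolynomial σ K, ∀ a b,
        monomial ((m.update i a).update j b) c = M * X i ^ a * X j ^ b :=
      ⟨_, fun a b => monomial_update_update m hij a b c⟩
    have hm : (monomial m c : MvPolynomial σ K) = M * X i ^ m i * X j ^ m j := by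
      rw [← hM, ← hself]
    have hC (n : σ →₀ ℕ) (x y : K) : monomial n (x * y) = C y * monomial n x := by
      rw [C_mul_monomial, mul_comm]
    have hd (k : σ) : X k ^ 2 * pderiv k (monomial m c) = X k * (C (m k : K) * monomial m c) := by
      rw [pow_two, mul_assoc, X_mul_pderiv_monomial]
      simp
    rw [hd, hd, pairOp_monomial, pairDefect_monomial]
    simp only [move, hC, hM, hm]
    have hg := (Commute.all (X i : MvPolynomial σ K) (X j)).mul_geom_sum₂ (m i)
    have hs : ∑ a ∈ range (m i), C ((m i : K) - m j) *
        (M * X i ^ a * X j ^ (m i + m j - a)) =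
        C ((m i : K) - m j) * M * X j ^ (m j + 1) *
          ∑ a ∈ range (m i), X i ^ a * X j ^ (m i - 1 - a) := by
      rw [mul_sum]
      refine sum_congr rfl fun a ha => ?_
      rw [mem_range] at ha
      rw [show m i + m j - a = (m j + 1) + (m i - 1 - a) by omega, pow_add]
      ring
    rw [hs, mul_add, mul_left_comm _ (_ * _ * _), hg]
    simp only [map_sub, map_natCast]
    ring

/-- The exponent depends only on `m_i + m_j` while the coefficient `m_i - m_j` changes sign. In
characteristic zero the defect therefore vanishes on symmetric polynomials. -/
theorem pairDefect_rename_swap [DecidableEq σ] {i j : σ} (hij : i ≠ j) (f : MvPolynomial σ K) :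
    pairDefect i j (rename (Equiv.swap i j) f) = - pairDefect i j f := by
  induction f using MvPolynomial.induction_on' with
  | add p q hp hq => simp only [map_add, hp, hq, neg_add]
  | monomial m c =>
    have hap (k) : (m.mapDomain (Equiv.swap i j)) k = m (Equiv.swap i j k) := by
      conv_lhs => rw [← Equiv.swap_apply_self i j k]
      exact Finsupp.mapDomain_apply (Equiv.injective _) _ _
    rw [rename_monomial, pairDefect_monomial, pairDefect_monomial, ← map_neg]
    congr 1
    · rw [hap, hap, Equiv.swap_apply_left, Equiv.swap_apply_right, add_comm (m j)]
      congr 1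
      rw [update_update_eq_iff hij]
      refine ⟨by simp [hij], by simp, fun k h1 h2 => ?_⟩
      rw [hap, Equiv.swap_apply_of_ne_of_ne h1 h2]
      simp [h1, h2]
    · rw [hap, hap, Equiv.swap_apply_left, Equiv.swap_apply_right]
      ring

theorem map_pairOp {L : Type*} [CommRing L] (φ : K →+* L) (i j : σ) (f : MvPolynomial σ K) :
    map φ (pairOp i j f) = pairOp i j (map φ f) := by
  induction f using MvPolynomial.induction_on' with
  | add p q hp hq => simp only [map_add, hp, hq]
  | monomial m c => simp [pairOp_monomial, map_monomial]

variable [IsDomain K] [CharZero K]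

theorem sub_mul_pairOp_of_isSymmetric {i j : σ} (hij : i ≠ j) {f : MvPolynomial σ K}
    (hf : f.IsSymmetric) :
    (X i - X j) * pairOp i j f = X i ^ 2 * pderiv i f - X j ^ 2 * pderiv j f := by
  classical
  have h := pairDefect_rename_swap hij f
  rw [hf (Equiv.swap i j), self_eq_neg] at h
  rw [sub_mul_pairOp hij, h, sub_zero]

theorem X_sub_X_ne_zero {σ K : Type*} [CommRing K] [CharZero K] {i j : σ} (hij : i ≠ j) : (X i - X j : MvPolynomial σ K) ≠ 0 :=
  sub_ne_zero.2 fun h => hij (X_injective h)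

theorem pairOp_comm {i j : σ} (hij : i ≠ j) {f : MvPolynomial σ K} (hf : f.IsSymmetric) :
    pairOp i j f = pairOp j i f := by
  apply mul_left_cancel₀ (X_sub_X_ne_zero (K := K) hij)
  rw [sub_mul_pairOp_of_isSymmetric hij hf]
  linear_combination sub_mul_pairOp_of_isSymmetric hij.symm hf

theorem rename_pairOp {i j : σ} (hij : i ≠ j) (s : Equiv.Perm σ) {f : MvPolynomial σ K}
    (hf : f.IsSymmetric) : rename s (pairOp i j f) = pairOp (s i) (s j) f := by
  have hs : s i ≠ s j := s.injective.ne hij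
  apply mul_left_cancel₀ (X_sub_X_ne_zero (K := K) hs)
  have h := congrArg (rename s) (sub_mul_pairOp_of_isSymmetric hij hf)
  rw [sub_mul_pairOp_of_isSymmetric hs hf]
  simp only [map_mul, map_sub, rename_X, map_pow] at h
  rw [h, ← pderiv_rename s.injective, ← pderiv_rename s.injective, hf s]

end PairOp

/-! ### The first-order part of the Laplace–Beltrami operator -/

section LbOp

variable {N : ℕ} {K : Type*} [CommRing K]

/-- The part of the Laplace–Beltrami operator that is of first order, for symmetric polynomials. -/
noncomputable def lbOp (f : MvPolynomial (Fin N) K) : MvPolynomial (Fin N) K :=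
  ∑ i, ∑ j ∈ Ioi i, pairOp i j f

theorem map_lbOp {L : Type*} [CommRing L] (φ : K →+* L) (f : MvPolynomial (Fin N) K) :
    map φ (lbOp f) = lbOp (map φ f) := by
  simp [lbOp, map_sum, map_pairOp]

theorem coeff_lbOp (f : MvPolynomial (Fin N) K) (e : Fin N →₀ ℕ) :
    coeff e (lbOp f) = (∑ i : Fin N, ((N - 1 - i : ℕ) : K) * e i) * coeff e f +
      ∑ i, ∑ j ∈ Ioi i, ∑ a ∈ Ioc (e i) (e i + e j),
        (2 * a - e i - e j) * coeff (move e i j a) f := by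
  rw [lbOp, coeff_sum]
  simp_rw [coeff_sum]
  have h (i j : Fin N) (hj : j ∈ Ioi i) := coeff_pairOp (mem_Ioi.1 hj).ne f e
  rw [sum_congr rfl fun i _ => sum_congr rfl fun j hj => h i j hj]
  simp_rw [sum_add_distrib, sum_mul]
  congr 1
  refine sum_congr rfl fun i _ => ?_
  rw [sum_const, Fin.card_Ioi, nsmul_eq_mul, mul_assoc]

variable [IsDomain K] [CharZero K]

/-- The terms `(i, j)` and `(j, i)` combine because `c j i = -c i j`. The target is arbitrary so
that the identity serves both fraction fields and power series over them. -/
theorem sum_mul_pderiv_eq_lbOp {F : Type*} [CommRing F] (θ : MvPolynomial (Fin N) K →+* F)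
    (c : Fin N → Fin N → F) (hc : ∀ i j, i ≠ j → c i j * (θ (X i) - θ (X j)) = 1)
    {f : MvPolynomial (Fin N) K} (hf : f.IsSymmetric) :
    ∑ i, ∑ j ∈ univ.erase i, θ (X i) ^ 2 * c i j * θ (pderiv i f) = θ (lbOp f) := by
  have h := sum_sum_Ioi_add_eq_sum_sum_off_diag
    (fun j i : Fin N => θ (X i) ^ 2 * c i j * θ (pderiv i f))
  simp_rw [compl_singleton] at h
  rw [← h, lbOp, map_sum]
  refine sum_congr rfl fun i _ => ?_
  rw [map_sum]
  refine sum_congr rfl fun j hj => ?_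
  have hij : i ≠ j := (mem_Ioi.1 hj).ne
  have h1 := congrArg θ (sub_mul_pairOp_of_isSymmetric hij hf)
  simp only [map_mul, map_sub, map_pow] at h1
  have h2 := hc i j hij
  have h3 := hc j i hij.symm
  have h4 : c j i = - c i j := by linear_combination -(c j i) * h2 - c i j * h3
  rw [h4]
  linear_combination (-c i j) * h1 + θ (pairOp i j f) * h2

/-- A sum over `i < j` is not visibly invariant under permutations; the sum over ordered pairs is.
-/
theorem two_mul_lbOp {f : MvPolynomial (Fin N) K} (hf : f.IsSymmetric) :
    2 * lbOp f = ∑ i, ∑ j ∈ univ.erase i, pairOp i j f := by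
  have h := sum_sum_Ioi_add_eq_sum_sum_off_diag (fun j i : Fin N => pairOp i j f)
  simp_rw [compl_singleton] at h
  rw [← h, lbOp, mul_sum]
  refine sum_congr rfl fun i _ => ?_
  rw [mul_sum]
  refine sum_congr rfl fun j hj => ?_
  rw [pairOp_comm (mem_Ioi.1 hj).ne' hf, two_mul]

theorem isSymmetric_lbOp {f : MvPolynomial (Fin N) K} (hf : f.IsSymmetric) :
    (lbOp f).IsSymmetric := by
  intro s
  apply mul_left_cancel₀ (two_ne_zero (α := MvPolynomial (Fin N) K))
  have h := congrArg (rename s) (two_mul_lbOp hf)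
  rw [map_mul, map_ofNat] at h
  rw [h, two_mul_lbOp hf, map_sum]
  refine Fintype.sum_equiv s _ _ fun i => ?_
  rw [map_sum]
  refine sum_equiv s (fun j => by simp) fun j hj => ?_
  rw [rename_pairOp (ne_of_mem_erase hj).symm s hf]

end LbOp

end Jack

namespace Jack

open Finset MvPolynomial IntPartition

/-! ### Partitions, their parts and the statistics `b` -/

section Partitions

theorem eq_range_card {s : Finset ℕ} (h : ∀ i ∈ s, ∀ j ≤ i, j ∈ s) : s = range s.card := by
  refine eq_of_subset_of_card_le (fun i hi => ?_) (by simp)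
  have h1 : range (i + 1) ⊆ s := fun j hj => h i hi j (Nat.lt_succ_iff.1 (mem_range.1 hj))
  have := card_le_card h1
  rw [card_range] at this
  exact mem_range.2 this

theorem IntPartition.lt_apply_iff (nu : IntPartition) (i j : ℕ) :
    j < nu.1 i ↔ i < (parts nu.1).countP (j < ·) := by
  have h1 : (nu.1.support.filter fun i => j < nu.1 i).card = (parts nu.1).countP (j < ·) := by
    rw [parts, Multiset.countP_map, card_def, filter_val]
  have h2 : (nu.1.support.filter fun i => j < nu.1 i) =
      range (nu.1.support.filter fun i => j < nu.1 i).card := by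
    apply eq_range_card
    intro i hi k hk
    simp only [mem_filter, Finsupp.mem_support_iff] at hi ⊢
    have := nu.2 hk
    omega
  rw [← h1, ← mem_range (n := Finset.card _), ← h2]
  simp only [mem_filter, Finsupp.mem_support_iff]
  omega

theorem IntPartition.eq_of_parts_eq {nu mu : IntPartition} (h : parts nu.1 = parts mu.1) :
    nu = mu := by
  apply Subtype.ext
  ext i
  refine eq_of_forall_lt_iff fun j => ?_
  rw [nu.lt_apply_iff, mu.lt_apply_iff, h]

theorem IntPartition.length_le_iff {nu : IntPartition} {N : ℕ} :
    nu.length ≤ N ↔ ∀ i, nu.1 i ≠ 0 → i < N := by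
  constructor
  · intro h i hi
    by_contra hN
    exact hi (apply_eq_zero (by omega))
  · intro h
    rw [length, ← card_range N]
    refine card_le_card fun i hi => mem_range.2 (h i (Finsupp.mem_support_iff.1 hi))

theorem IntPartition.coe_add_apply (lam mu : IntPartition) (k : ℕ) :
    (lam + mu).1 k = lam.1 k + mu.1 k := rfl

theorem IntPartition.coe_sum_apply {ι : Type*} (s : Finset ι) (lam : ι → IntPartition) (k : ℕ) :
    (∑ i ∈ s, lam i).1 k = ∑ i ∈ s, (lam i).1 k := by
  have h := map_sum partitionMonoid.subtype lam s
  simp only [AddSubmonoid.subtype_apply] at h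
  rw [h, Finsupp.finsetSum_apply]

theorem IntPartition.length_add_le {lam mu : IntPartition} {N : ℕ} (h1 : lam.length ≤ N)
    (h2 : mu.length ≤ N) : (lam + mu).length ≤ N := by
  rw [length_le_iff] at *
  intro i hi
  rw [coe_add_apply] at hi
  by_contra h
  have := mt (h1 i) h
  have := mt (h2 i) h
  omega

theorem IntPartition.length_zero : (0 : IntPartition).length = 0 := by
  change (0 : ℕ →₀ ℕ).support.card = 0
  simp

theorem IntPartition.length_sum_le {ι : Type*} {s : Finset ι} {lam : ι → IntPartition} {N : ℕ}
    (h : ∀ i ∈ s, (lam i).length ≤ N) : (∑ i ∈ s, lam i).length ≤ N :=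
  Finset.sum_induction lam (fun l => l.length ≤ N) (fun _ _ => length_add_le)
    (by simp [length_zero]) h

theorem IntPartition.sum_support_eq {nu : IntPartition} {N : ℕ} (h : nu.length ≤ N) {M : Type*}
    [AddCommMonoid M] (f : ℕ → ℕ → M) (hf : ∀ i, f i 0 = 0) :
    nu.1.sum f = ∑ i : Fin N, f i (nu.1 i) := by
  rw [Fin.sum_univ_eq_sum_range (fun i => f i (nu.1 i)) N]
  refine Finsupp.sum_of_support_subset _ ?_ _ fun i _ => hf i
  rw [nu.support_eq_range]
  exact range_subset_range.2 h

theorem IntPartition.size_eq {nu : IntPartition} {N : ℕ} (h : nu.length ≤ N) :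
    nu.size = ∑ i : Fin N, nu.1 i := sum_support_eq h _ fun _ => rfl

theorem IntPartition.b_eq {nu : IntPartition} {N : ℕ} (h : nu.length ≤ N) :
    nu.b = ∑ i : Fin N, (nu.1 i).choose 2 := sum_support_eq h _ fun _ => rfl

/-- The binomial coefficient of a column length is the sum of the row indices in that column; the
boxes are then summed by rows. -/
theorem IntPartition.conj_b_eq {nu : IntPartition} {N : ℕ} (h : nu.length ≤ N) :
    nu.conj.b = ∑ i : Fin N, (i : ℕ) * nu.1 i := by
  have h1 (j : ℕ) : (nu.conj.1 j).choose 2 = ∑ i ∈ range N, if j < nu.1 i then i else 0 := by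
    rw [Nat.choose_two_right, ← sum_range_id, ← sum_filter]
    have : range (nu.conj.1 j) = (range N).filter fun i => j < nu.1 i := by
      have h2 : ((range N).filter fun i => j < nu.1 i) =
          nu.1.support.filter fun i => j < nu.1 i := by
        ext i
        simp only [mem_filter, Finsupp.mem_support_iff, mem_range]
        have := length_le_iff.1 h i
        constructor
        · rintro ⟨-, h⟩
          exact ⟨by omega, h⟩
        · rintro ⟨h1, h2⟩
          exact ⟨this h1, h2⟩
      rw [h2]
      refine (eq_range_card ?_).symm
      intro i hi k hk
      simp only [mem_filter, Finsupp.mem_support_iff] at hi ⊢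
      have := nu.2 hk
      omega
    rw [this]
  have h2 : nu.conj.b = ∑ j ∈ range (nu.1 0), (nu.conj.1 j).choose 2 :=
    Finsupp.sum_of_support_subset nu.conj.1 (fun j hj => by
      obtain ⟨i, hi⟩ := card_pos.1 (Nat.pos_of_ne_zero (Finsupp.mem_support_iff.1 hj))
      exact mem_range.2 ((mem_filter.1 hi).2.trans_le (nu.2 (Nat.zero_le i)))) _ fun _ _ => rfl
  rw [h2, sum_congr rfl fun j _ => h1 j, sum_comm,
    Fin.sum_univ_eq_sum_range (fun i => i * nu.1 i) N]
  refine sum_congr rfl fun i _ => ?_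
  rw [← sum_filter]
  have : ((range (nu.1 0)).filter fun j => j < nu.1 i) = range (nu.1 i) := by
    ext j
    simp only [mem_filter, mem_range]
    have := nu.2 (Nat.zero_le i)
    omega
  rw [this, sum_const, card_range, smul_eq_mul, mul_comm]

end Partitions

/-! ### Exponents as rearranged partitions; monomial symmetric polynomials -/

section Exponents

variable {N : ℕ}

/-- The first `N` entries of a sequence, as an exponent in `N` variables. -/
noncomputable def expo (N : ℕ) (x : ℕ →₀ ℕ) : Fin N →₀ ℕ := Finsupp.equivFunOnFinite.symm fun i => x i

@[simp]
theorem expo_apply (x : ℕ →₀ ℕ) (i : Fin N) : expo N x i = x i := rfl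

theorem parts_expo {x : ℕ →₀ ℕ} (h : ∀ i, x i ≠ 0 → i < N) : parts (expo N x) = parts x := by
  rw [← parts_embDomain Fin.valEmbedding]
  congr 1
  ext i
  by_cases hi : i < N
  · exact Finsupp.embDomain_apply_self Fin.valEmbedding (expo N x) ⟨i, hi⟩
  · rw [Finsupp.embDomain_of_notMem_range]
    · by_contra hne
      exact hi (h i (Ne.symm hne))
    · rintro ⟨j, rfl⟩
      exact hi j.2

theorem parts_mapDomain (s : Equiv.Perm (Fin N)) (e : Fin N →₀ ℕ) :
    parts (e.mapDomain s) = parts e := by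
  rw [← parts_embDomain s.toEmbedding e, Finsupp.embDomain_eq_mapDomain]
  rfl

/-- Every exponent is a rearrangement of a partition. -/
theorem exists_partition (e : Fin N →₀ ℕ) :
    ∃ (nu : IntPartition) (s : Equiv.Perm (Fin N)), nu.length ≤ N ∧
      e = (expo N nu.1).mapDomain s := by
  have hm : Antitone (e ∘ (Fin.revPerm.trans (Tuple.sort e))) := fun i j hij =>
    Tuple.monotone_sort e (Fin.rev_le_rev.2 hij)
  set s := Fin.revPerm.trans (Tuple.sort e)
  let nu : ℕ →₀ ℕ := (e.mapDomain s.symm).embDomain Fin.valEmbedding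
  have hnu (i : Fin N) : nu i = e (s i) := by
    have h1 := Finsupp.embDomain_apply_self Fin.valEmbedding (e.mapDomain s.symm) i
    have h2 := Finsupp.mapDomain_apply s.symm.injective e (s i)
    rw [Equiv.symm_apply_apply] at h2
    rw [← h2]
    exact h1
  have hnu' (i : ℕ) (hi : N ≤ i) : nu i = 0 := by
    apply Finsupp.embDomain_of_notMem_range
    rintro ⟨j, rfl⟩
    exact absurd j.2 (not_lt.2 hi)
  have hanti : Antitone nu := by
    intro i j hij
    rcases lt_or_ge j N with hj | hj
    · rw [hnu ⟨j, hj⟩, hnu ⟨i, by omega⟩]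
      exact hm hij
    · rw [hnu' j hj]
      exact Nat.zero_le _
  refine ⟨⟨nu, hanti⟩, s, length_le_iff.2 fun i hi => ?_, ?_⟩
  · by_contra h
    exact hi (hnu' i (by omega))
  · ext i
    have h2 := Finsupp.mapDomain_apply s.injective (expo N nu) (s.symm i)
    rw [Equiv.apply_symm_apply] at h2
    rw [h2, expo_apply, hnu, Equiv.apply_symm_apply]

theorem exists_partition_parts (e : Fin N →₀ ℕ) :
    ∃ nu : IntPartition, nu.length ≤ N ∧ parts nu.1 = parts e := by
  obtain ⟨nu, s, h, rfl⟩ := exists_partition e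
  exact ⟨nu, h, by rw [parts_mapDomain, parts_expo (length_le_iff.1 h)]⟩

theorem exists_perm_of_parts_eq {e : Fin N →₀ ℕ} {nu : IntPartition} (h : parts e = parts nu.1) :
    nu.length ≤ N ∧ ∃ s : Equiv.Perm (Fin N), e = (expo N nu.1).mapDomain s := by
  obtain ⟨mu, s, hmu, rfl⟩ := exists_partition e
  rw [parts_mapDomain, parts_expo (length_le_iff.1 hmu)] at h
  rw [← eq_of_parts_eq h]
  exact ⟨hmu, s, rfl⟩

theorem coeff_eq_of_isSymmetric {K : Type*} [CommSemiring K] {f : MvPolynomial (Fin N) K}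
    (hf : f.IsSymmetric) (s : Equiv.Perm (Fin N)) (e : Fin N →₀ ℕ) :
    coeff (e.mapDomain s) f = coeff e f := by
  conv_lhs => rw [← hf s]
  exact coeff_rename_mapDomain s s.injective f e

theorem degree_expo {nu : IntPartition} (h : nu.length ≤ N) : (expo N nu.1).degree = nu.size := by
  rw [Finsupp.degree_eq_sum, size_eq h]
  rfl

theorem coeff_monomialPoly (K : Type*) [CommSemiring K] (nu : IntPartition) (e : Fin N →₀ ℕ) :
    coeff e (monomialPoly N K nu) = if parts e = parts nu.1 then 1 else 0 := by
  rw [monomialPoly, coeff_sum]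
  simp only [coeff_monomial]
  rw [sum_ite_eq']
  refine if_congr ?_ rfl rfl
  simp only [mem_filter, mem_finsuppAntidiag, and_iff_right_iff_imp]
  intro h
  refine ⟨?_, subset_univ _⟩
  rw [← Finsupp.degree_eq_sum, ← sum_parts, h]
  rfl

theorem isSymmetric_monomialPoly (K : Type*) [CommSemiring K] (nu : IntPartition) :
    (monomialPoly N K nu).IsSymmetric := by
  intro s
  ext e
  have h : e = (e.mapDomain s.symm).mapDomain s := by
    rw [← Finsupp.mapDomain_comp]
    simp
  rw [h, coeff_rename_mapDomain _ s.injective, coeff_monomialPoly, coeff_monomialPoly,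
    parts_mapDomain s]

theorem map_monomialPoly {K L : Type*} [CommSemiring K] [CommSemiring L] (φ : K →+* L)
    (nu : IntPartition) : map φ (monomialPoly N K nu) = monomialPoly N L nu := by
  simp [monomialPoly, map_monomial]

end Exponents

/-! ### The dominance order on exponents and leading coefficients -/

section Dominance

variable {N : ℕ}

/-- Indices of `T` outside the initial segment and indices of the segment missing from `T` are
equally many; both kinds of entries are compared with the entry at `|T|`. -/
theorem sum_le_sum_range (nu : IntPartition) (T : Finset ℕ) :
    ∑ i ∈ T, nu.1 i ≤ ∑ i ∈ range T.card, nu.1 i := by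
  have hcard : (T \ range T.card).card = (range T.card \ T).card :=
    card_sdiff_comm (card_range _).symm
  rw [← sum_inter_add_sum_sdiff T (range T.card), ← sum_inter_add_sum_sdiff (range T.card) T,
    inter_comm]
  refine Nat.add_le_add_left ?_ _
  calc ∑ i ∈ T \ range T.card, nu.1 i ≤ ∑ i ∈ T \ range T.card, nu.1 T.card :=
        sum_le_sum fun i hi => nu.2 (by simpa using (mem_sdiff.1 hi).2)
    _ = ∑ i ∈ range T.card \ T, nu.1 T.card := by simp [hcard]
    _ ≤ _ := sum_le_sum fun i hi => nu.2 (by simpa using (mem_range.1 (mem_sdiff.1 hi).1).le)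

/-- The rearrangement of the exponent `e` to a partition is dominated by `lam`. -/
def Below (lam : IntPartition) (e : Fin N →₀ ℕ) : Prop :=
  e.degree = lam.size ∧ ∀ T : Finset (Fin N), ∑ i ∈ T, e i ≤ ∑ k ∈ range T.card, lam.1 k

theorem Below.mapDomain {lam : IntPartition} {e : Fin N →₀ ℕ} (h : Below lam e)
    (s : Equiv.Perm (Fin N)) : Below lam (e.mapDomain s) := by
  refine ⟨?_, fun T => ?_⟩
  · rw [← sum_parts, parts_mapDomain, sum_parts, h.1]
  · have h1 : ∑ i ∈ T, e.mapDomain s i = ∑ i ∈ T.map s.symm.toEmbedding, e i := by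
      rw [sum_map]
      refine sum_congr rfl fun i _ => ?_
      conv_lhs => rw [← s.apply_symm_apply i]
      exact Finsupp.mapDomain_apply s.injective _ _
    rw [h1, ← card_map s.symm.toEmbedding]
    exact h.2 _

theorem below_expo {lam nu : IntPartition} (hN : nu.length ≤ N) (h : DominatedBy nu lam) :
    Below lam (expo N nu.1) := by
  refine ⟨by rw [degree_expo hN, h.1], fun T => ?_⟩
  refine le_trans ?_ (h.2 T.card)
  have := sum_le_sum_range nu (T.map Fin.valEmbedding)
  rw [sum_map, card_map] at this
  exact this

theorem below_of_parts_eq {lam nu : IntPartition} {e : Fin N →₀ ℕ} (he : parts e = parts nu.1)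
    (h : DominatedBy nu lam) : Below lam e := by
  obtain ⟨hN, s, rfl⟩ := exists_perm_of_parts_eq he
  exact (below_expo hN h).mapDomain s

theorem sum_range_eq_sum_filter {x : ℕ →₀ ℕ} {k : ℕ} (hk : k ≤ N) :
    ∑ i ∈ range k, x i = ∑ i : Fin N with i.1 < k, expo N x i := by
  refine sum_bij' (fun i hi => ⟨i, (mem_range.1 hi).trans_le hk⟩) (fun i _ => i.1) ?_ ?_ ?_ ?_ ?_ <;>
    simp

theorem card_filter_val_lt {k : ℕ} (hk : k ≤ N) : #{i : Fin N | i.1 < k} = k := by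
  rw [Fin.card_filter_val_lt, min_eq_right hk]

theorem IntPartition.sum_range_eq_size {nu : IntPartition} {k : ℕ} (h : nu.length ≤ k) :
    ∑ i ∈ range k, nu.1 i = nu.size := by
  rw [size_eq h, Fin.sum_univ_eq_sum_range (fun i => nu.1 i)]

theorem Below.sum_range_le {lam : IntPartition} {x : ℕ →₀ ℕ} (h : Below lam (expo N x)) {k : ℕ}
    (hk : k ≤ N) : ∑ i ∈ range k, x i ≤ ∑ i ∈ range k, lam.1 i := by
  have := h.2 {i : Fin N | i.1 < k}
  rwa [card_filter_val_lt hk, ← sum_range_eq_sum_filter hk] at this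

theorem Below.dominatedBy {lam nu : IntPartition} (hN : nu.length ≤ N)
    (h : Below lam (expo N nu.1)) (hlam : lam.length ≤ N) : DominatedBy nu lam := by
  have hs : nu.size = lam.size := by rw [← h.1, degree_expo hN]
  refine ⟨hs, fun k => ?_⟩
  rcases le_total k N with hk | hk
  · exact h.sum_range_le hk
  · rw [sum_range_eq_size (hN.trans hk), sum_range_eq_size (hlam.trans hk), hs]

theorem IntPartition.size_add (lam mu : IntPartition) : (lam + mu).size = lam.size + mu.size := by
  have h1 := le_max_left lam.length mu.length
  have h2 := le_max_right lam.length mu.length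
  rw [size_eq h1, size_eq h2, size_eq (length_add_le h1 h2), ← sum_add_distrib]
  rfl

theorem Below.add {lam mu : IntPartition} {e e' : Fin N →₀ ℕ} (h : Below lam e)
    (h' : Below mu e') : Below (lam + mu) (e + e') := by
  refine ⟨by rw [map_add, h.1, h'.1, size_add], fun T => ?_⟩
  simp only [Finsupp.add_apply, coe_add_apply, sum_add_distrib]
  exact add_le_add (h.2 T) (h'.2 T)

/-- The partial sums of `e` and `e'` are bounded separately and their totals attain the sum of the
bounds, so both bounds are equalities. This makes leading coefficients multiplicative. -/
theorem Below.eq_of_add_eq {lam mu : IntPartition} {e e' : Fin N →₀ ℕ} (h : Below lam e)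
    (h' : Below mu e') (hadd : e + e' = expo N (lam + mu).1) :
    e = expo N lam.1 ∧ e' = expo N mu.1 := by
  have key (k : ℕ) (hk : k ≤ N) :
      ∑ i : Fin N with i.1 < k, e i = ∑ i ∈ range k, lam.1 i ∧
      ∑ i : Fin N with i.1 < k, e' i = ∑ i ∈ range k, mu.1 i := by
    have h1 := h.2 {i : Fin N | i.1 < k}
    have h2 := h'.2 {i : Fin N | i.1 < k}
    rw [card_filter_val_lt hk] at h1 h2
    have h3 : ∑ i : Fin N with i.1 < k, e i + ∑ i : Fin N with i.1 < k, e' i =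
        ∑ i ∈ range k, lam.1 i + ∑ i ∈ range k, mu.1 i := by
      rw [← sum_add_distrib, ← sum_add_distrib]
      simp_rw [← coe_add_apply, ← Finsupp.add_apply]
      rw [sum_range_eq_sum_filter (x := (lam + mu).1) hk, ← hadd]
    omega
  have step (i : Fin N) (x : Fin N →₀ ℕ) : ∑ j : Fin N with j.1 < i.1 + 1, x j =
      x i + ∑ j : Fin N with j.1 < i.1, x j := by
    rw [← sum_insert (by simp)]
    congr 1
    ext j
    simp [le_iff_lt_or_eq, Fin.ext_iff, or_comm]
  constructor
  · ext i
    have h1 := (key (i + 1) i.2).1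
    have h2 := (key i i.2.le).1
    rw [step, sum_range_succ] at h1
    simp only [expo_apply]
    omega
  · ext i
    have h1 := (key (i + 1) i.2).2
    have h2 := (key i i.2.le).2
    rw [step, sum_range_succ] at h1
    simp only [expo_apply]
    omega

/-- All exponents of `f` are below `lam` in the dominance order. -/
def IsBelow {K : Type*} [CommSemiring K] (lam : IntPartition) (f : MvPolynomial (Fin N) K) : Prop :=
  ∀ e, coeff e f ≠ 0 → Below lam e

section IsBelow

variable {K : Type*} [CommRing K]

theorem IsBelow.sub {lam : IntPartition} {f g : MvPolynomial (Fin N) K} (hf : IsBelow lam f)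
    (hg : IsBelow lam g) : IsBelow lam (f - g) := by
  intro e he
  by_cases h : coeff e f = 0
  · refine hg e fun h' => he ?_
    rw [coeff_sub, h, h', sub_zero]
  · exact hf e h

theorem IsBelow.mul {lam mu : IntPartition} {f g : MvPolynomial (Fin N) K} (hf : IsBelow lam f)
    (hg : IsBelow mu g) : IsBelow (lam + mu) (f * g) := by
  intro e he
  rw [coeff_mul] at he
  obtain ⟨p, hp, hne⟩ := exists_ne_zero_of_sum_ne_zero he
  rw [← HasAntidiagonal.mem_antidiagonal.1 hp]
  exact (hf _ (left_ne_zero_of_mul hne)).add (hg _ (right_ne_zero_of_mul hne))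

theorem IsBelow.coeff_mul {lam mu : IntPartition} {f g : MvPolynomial (Fin N) K}
    (hf : IsBelow lam f) (hg : IsBelow mu g) :
    coeff (expo N (lam + mu).1) (f * g) = coeff (expo N lam.1) f * coeff (expo N mu.1) g := by
  rw [MvPolynomial.coeff_mul]
  have hmem : (expo N lam.1, expo N mu.1) ∈ antidiagonal (expo N (lam + mu).1) := by
    rw [HasAntidiagonal.mem_antidiagonal]
    ext i
    rfl
  rw [sum_eq_single_of_mem _ hmem]
  intro p hp hne
  by_contra h
  have := (hf _ (left_ne_zero_of_mul h)).eq_of_add_eq (hg _ (right_ne_zero_of_mul h))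
    (HasAntidiagonal.mem_antidiagonal.1 hp)
  exact hne (Prod.ext this.1 this.2)

theorem isBelow_one : IsBelow (N := N) 0 (1 : MvPolynomial (Fin N) K) := by
  intro e he
  rw [coeff_one] at he
  obtain rfl : 0 = e := by
    by_contra h
    rw [if_neg h] at he
    exact he rfl
  exact ⟨by rw [map_zero]; rfl, fun T => by simp⟩

theorem IsBelow.prod {ι : Type*} (s : Finset ι) {lam : ι → IntPartition}
    {f : ι → MvPolynomial (Fin N) K} (h : ∀ i ∈ s, IsBelow (lam i) (f i)) :
    IsBelow (∑ i ∈ s, lam i) (∏ i ∈ s, f i) ∧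
      coeff (expo N (∑ i ∈ s, lam i).1) (∏ i ∈ s, f i) =
        ∏ i ∈ s, coeff (expo N (lam i).1) (f i) := by
  classical
  induction s using Finset.induction with
  | empty =>
    simp only [sum_empty, prod_empty]
    refine ⟨isBelow_one, ?_⟩
    rw [coeff_one, if_pos]
    ext i
    rfl
  | insert i s hi ih =>
    obtain ⟨h1, h2⟩ := ih fun j hj => h j (mem_insert_of_mem hj)
    have h3 := h i (mem_insert_self i s)
    rw [sum_insert hi, prod_insert hi, prod_insert hi, h3.coeff_mul h1, h2]
    exact ⟨h3.mul h1, rfl⟩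

end IsBelow

end Dominance

/-! ### Eigenvalues at `α = 0` and raising moves -/

section Weights

variable {N : ℕ}

/-- The value at `α = 0` of the eigenvalue of the Laplace–Beltrami operator. -/
def eigenZero (N : ℕ) (lam : IntPartition) : ℕ := ∑ i : Fin N, (N - 1 - i) * lam.1 i

/-- Abel summation: as a sum of partial sums, the eigenvalue is visibly monotone for dominance. -/
theorem eigenZero_eq (lam : IntPartition) :
    eigenZero N lam = ∑ k ∈ range N, ∑ i ∈ range k, lam.1 i := by
  rw [eigenZero, Fin.sum_univ_eq_sum_range (fun i => (N - 1 - i) * lam.1 i)]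
  induction N with
  | zero => simp
  | succ n ih =>
    rw [sum_range_succ, sum_range_succ, ← ih, ← sum_range_succ, sum_range_succ, ← sum_add_distrib]
    simp only [Nat.add_sub_cancel, Nat.sub_self, zero_mul, add_zero]
    refine sum_congr rfl fun i hi => ?_
    rw [mem_range] at hi
    have : n - i = n - 1 - i + 1 := by omega
    rw [this]
    ring

theorem conj_b_add_eigenZero {lam : IntPartition} (h : lam.length ≤ N) :
    lam.conj.b + eigenZero N lam + lam.size = N * lam.size := by
  rw [conj_b_eq h, eigenZero, size_eq h, mul_sum, ← sum_add_distrib, ← sum_add_distrib]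
  refine sum_congr rfl fun i _ => ?_
  have : i + (N - 1 - i) + 1 = N := by omega
  calc _ = (i + (N - 1 - i) + 1) * lam.1 i := by ring
    _ = _ := by rw [this]

theorem eigenvalue_eq {lam : IntPartition} (h : lam.length ≤ N) :
    eigenvalue N lam = RatFunc.X * (lam.b : QAlpha) + (eigenZero N lam : QAlpha) := by
  have h2 := congrArg (Nat.cast : ℕ → QAlpha) (conj_b_add_eigenZero h)
  push_cast at h2
  rw [eigenvalue]
  linear_combination -h2

theorem eigenZero_sum {ι : Type*} (s : Finset ι) (lam : ι → IntPartition) :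
    eigenZero N (∑ i ∈ s, lam i) = ∑ i ∈ s, eigenZero N (lam i) := by
  simp only [eigenZero, coe_sum_apply, mul_sum]
  rw [sum_comm]

theorem Below.eigenZero_lt {lam nu : IntPartition} (hN : nu.length ≤ N) (hlam : lam.length ≤ N)
    (h : Below lam (expo N nu.1)) (hne : nu ≠ lam) : eigenZero N nu < eigenZero N lam := by
  rw [eigenZero_eq, eigenZero_eq]
  refine sum_lt_sum (fun k hk => h.sum_range_le (mem_range.1 hk).le) ?_
  by_contra! hall
  have heq (k : ℕ) : ∑ i ∈ range k, nu.1 i = ∑ i ∈ range k, lam.1 i := by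
    rcases lt_or_ge k N with hk | hk
    · exact (h.sum_range_le hk.le).antisymm (hall k (mem_range.2 hk))
    · rw [sum_range_eq_size (hN.trans hk), sum_range_eq_size (hlam.trans hk), ← h.1, degree_expo hN]
  apply hne
  apply Subtype.ext
  ext k
  have := heq (k + 1)
  rw [sum_range_succ, sum_range_succ, heq k] at this
  omega

/-- Induction on the sum of the squares of the entries of an exponent of given degree, starting
from large values. -/
theorem exponent_induction {P : (Fin N →₀ ℕ) → Prop}
    (h : ∀ e, (∀ e', e'.degree = e.degree → ∑ i, e i ^ 2 < ∑ i, e' i ^ 2 → P e') → P e)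
    (e : Fin N →₀ ℕ) : P e := by
  induction hm : e.degree ^ 2 - ∑ i, e i ^ 2 using Nat.strong_induction_on generalizing e with
  | _ m ih =>
    refine h e fun e' hd hlt => ih _ ?_ e' rfl
    have : ∑ i, e' i ^ 2 ≤ e'.degree ^ 2 := by
      rw [Finsupp.degree_eq_sum]
      exact sum_sq_le_sq_sum_of_nonneg fun i _ => Nat.zero_le _
    rw [hd] at this ⊢
    omega

theorem sum_move {M : Type*} [AddCommMonoid M] (F : ℕ → M) (e : Fin N →₀ ℕ) {i j : Fin N}
    (hij : i ≠ j) (a : ℕ) : ∑ k, F (move e i j a k) + (F (e i) + F (e j)) =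
      ∑ k, F (e k) + (F a + F (e i + e j - a)) := by
  have hj : j ∈ univ.erase i := mem_erase.2 ⟨hij.symm, mem_univ j⟩
  have h (x : Fin N →₀ ℕ) : ∑ k, F (x k) =
      F (x i) + (F (x j) + ∑ k ∈ (univ.erase i).erase j, F (x k)) := by
    rw [add_sum_erase _ (fun k => F (x k)) hj, add_sum_erase _ (fun k => F (x k)) (mem_univ i)]
  rw [h, h e]
  have h1 : ∑ k ∈ (univ.erase i).erase j, F (move e i j a k) =
      ∑ k ∈ (univ.erase i).erase j, F (e k) := by
    refine sum_congr rfl fun k hk => ?_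
    simp only [mem_erase, mem_univ, and_true] at hk
    rw [move_apply, if_neg hk.1, if_neg hk.2]
  rw [h1]
  simp only [move_apply, if_neg hij, if_true]
  abel

theorem degree_move (e : Fin N →₀ ℕ) {i j : Fin N} (hij : i ≠ j) {a : ℕ} (ha : a ≤ e i + e j) :
    (move e i j a).degree = e.degree := by
  have := sum_move id e hij a
  rw [Finsupp.degree_eq_sum, Finsupp.degree_eq_sum]
  simp only [id] at this
  omega

/-- With `a = e i + d` the sum of squares grows by `2 d (e i - e j + d) > 0`. -/
theorem sum_sq_lt_move (e : Fin N →₀ ℕ) {i j : Fin N} (hij : i ≠ j) {a : ℕ} (hle : e j ≤ e i)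
    (ha : a ∈ Ioc (e i) (e i + e j)) : ∑ k, e k ^ 2 < ∑ k, move e i j a k ^ 2 := by
  have h := sum_move (fun n => n ^ 2) e hij a
  rw [mem_Ioc] at ha
  obtain ⟨d, hd⟩ := Nat.exists_eq_add_of_le ha.1.le
  obtain ⟨c, hc⟩ := Nat.exists_eq_add_of_le ha.2
  have h1 : e i + e j - a = c := by omega
  have h2 : e j = d + c := by omega
  have h3 : 0 < d := by omega
  rw [h2] at hle
  rw [h1, h2] at h
  subst hd
  have := Nat.mul_le_mul_left d hle
  have := Nat.mul_pos h3 h3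
  linarith [h, show (e i + d) ^ 2 = e i ^ 2 + 2 * (d * e i) + d * d by ring,
    show (d + c) ^ 2 = d * d + 2 * (d * c) + c ^ 2 by ring,
    show d * (d + c) = d * d + d * c by ring]

/-- Lowering a box of a rearranged partition does not leave the ideal below `lam`. -/
theorem Below.of_move {lam : IntPartition} {e : Fin N →₀ ℕ} {i j : Fin N} (hij : i ≠ j) {a : ℕ}
    (hle : e j ≤ e i) (ha : a ∈ Ioc (e i) (e i + e j)) (h : Below lam (move e i j a)) :
    Below lam e := by
  rw [mem_Ioc] at ha
  refine ⟨by rw [← h.1, degree_move e hij ha.2], fun T => ?_⟩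
  have hi : move e i j a i = a := by rw [move_apply, if_neg hij, if_pos rfl]
  have hj : move e i j a j = e i + e j - a := by rw [move_apply, if_pos rfl]
  have hk (k) (h1 : k ≠ i) (h2 : k ≠ j) : move e i j a k = e k := by
    rw [move_apply, if_neg h2, if_neg h1]
  have herase (U : Finset (Fin N)) (h1 : i ∉ U) (h2 : j ∉ U) :
      ∑ k ∈ U, e k = ∑ k ∈ U, move e i j a k :=
    sum_congr rfl fun k hkU => (hk k (fun h => h1 (h ▸ hkU)) (fun h => h2 (h ▸ hkU))).symm
  by_cases hiT : i ∈ T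
  · refine le_trans ?_ (h.2 T)
    by_cases hjT : j ∈ T
    · have hj' : j ∈ T.erase i := mem_erase.2 ⟨hij.symm, hjT⟩
      rw [← add_sum_erase T _ hiT, ← add_sum_erase _ _ hj', ← add_sum_erase T (move e i j a) hiT,
        ← add_sum_erase _ (move e i j a) hj', herase _ (by simp) (by simp), hi, hj]
      omega
    · rw [← add_sum_erase T _ hiT, ← add_sum_erase T (move e i j a) hiT,
        herase _ (by simp) (by simp [hjT]), hi]
      omega
  · by_cases hjT : j ∈ T
    · have hi' : i ∉ T.erase j := by simp [hiT]
      -- Replacing `j` by `i` keeps the cardinality, and `e j ≤ e i < a`.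
      have := h.2 (insert i (T.erase j))
      rw [card_insert_of_notMem hi', card_erase_add_one hjT, sum_insert hi', hi,
        ← herase _ hi' (by simp)] at this
      rw [← add_sum_erase T _ hjT]
      omega
    · rw [herase T hiT hjT]
      exact h.2 T

/-- Raising a box of a partition leads out of the ideal below it. -/
theorem not_below_move {lam : IntPartition} {i j : Fin N} (hij : i < j) {a : ℕ}
    (ha : a ∈ Ioc (expo N lam.1 i) (expo N lam.1 i + expo N lam.1 j)) :
    ¬ Below lam (move (expo N lam.1) i j a) := by
  intro h
  have hi : i ∉ ({k : Fin N | k.1 < i.1} : Finset (Fin N)) := by simp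
  -- The partial sum up to and including `i` grows, since `j` lies beyond it.
  have h1 := h.2 (insert i ({k : Fin N | k.1 < i.1} : Finset (Fin N)))
  rw [card_insert_of_notMem hi, card_filter_val_lt i.2.le, sum_insert hi, sum_range_succ,
    sum_range_eq_sum_filter i.2.le, move_apply, if_neg hij.ne, if_pos rfl] at h1
  have h2 : ∑ k : Fin N with k.1 < i.1, move (expo N lam.1) i j a k =
      ∑ k : Fin N with k.1 < i.1, expo N lam.1 k := by
    refine sum_congr rfl fun k hk => ?_
    simp only [mem_filter, mem_univ, true_and] at hk
    rw [move_apply, if_neg, if_neg]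
    · exact fun h => by omega
    · exact fun h => by rw [h] at hk; omega
  rw [h2] at h1
  rw [mem_Ioc, expo_apply] at ha
  omega

end Weights

end Jack

namespace Jack

open Finset MvPolynomial IntPartition

/-! ### Triangularity of the Laplace–Beltrami operator -/

section FullOp

variable {N : ℕ} {K : Type*} [CommRing K]

/-- The Laplace–Beltrami operator on symmetric polynomials; `c` is half the Jack parameter. -/
noncomputable def fullOp (c : K) (f : MvPolynomial (Fin N) K) : MvPolynomial (Fin N) K :=
  lbOp f + C c * ∑ i, X i ^ 2 * pderiv i (pderiv i f)

theorem map_fullOp {L : Type*} [CommRing L] (φ : K →+* L) (c : K) (f : MvPolynomial (Fin N) K) :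
    map φ (fullOp c f) = fullOp (φ c) (map φ f) := by
  simp [fullOp, map_lbOp, pderiv_map]

theorem coeff_X_mul_pderiv {σ : Type*} (i : σ) (f : MvPolynomial σ K) (e : σ →₀ ℕ) :
    coeff e (X i * pderiv i f) = e i * coeff e f := by
  induction f using MvPolynomial.induction_on' with
  | add p q hp hq => simp only [map_add, mul_add, coeff_add, hp, hq]
  | monomial m c =>
    classical
    rw [X_mul_pderiv_monomial, coeff_smul, coeff_monomial]
    split_ifs with h
    · rw [h, nsmul_eq_mul]
    · simp

theorem coeff_X_sq_mul_pderiv {σ : Type*} (i : σ) (f : MvPolynomial σ K) (e : σ →₀ ℕ) :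
    coeff e (X i ^ 2 * pderiv i (pderiv i f)) = e i * (e i - 1) * coeff e f := by
  have h : X i ^ 2 * pderiv i (pderiv i f) =
      X i * pderiv i (X i * pderiv i f) - X i * pderiv i f := by
    rw [pderiv_mul, pderiv_X_self]
    ring
  rw [h, coeff_sub, coeff_X_mul_pderiv, coeff_X_mul_pderiv]
  ring

theorem natCast_mul_sub_one (n : ℕ) : (n : K) * (n - 1) = 2 * (n.choose 2 : ℕ) := by
  have h : n * (n - 1) = 2 * n.choose 2 := by
    rw [Nat.choose_two_right, Nat.mul_div_cancel' (Nat.even_mul_pred_self n).two_dvd]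
  cases n with
  | zero => simp
  | succ n =>
    have := congrArg (Nat.cast : ℕ → K) h
    push_cast at this ⊢
    rw [← this]
    simp

theorem coeff_fullOp (c : K) (f : MvPolynomial (Fin N) K) {nu : IntPartition}
    (h : nu.length ≤ N) :
    coeff (expo N nu.1) (fullOp c f) =
      (2 * c * (nu.b : K) + (eigenZero N nu : K)) * coeff (expo N nu.1) f +
      ∑ i : Fin N, ∑ j ∈ Ioi i, ∑ a ∈ Ioc (nu.1 i) (nu.1 i + nu.1 j),
        (2 * a - nu.1 i - nu.1 j) * coeff (move (expo N nu.1) i j a) f := by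
  rw [fullOp, coeff_add, coeff_lbOp, coeff_C_mul, coeff_sum]
  simp_rw [coeff_X_sq_mul_pderiv, natCast_mul_sub_one, ← sum_mul, ← mul_sum]
  rw [b_eq h, eigenZero]
  push_cast
  simp only [expo_apply]
  ring

theorem eq_of_coeff_expo_eq {f g : MvPolynomial (Fin N) K} (hf : f.IsSymmetric)
    (hg : g.IsSymmetric)
    (h : ∀ nu : IntPartition, nu.length ≤ N → coeff (expo N nu.1) f = coeff (expo N nu.1) g) :
    f = g := by
  ext e
  obtain ⟨nu, s, hnu, rfl⟩ := exists_partition e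
  rw [coeff_eq_of_isSymmetric hf, coeff_eq_of_isSymmetric hg, h nu hnu]

theorem sum_mapDomain {M : Type*} [AddCommMonoid M] (s : Equiv.Perm (Fin N)) (e : Fin N →₀ ℕ)
    (F : ℕ → M) : ∑ i, F (e.mapDomain s i) = ∑ i, F (e i) := by
  refine (Fintype.sum_equiv s _ _ fun i => ?_).symm
  rw [Finsupp.mapDomain_apply s.injective]

theorem degree_mapDomain (s : Equiv.Perm (Fin N)) (e : Fin N →₀ ℕ) :
    (e.mapDomain s).degree = e.degree := by
  rw [← sum_parts, parts_mapDomain, sum_parts]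

/-- Raising moves increase the sum of squares, which is bounded in fixed degree; by symmetry each
moved exponent may be sorted again. -/
theorem symmetric_induction {P : K → Prop} {f : MvPolynomial (Fin N) K} (hf : f.IsSymmetric)
    (h : ∀ nu : IntPartition, nu.length ≤ N →
      (∀ i j : Fin N, i < j → ∀ a ∈ Ioc (nu.1 i) (nu.1 i + nu.1 j),
        P (coeff (move (expo N nu.1) i j a) f)) → P (coeff (expo N nu.1) f)) (e : Fin N →₀ ℕ) :
    P (coeff e f) := by
  induction e using exponent_induction with
  | _ e ih =>
    obtain ⟨nu, s, hnu, rfl⟩ := exists_partition e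
    rw [coeff_eq_of_isSymmetric hf]
    refine h nu hnu fun i j hij a ha => ih _ ?_ ?_
    · rw [degree_mapDomain]
      exact degree_move _ hij.ne (mem_Ioc.1 ha).2
    · rw [sum_mapDomain s _ fun n => n ^ 2]
      exact sum_sq_lt_move _ hij.ne (nu.2 hij.le) ha

variable [IsDomain K] [CharZero K]

theorem isSymmetric_fullOp (c : K) {f : MvPolynomial (Fin N) K} (hf : f.IsSymmetric) :
    (fullOp c f).IsSymmetric := by
  intro s
  rw [fullOp, map_add, isSymmetric_lbOp hf s, map_mul, rename_C, map_sum]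
  congr 2
  refine Fintype.sum_equiv s _ _ fun i => ?_
  rw [map_mul, map_pow, rename_X, ← pderiv_rename s.injective, ← pderiv_rename s.injective, hf s]

theorem laplaceBeltrami_eq {f : MvPolynomial (Fin N) QAlpha} (hf : f.IsSymmetric) :
    laplaceBeltrami N f = algebraMap _ _ (fullOp (RatFunc.X / 2) f) := by
  rw [laplaceBeltrami, fullOp, map_add]
  congr 1
  have := sum_mul_pderiv_eq_lbOp
    (algebraMap (MvPolynomial (Fin N) QAlpha) (FractionRing (MvPolynomial (Fin N) QAlpha)))
    (fun i j => (algebraMap (MvPolynomial (Fin N) QAlpha)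
      (FractionRing (MvPolynomial (Fin N) QAlpha)) (X i) - algebraMap _ _ (X j))⁻¹) (fun i j hij => by
      rw [← map_sub]
      apply inv_mul_cancel₀
      rw [map_ne_zero_iff _ (IsFractionRing.injective _ _)]
      exact X_sub_X_ne_zero hij) hf
  rw [← this]
  simp only [div_eq_mul_inv]

/-- A symmetric eigenvector whose exponents have other eigenvalues vanishes. -/
theorem eq_zero_of_lbOp_eq {f : MvPolynomial (Fin N) K} (hf : f.IsSymmetric) (n : ℕ)
    (hop : lbOp f = C (n : K) * f)
    (hn : ∀ nu : IntPartition, nu.length ≤ N → coeff (expo N nu.1) f ≠ 0 → eigenZero N nu ≠ n) :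
    f = 0 := by
  ext e
  rw [coeff_zero]
  refine symmetric_induction (P := fun x => x = 0) hf (fun nu hnu ih => ?_) e
  by_contra hne
  -- Parameter `0` leaves only `lbOp`. The raised coefficients vanish by induction, so the diagonal
  -- entry must equal `n`.
  have h := coeff_fullOp 0 f hnu
  rw [fullOp, C_0, zero_mul, add_zero, hop, coeff_C_mul,
    sum_eq_zero (s := univ) fun i _ => sum_eq_zero fun j hj => sum_eq_zero fun a ha => by
      rw [ih i j (mem_Ioi.1 hj) a ha, mul_zero]] at h
  simp only [mul_zero, zero_mul, zero_add, add_zero] at h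
  exact hn nu hnu hne (by exact_mod_cast (mul_right_cancel₀ hne h).symm)

end FullOp

/-! ### Consequences of the characterization of Jack polynomials -/

section JackPolynomials

variable {N : ℕ}

theorem coeff_sum_monomialPoly {K : Type*} [CommSemiring K] (a : IntPartition →₀ K)
    {e : Fin N →₀ ℕ} {nu : IntPartition} (h : parts e = parts nu.1) :
    coeff e (a.sum fun nu c => C c * monomialPoly N K nu) = a nu := by
  rw [Finsupp.sum, coeff_sum]
  simp_rw [coeff_C_mul, coeff_monomialPoly, h]
  rw [Finset.sum_eq_single nu]
  · simp
  · intro mu _ hne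
    rw [if_neg fun h' => hne (eq_of_parts_eq h'.symm), mul_zero]
  · intro hnu
    rw [Finsupp.notMem_support_iff.1 hnu, zero_mul]

theorem isSymmetric_C_mul_monomialPoly {K : Type*} [CommSemiring K] (c : K) (nu : IntPartition) :
    (C c * monomialPoly N K nu).IsSymmetric :=
  (MvPolynomial.IsSymmetric.C c).mul (isSymmetric_monomialPoly K nu)

theorem isSymmetric_sum_monomialPoly {K : Type*} [CommSemiring K] (a : IntPartition →₀ K) :
    (a.sum fun nu c => C c * monomialPoly N K nu).IsSymmetric := by
  intro s
  rw [Finsupp.sum, map_sum]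
  exact sum_congr rfl fun nu _ => isSymmetric_C_mul_monomialPoly _ _ s

section

variable {lam : IntPartition} {f : MvPolynomial (Fin N) QAlpha}

theorem IsJackPoly.isSymmetric (h : IsJackPoly N lam f) : f.IsSymmetric := by
  obtain ⟨-, a, -, rfl⟩ := h
  exact (isSymmetric_C_mul_monomialPoly _ _).add (isSymmetric_sum_monomialPoly a)

theorem IsJackPoly.fullOp_eq (h : IsJackPoly N lam f) :
    fullOp (RatFunc.X / 2) f = C (eigenvalue N lam) * f := by
  have h1 := h.1
  rw [laplaceBeltrami_eq h.isSymmetric] at h1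
  exact IsFractionRing.injective _ _ h1

theorem DominatedBy_refl (lam : IntPartition) : DominatedBy lam lam := ⟨rfl, fun _ => le_rfl⟩

theorem IsJackPoly.isBelow (h : IsJackPoly N lam f) : IsBelow lam f := by
  obtain ⟨-, a, ha, rfl⟩ := h
  intro e he
  obtain ⟨nu, -, hnu⟩ := exists_partition_parts e
  rw [coeff_add, coeff_C_mul, coeff_monomialPoly, coeff_sum_monomialPoly a hnu.symm] at he
  refine below_of_parts_eq hnu.symm ?_
  by_cases hlam : nu = lam
  · rw [hlam]
    exact DominatedBy_refl lam
  · rw [if_neg fun h' => hlam (eq_of_parts_eq (hnu.trans h')), mul_zero, zero_add] at he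
    exact (ha nu (Finsupp.mem_support_iff.2 he)).1

theorem IsJackPoly.coeff_expo (h : IsJackPoly N lam f) (hlam : lam.length ≤ N) :
    coeff (expo N lam.1) f = hook lam := by
  obtain ⟨-, a, ha, rfl⟩ := h
  have hp := parts_expo (length_le_iff.1 hlam)
  rw [coeff_add, coeff_C_mul, coeff_monomialPoly, coeff_sum_monomialPoly a hp, if_pos hp, mul_one,
    add_eq_left]
  by_contra hne
  exact (ha lam (Finsupp.mem_support_iff.2 hne)).2 rfl

end

end JackPolynomials

/-! ### Regularity of the coefficients at `α = 0` -/

section Regular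

open scoped RatFunc LaurentSeries in
/-- The expansion of a rational function at `0`. -/
noncomputable def toLaurent (F : Type*) [Field F] : RatFunc F →+* LaurentSeries F :=
  algebraMap (RatFunc F) (LaurentSeries F)

open scoped RatFunc LaurentSeries in
theorem toLaurent_X (F : Type*) [Field F] :
    toLaurent F RatFunc.X = HahnSeries.ofPowerSeries ℤ F PowerSeries.X := by
  rw [HahnSeries.ofPowerSeries_X]
  exact RatFunc.coe_X

open scoped RatFunc LaurentSeries in
theorem toLaurent_algebraMap (F : Type*) [Field F] (p : Polynomial F) :
    toLaurent F (algebraMap _ _ p) = HahnSeries.ofPowerSeries ℤ F p :=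
  (RatFunc.coe_coe p).symm

/-- The rational functions of `α` without a pole at `0`. -/
noncomputable def regular : Subring QAlpha :=
  (HahnSeries.ofPowerSeries ℤ ℚ).range.comap (toLaurent ℚ)

theorem mem_regular {x : QAlpha} : x ∈ regular ↔
    ∃ y : PowerSeries ℚ, HahnSeries.ofPowerSeries ℤ ℚ y = toLaurent ℚ x :=
  Iff.rfl

theorem X_mul_add_ne_zero {m n : ℚ} (hn : n ≠ 0) :
    (PowerSeries.X * PowerSeries.C m + PowerSeries.C n : PowerSeries ℚ) ≠ 0 := by
  intro h
  have := congrArg PowerSeries.constantCoeff h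
  simp at this
  exact hn this

theorem algebraMap_X_mul_add (m n : ℤ) :
    toLaurent ℚ (RatFunc.X * (m : QAlpha) + (n : QAlpha)) =
    HahnSeries.ofPowerSeries ℤ ℚ (PowerSeries.X * PowerSeries.C (m : ℚ) + PowerSeries.C (n : ℚ)) := by
  rw [map_add, map_mul, map_add, map_mul, toLaurent_X]
  simp

theorem ratFunc_X_mul_add_ne_zero {m n : ℤ} (hn : n ≠ 0) :
    (RatFunc.X * (m : QAlpha) + (n : QAlpha)) ≠ 0 := by
  intro h
  have h1 := algebraMap_X_mul_add m n
  rw [h, map_zero] at h1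
  exact X_mul_add_ne_zero (m := m) (Int.cast_ne_zero.2 hn)
    (HahnSeries.ofPowerSeries_injective (h1.symm.trans (map_zero _).symm))

theorem inv_mem_regular {m n : ℤ} (hn : n ≠ 0) :
    (RatFunc.X * (m : QAlpha) + (n : QAlpha))⁻¹ ∈ regular := by
  set p : PowerSeries ℚ := PowerSeries.X * PowerSeries.C (m : ℚ) + PowerSeries.C (n : ℚ) with hp
  have hc : PowerSeries.constantCoeff p ≠ 0 := by simpa [hp] using hn
  refine mem_regular.2 ⟨p⁻¹, ?_⟩
  rw [map_inv₀, algebraMap_X_mul_add, ← hp]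
  apply eq_inv_of_mul_eq_one_left
  rw [← map_mul, PowerSeries.inv_mul_cancel _ hc, map_one]

theorem hook_eq (lam : IntPartition) : hook lam = hookProd RatFunc.X lam := rfl

theorem hook_mem_regular (lam : IntPartition) : hook lam ∈ regular := by
  refine mem_regular.2 ⟨hookProd PowerSeries.X lam, ?_⟩
  rw [hook_eq, map_hookProd, map_hookProd, toLaurent_X]

variable {N : ℕ} {lam : IntPartition} {f : MvPolynomial (Fin N) QAlpha}

theorem eigenvalue_sub {lam : IntPartition} (h1 : lam.length ≤ N) (nu : IntPartition) :
    eigenvalue N lam - (2 * (RatFunc.X / 2) * (nu.b : QAlpha) + (eigenZero N nu : QAlpha)) =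
      RatFunc.X * (((lam.b : ℤ) - (nu.b : ℤ) : ℤ) : QAlpha) +
        (((eigenZero N lam : ℤ) - (eigenZero N nu : ℤ) : ℤ) : QAlpha) := by
  rw [eigenvalue_eq h1]
  push_cast
  ring

/-- The recursion divides by the difference of two eigenvalues, whose value at `α = 0` is nonzero by
strict monotonicity under dominance. -/
theorem IsJackPoly.coeff_mem_regular (h : IsJackPoly N lam f) (hlam : lam.length ≤ N)
    (e : Fin N →₀ ℕ) : coeff e f ∈ regular := by
  refine symmetric_induction (P := fun x => x ∈ regular) h.isSymmetric (fun nu hnu ih => ?_) e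
  by_cases hne : coeff (expo N nu.1) f = 0
  · rw [hne]
    exact zero_mem _
  by_cases hnl : nu = lam
  · rw [hnl, h.coeff_expo hlam]
    exact hook_mem_regular lam
  have hlt := (h.isBelow _ hne).eigenZero_lt hnu hlam hnl
  have h1 := coeff_fullOp (RatFunc.X / 2) f hnu
  rw [h.fullOp_eq, coeff_C_mul, ← sub_eq_iff_eq_add', ← sub_mul, eigenvalue_sub hlam] at h1
  have hn : (eigenZero N lam : ℤ) - (eigenZero N nu : ℤ) ≠ 0 := by omega
  rw [← inv_mul_cancel_left₀ (ratFunc_X_mul_add_ne_zero (m := (lam.b : ℤ) - (nu.b : ℤ)) hn)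
    (coeff (expo N nu.1) f), h1]
  refine mul_mem (inv_mem_regular hn) (sum_mem fun i _ => sum_mem fun j hj => sum_mem fun a ha =>
    mul_mem ?_ (ih i j (mem_Ioi.1 hj) a ha))
  have := intCast_mem regular (2 * a - nu.1 i - nu.1 j : ℤ)
  exact_mod_cast this

end Regular

end Jack

namespace Jack

open Finset MvPolynomial IntPartition

/-! ### Existence of Jack symmetric functions -/

section Existence

theorem exists_recursion {X K : Type*} [Zero K] (meas : X → ℕ) (F : X → (X → K) → K)
    (hF : ∀ x A B, (∀ y, meas y < meas x → A y = B y) → F x A = F x B) :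
    ∃ A : X → K, ∀ x, A x = F x A := by
  have wf : WellFounded fun x y => meas x < meas y := (measure meas).wf
  let A : X → K := wf.fix fun x rec => F x fun y => if h : meas y < meas x then rec y h else 0
  refine ⟨A, fun x => ?_⟩
  have h : A x = F x fun y => if _ : meas y < meas x then A y else 0 := wf.fix_eq _ x
  rw [h]
  exact hF x _ _ fun y hy => dif_pos hy

theorem finite_dominatedBy (lam : IntPartition) : {nu | DominatedBy nu lam}.Finite := by
  have hinj : Set.InjOn (Subtype.val : IntPartition → ℕ →₀ ℕ)
      (Subtype.val ⁻¹' (finsuppAntidiag (range lam.size) lam.size : Set (ℕ →₀ ℕ))) :=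
    Subtype.val_injective.injOn
  refine (Set.Finite.preimage hinj (finite_toSet _)).subset fun (nu : IntPartition) hnu => ?_
  have hlen : nu.length ≤ lam.size := by
    rw [← hnu.1, length, size, Finsupp.sum, card_eq_sum_ones]
    exact sum_le_sum fun i hi => Nat.one_le_iff_ne_zero.2 (Finsupp.mem_support_iff.1 hi)
  simp only [Set.mem_preimage, mem_coe, mem_finsuppAntidiag]
  refine ⟨?_, ?_⟩
  · rw [sum_range_eq_size hlen, hnu.1]
  · rw [nu.support_eq_range]
    exact range_subset_range.2 hlen

theorem expo_move {N : ℕ} (x : ℕ →₀ ℕ) (i j : Fin N) (a : ℕ) :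
    expo N (move x i j a) = move (expo N x) i j a := by
  ext k
  simp only [expo_apply, move_apply, Fin.ext_iff]

theorem parts_move {N : ℕ} {nu : IntPartition} (hN : nu.length ≤ N) (i j : Fin N) (a : ℕ) :
    parts (move nu.1 i j a) = parts (move (expo N nu.1) i j a) := by
  rw [← expo_move, parts_expo]
  intro k hk
  by_contra h
  rw [move_apply, if_neg (by omega), if_neg (by omega)] at hk
  exact h (length_le_iff.1 hN k hk)

open Classical in
/-- The partition with given parts. -/
noncomputable def ofParts (M : Multiset ℕ) : IntPartition :=
  if h : ∃ nu : IntPartition, parts nu.1 = M then h.choose else 0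

theorem parts_ofParts {N : ℕ} (e : Fin N →₀ ℕ) : parts (ofParts (parts e)).1 = parts e := by
  have h : ∃ nu : IntPartition, parts nu.1 = parts e := by
    obtain ⟨nu, -, h⟩ := exists_partition_parts e
    exact ⟨nu, h⟩
  rw [ofParts, dif_pos h]
  exact h.choose_spec

/-- The complement of the sum of squares of the parts to the square of the size. -/
def sqDefect (M : Multiset ℕ) : ℕ := M.sum ^ 2 - (M.map (· ^ 2)).sum

theorem sqDefect_parts {N : ℕ} (e : Fin N →₀ ℕ) :
    sqDefect (parts e) = e.degree ^ 2 - ∑ i, e i ^ 2 := by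
  rw [sqDefect, sum_parts, parts, Multiset.map_map]
  congr 1
  change ∑ i ∈ e.support, e i ^ 2 = _
  refine sum_subset (subset_univ _) fun i _ hi => ?_
  rw [Finsupp.notMem_support_iff.1 hi]
  rfl

theorem sqDefect_move_lt {N : ℕ} (e : Fin N →₀ ℕ) {i j : Fin N} (hij : i ≠ j) (hle : e j ≤ e i)
    {a : ℕ} (ha : a ∈ Ioc (e i) (e i + e j)) :
    sqDefect (parts (move e i j a)) < sqDefect (parts e) := by
  rw [sqDefect_parts, sqDefect_parts, degree_move e hij (mem_Ioc.1 ha).2]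
  have h1 := sum_sq_lt_move e hij hle ha
  have h2 : ∑ k, move e i j a k ^ 2 ≤ (move e i j a).degree ^ 2 := by
    rw [Finsupp.degree_eq_sum]
    exact sum_sq_le_sq_sum_of_nonneg fun i _ => Nat.zero_le _
  rw [degree_move e hij (mem_Ioc.1 ha).2] at h2
  omega

/-- The contribution of the partitions above `nu` to the coefficient of `m_nu` in the image under
the Laplace–Beltrami operator of the symmetric function with coefficients `A`. -/
noncomputable def raiseSum (nu : IntPartition) (A : IntPartition → QAlpha) : QAlpha :=
  ∑ i ∈ range nu.length, ∑ j ∈ range nu.length, if i < j then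
    ∑ a ∈ Ioc (nu.1 i) (nu.1 i + nu.1 j),
      (2 * a - nu.1 i - nu.1 j) * A (ofParts (parts (move nu.1 i j a))) else 0

theorem raiseSum_congr {nu : IntPartition} {A B : IntPartition → QAlpha}
    (h : ∀ mu : IntPartition, sqDefect (parts mu.1) < sqDefect (parts nu.1) → A mu = B mu) :
    raiseSum nu A = raiseSum nu B := by
  refine sum_congr rfl fun i hi => sum_congr rfl fun j hj => ?_
  split_ifs with hij
  · refine sum_congr rfl fun a ha => ?_
    rw [h]
    have hp := parts_move le_rfl (⟨i, mem_range.1 hi⟩ : Fin nu.length) ⟨j, mem_range.1 hj⟩ a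
    simp only at hp
    rw [hp, parts_ofParts, ← parts_expo (length_le_iff.1 le_rfl : ∀ k, nu.1 k ≠ 0 → k < nu.length)]
    exact sqDefect_move_lt _ (by simpa using hij.ne) (nu.2 hij.le) ha
  · rfl

/-- Beyond the length of `nu` there is nothing to take from entry `j`, so additional variables
contribute empty sums. -/
theorem raiseSum_eq {N : ℕ} {nu : IntPartition} (hN : nu.length ≤ N) (A : IntPartition → QAlpha) :
    raiseSum nu A = ∑ i : Fin N, ∑ j ∈ Ioi i, ∑ a ∈ Ioc (nu.1 i) (nu.1 i + nu.1 j),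
      (2 * a - nu.1 i - nu.1 j) * A (ofParts (parts (move (expo N nu.1) i j a))) := by
  set G : ℕ → ℕ → QAlpha := fun i j => if i < j then
    ∑ a ∈ Ioc (nu.1 i) (nu.1 i + nu.1 j),
      (2 * a - nu.1 i - nu.1 j) * A (ofParts (parts (move nu.1 i j a))) else 0 with hG
  have h0 (i j : ℕ) (hj : nu.length ≤ j) : G i j = 0 := by
    simp [hG, apply_eq_zero hj]
  have h1 : raiseSum nu A = ∑ i ∈ range N, ∑ j ∈ range N, G i j := by
    refine (sum_subset (range_subset_range.2 hN) fun i _ hi => ?_).trans (sum_congr rfl fun i _ =>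
      sum_subset (range_subset_range.2 hN) fun j _ hj => h0 i j (by simpa using hj))
    refine sum_eq_zero fun j hj => ?_
    have : ¬ i < j := by
      simp only [mem_range] at hi hj
      omega
    simp [this]
  rw [h1, ← Fin.sum_univ_eq_sum_range (fun i => ∑ j ∈ range N, G i j)]
  refine sum_congr rfl fun i _ => ?_
  rw [← Fin.sum_univ_eq_sum_range (fun j => G i j)]
  have h2 : Ioi i = univ.filter fun j => i < j := by ext; simp
  rw [h2, sum_filter]
  refine sum_congr rfl fun j _ => ?_
  simp only [hG, Fin.lt_def, parts_move hN]

/-- Written with conjugate partitions, the difference of two eigenvalues does not involve `N`; one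
family of coefficients thus serves every number of variables. -/
theorem exists_jackCoefficients (lam : IntPartition) : ∃ A : IntPartition → QAlpha,
    A lam = hook lam ∧ (∀ nu, ¬ DominatedBy nu lam → A nu = 0) ∧
    ∀ nu, DominatedBy nu lam → nu ≠ lam →
      (RatFunc.X * (((lam.b : ℤ) - (nu.b : ℤ) : ℤ) : QAlpha) +
        (((nu.conj.b : ℤ) - (lam.conj.b : ℤ) : ℤ) : QAlpha)) * A nu = raiseSum nu A := by
  classical
  obtain ⟨A, hA⟩ := exists_recursion (fun nu : IntPartition => sqDefect (parts nu.1))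
    (fun nu A => if nu = lam then hook lam else if DominatedBy nu lam then
      (RatFunc.X * (((lam.b : ℤ) - (nu.b : ℤ) : ℤ) : QAlpha) +
        (((nu.conj.b : ℤ) - (lam.conj.b : ℤ) : ℤ) : QAlpha))⁻¹ * raiseSum nu A else 0) (by
    intro nu A B h
    simp only [raiseSum_congr h])
  refine ⟨A, by rw [hA, if_pos rfl], fun nu hnu => ?_, fun nu hnu hne => ?_⟩
  · rw [hA, if_neg, if_neg hnu]
    rintro rfl
    exact hnu (DominatedBy_refl nu)
  · conv_lhs => rw [hA nu, if_neg hne, if_pos hnu]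
    apply mul_inv_cancel_left₀
    apply ratFunc_X_mul_add_ne_zero
    have h1 := le_max_left lam.length nu.length
    have h2 := le_max_right lam.length nu.length
    have hlt := (below_expo h2 hnu).eigenZero_lt h2 h1 hne
    have k1 := conj_b_add_eigenZero h1
    have k2 := conj_b_add_eigenZero h2
    rw [hnu.1] at k2
    omega

theorem exists_isJackExpansion (lam : IntPartition) : ∃ a, IsJackExpansion lam a := by
  classical
  obtain ⟨A, hlam, hzero, hrec⟩ := exists_jackCoefficients lam
  let a : IntPartition →₀ QAlpha := Finsupp.onFinset (finite_dominatedBy lam).toFinset A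
    fun nu hnu => by
      simp only [Set.Finite.mem_toFinset, Set.mem_ofPred_eq]
      exact not_imp_comm.1 (hzero nu) hnu
  refine ⟨a, fun N hN => ?_⟩
  set f : MvPolynomial (Fin N) QAlpha := a.sum fun nu c => C c * monomialPoly N QAlpha nu with hf
  have hsym : f.IsSymmetric := isSymmetric_sum_monomialPoly a
  have hcoeff (e : Fin N →₀ ℕ) : coeff e f = A (ofParts (parts e)) :=
    coeff_sum_monomialPoly a (parts_ofParts e).symm
  have hcoeff' (nu : IntPartition) (hnu : nu.length ≤ N) : coeff (expo N nu.1) f = A nu :=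
    coeff_sum_monomialPoly a (parts_expo (length_le_iff.1 hnu))
  have hbelow : IsBelow lam f := by
    intro e he
    rw [hcoeff] at he
    exact below_of_parts_eq (parts_ofParts e).symm (not_imp_comm.1 (hzero _) he)
  refine ⟨?_, a.erase lam, fun nu hnu => ?_, ?_⟩
  · rw [laplaceBeltrami_eq hsym]
    congr 1
    refine eq_of_coeff_expo_eq (isSymmetric_fullOp _ hsym) ((MvPolynomial.IsSymmetric.C _).mul hsym)
      fun nu hnu => ?_
    rw [coeff_C_mul, coeff_fullOp _ _ hnu, ← eq_sub_iff_add_eq', ← sub_mul, eigenvalue_sub hN]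
    -- At `lam` the diagonal factor is zero, and raising leads out of the ideal below `lam`.
    by_cases hne : nu = lam
    · rw [hne, sub_self, sub_self, Int.cast_zero, mul_zero, add_zero, zero_mul]
      refine sum_eq_zero fun i _ => sum_eq_zero fun j hj => sum_eq_zero fun a ha => ?_
      by_contra h
      exact not_below_move (mem_Ioi.1 hj) ha (hbelow _ (right_ne_zero_of_mul h))
    by_cases hdom : DominatedBy nu lam
    · have h1 := hrec nu hdom hne
      rw [raiseSum_eq hnu] at h1
      simp_rw [hcoeff, ← h1]
      have h2 := parts_expo (length_le_iff.1 hnu)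
      rw [show ofParts (parts (expo N nu.1)) = nu from eq_of_parts_eq ((parts_ofParts _).trans h2)]
      have k1 := conj_b_add_eigenZero hN
      have k2 := conj_b_add_eigenZero hnu
      rw [hdom.1] at k2
      rw [show (nu.conj.b : ℤ) - lam.conj.b = eigenZero N lam - eigenZero N nu by omega]
    -- If a raised exponent were below `lam`, then so would `nu` be.
    · have h1 : coeff (expo N nu.1) f = 0 := by rw [hcoeff' nu hnu, hzero nu hdom]
      rw [h1, mul_zero]
      refine sum_eq_zero fun i _ => sum_eq_zero fun j hj => sum_eq_zero fun a ha => ?_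
      by_contra h
      have hb := (hbelow _ (right_ne_zero_of_mul h)).of_move (mem_Ioi.1 hj).ne
        (nu.2 (mem_Ioi.1 hj).le) ha
      exact hdom (hb.dominatedBy hnu hN)
  · rw [Finsupp.support_erase, mem_erase] at hnu
    refine ⟨?_, hnu.1⟩
    have h1 : A nu ≠ 0 := Finsupp.mem_support_iff.1 hnu.2
    exact not_imp_comm.1 (hzero nu) h1
  · have h1 : a lam = hook lam := hlam
    rw [← h1, hf, Finsupp.add_sum_erase' a lam (fun nu c => C c * monomialPoly N QAlpha nu) fun _ => by
      rw [C_0, zero_mul]]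

theorem isJackExpansion_jackCoeff (lam : IntPartition) : IsJackExpansion lam (jackCoeff lam) := by
  have h := exists_isJackExpansion lam
  rw [jackCoeff, dif_pos h]
  exact h.choose_spec

end Existence

end Jack

namespace Jack

open Finset MvPolynomial IntPartition

/-! ### Jack polynomials over `ℚ⟦α⟧` -/

section JackHat

theorem jackCoeff_mem_regular (lam nu : IntPartition) : jackCoeff lam nu ∈ regular := by
  have h1 := le_max_left lam.length nu.length
  have h2 := le_max_right lam.length nu.length
  have h := isJackExpansion_jackCoeff lam _ h1
  rw [← coeff_sum_monomialPoly (jackCoeff lam) (parts_expo (length_le_iff.1 h2))]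
  exact h.coeff_mem_regular h1 _

theorem exists_jackHat (lam : IntPartition) : ∃ a : IntPartition →₀ PowerSeries ℚ,
    ∀ nu, HahnSeries.ofPowerSeries ℤ ℚ (a nu) = toLaurent ℚ (jackCoeff lam nu) := by
  choose g hg using fun nu => mem_regular.1 (jackCoeff_mem_regular lam nu)
  refine ⟨Finsupp.onFinset (jackCoeff lam).support g fun nu hnu => ?_, hg⟩
  rw [Finsupp.mem_support_iff]
  intro h0
  apply hnu
  have h1 := hg nu
  rw [h0, map_zero] at h1
  exact HahnSeries.ofPowerSeries_injective (h1.trans (map_zero _).symm)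

/-- The expansions at `α = 0` of the coefficients of the Jack symmetric function. -/
noncomputable def jackHat (lam : IntPartition) : IntPartition →₀ PowerSeries ℚ :=
  (exists_jackHat lam).choose

theorem ofPowerSeries_jackHat (lam nu : IntPartition) :
    HahnSeries.ofPowerSeries ℤ ℚ (jackHat lam nu) = toLaurent ℚ (jackCoeff lam nu) :=
  (exists_jackHat lam).choose_spec nu

/-- The Jack polynomial with coefficients expanded at `α = 0`. -/
noncomputable def jackHatPoly (N : ℕ) (lam : IntPartition) :
    MvPolynomial (Fin N) (PowerSeries ℚ) :=
  (jackHat lam).sum fun nu c => C c * monomialPoly N (PowerSeries ℚ) nu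

variable {N : ℕ} {lam : IntPartition}

theorem isSymmetric_jackHatPoly : (jackHatPoly N lam).IsSymmetric :=
  isSymmetric_sum_monomialPoly _

theorem ofPowerSeries_coeff_jackHatPoly (e : Fin N →₀ ℕ) :
    HahnSeries.ofPowerSeries ℤ ℚ (coeff e (jackHatPoly N lam)) =
      toLaurent ℚ (coeff e ((jackCoeff lam).sum fun nu c => C c * monomialPoly N QAlpha nu)) := by
  obtain ⟨nu, -, h⟩ := exists_partition_parts e
  rw [jackHatPoly, coeff_sum_monomialPoly _ h.symm, coeff_sum_monomialPoly _ h.symm,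
    ofPowerSeries_jackHat]

theorem isBelow_jackHatPoly (h : lam.length ≤ N) : IsBelow lam (jackHatPoly N lam) := by
  intro e he
  refine (isJackExpansion_jackCoeff lam N h).isBelow e fun h0 => he ?_
  have h1 := ofPowerSeries_coeff_jackHatPoly (lam := lam) e
  rw [h0, map_zero] at h1
  exact HahnSeries.ofPowerSeries_injective (h1.trans (map_zero _).symm)

theorem coeff_expo_jackHatPoly (h : lam.length ≤ N) :
    coeff (expo N lam.1) (jackHatPoly N lam) = hookProd PowerSeries.X lam := by
  apply HahnSeries.ofPowerSeries_injective (Γ := ℤ)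
  rw [ofPowerSeries_coeff_jackHatPoly, (isJackExpansion_jackCoeff lam N h).coeff_expo h, hook_eq,
    map_hookProd, map_hookProd, toLaurent_X]

/-- The eigenvalue equation is compared in Laurent series, where both `ℚ(α)` and `ℚ⟦α⟧` embed. -/
theorem fullOp_jackHatPoly (h : lam.length ≤ N) :
    fullOp (PowerSeries.C (1 / 2 : ℚ) * PowerSeries.X) (jackHatPoly N lam) =
      C (PowerSeries.X * (lam.b : PowerSeries ℚ) + (eigenZero N lam : PowerSeries ℚ)) *
        jackHatPoly N lam := by
  apply map_injective (HahnSeries.ofPowerSeries ℤ ℚ) HahnSeries.ofPowerSeries_injective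
  have hmap : map (HahnSeries.ofPowerSeries ℤ ℚ) (jackHatPoly N lam) = map (toLaurent ℚ)
      ((jackCoeff lam).sum fun nu c => C c * monomialPoly N QAlpha nu) := by
    ext1 e
    rw [coeff_map, coeff_map, ofPowerSeries_coeff_jackHatPoly]
  have h1 := congrArg (map (toLaurent ℚ)) (isJackExpansion_jackCoeff lam N h).fullOp_eq
  rw [map_fullOp, map_mul, map_C, ← hmap, eigenvalue_eq h] at h1
  rw [map_fullOp, map_mul (MvPolynomial.map _), MvPolynomial.map_C]
  have h0 : (2 : LaurentSeries ℚ) ≠ 0 := by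
    rw [← map_ofNat (toLaurent ℚ) 2, map_ne_zero]
    exact two_ne_zero
  have h2 : HahnSeries.ofPowerSeries ℤ ℚ (PowerSeries.C (1 / 2 : ℚ) * PowerSeries.X) =
      toLaurent ℚ (RatFunc.X / 2) := by
    rw [map_div₀ (toLaurent ℚ), toLaurent_X, map_ofNat, eq_div_iff h0,
      ← map_ofNat (HahnSeries.ofPowerSeries ℤ ℚ), ← map_mul]
    congr 1
    rw [mul_right_comm, ← map_ofNat (PowerSeries.C (R := ℚ)), ← map_mul]
    norm_num
  rw [h2, h1]
  simp [toLaurent_X]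

end JackHat

/-! ### Extending derivations to fractions and to power series -/

section Derivations

/-- A derivation of an integral domain extends to its field of fractions. -/
theorem exists_derivation_isFractionRing {k S R : Type*} [CommRing k] [CommRing S] [IsDomain S]
    [Algebra k S] [Field R] [Algebra S R] [IsFractionRing S R] (D : Derivation k S S) :
    ∃ D' : Derivation ℤ R R, ∀ s, D' (algebraMap S R s) = algebraMap S R (D s) := by
  let ι := algebraMap S R
  -- A derivation is the nilpotent part of the homomorphism `s ↦ s + ε D s` to dual numbers. It
  -- extends to fractions because dual numbers with invertible first component are units.
  let φ : S →+* TrivSqZeroExt R R :=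
    { toFun := fun s => TrivSqZeroExt.inl (ι s) + TrivSqZeroExt.inr (ι (D s))
      map_one' := by ext <;> simp
      map_zero' := by ext <;> simp
      map_add' := fun a b => by ext <;> simp
      map_mul' := fun a b => by ext <;> simp; ring }
  have hu (y : nonZeroDivisors S) : IsUnit (φ y) := by
    rw [TrivSqZeroExt.isUnit_iff_isUnit_fst, show (φ y).fst = ι y by simp [φ]]
    exact IsLocalization.map_units R y
  let ψ : R →+* TrivSqZeroExt R R := IsLocalization.lift hu
  have hψ (s : S) : ψ (ι s) = φ s := IsLocalization.lift_eq hu s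
  have hfst : (TrivSqZeroExt.fstHom ℤ R R).toRingHom.comp ψ = RingHom.id R := by
    apply IsLocalization.ringHom_ext (nonZeroDivisors S)
    ext s
    change (ψ (ι s)).fst = ι s
    rw [hψ]
    simp [φ]
  have hfst' (x : R) : (ψ x).fst = x := RingHom.congr_fun hfst x
  refine ⟨Derivation.mk' (AddMonoidHom.toIntLinearMap
    ⟨⟨fun x => (ψ x).snd, by simp⟩, fun x y => by simp⟩) fun a b => ?_, fun s => ?_⟩
  · change (ψ (a * b)).snd = a • (ψ b).snd + b • (ψ a).snd
    rw [map_mul, TrivSqZeroExt.snd_mul, hfst', hfst']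
    simp [mul_comm]
  · change (ψ (ι s)).snd = ι (D s)
    rw [hψ]
    simp [φ]

/-- The extension of a derivation to power series with constant variable. -/
noncomputable def coeffwise {R : Type*} [CommRing R] (D : Derivation ℤ R R) :
    Derivation ℤ (PowerSeries R) (PowerSeries R) :=
  Derivation.mk' (AddMonoidHom.toIntLinearMap
    ⟨⟨fun f => PowerSeries.mk fun n => D (PowerSeries.coeff n f), by ext; simp⟩,
      fun f g => by ext; simp⟩) fun f g => by
    change (PowerSeries.mk fun n => D (PowerSeries.coeff n (f * g))) =
      f * (PowerSeries.mk fun n => D (PowerSeries.coeff n g)) +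
      g * (PowerSeries.mk fun n => D (PowerSeries.coeff n f))
    rw [mul_comm g]
    ext n
    simp only [PowerSeries.coeff_mk, PowerSeries.coeff_mul, map_sum, map_add, ← sum_add_distrib,
      Derivation.leibniz, smul_eq_mul]
    exact sum_congr rfl fun p _ => by ring

theorem coeff_coeffwise {R : Type*} [CommRing R] (D : Derivation ℤ R R) (f : PowerSeries R)
    (n : ℕ) : PowerSeries.coeff n (coeffwise D f) = D (PowerSeries.coeff n f) :=
  PowerSeries.coeff_mk n fun n => D (PowerSeries.coeff n f)

theorem coeffwise_X {R : Type*} [CommRing R] (D : Derivation ℤ R R) :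
    coeffwise D PowerSeries.X = 0 := by
  ext n
  rw [coeff_coeffwise, PowerSeries.coeff_X]
  split_ifs <;> simp

theorem coeffwise_C {R : Type*} [CommRing R] (D : Derivation ℤ R R) (a : R) :
    coeffwise D (PowerSeries.C a) = PowerSeries.C (D a) := by
  ext n
  rw [coeff_coeffwise, PowerSeries.coeff_C, PowerSeries.coeff_C]
  split_ifs <;> simp

end Derivations

/-! ### From polynomials over `ℚ⟦α⟧` to power series over a field -/

section ToSeries

variable {N : ℕ} (R : Type*) [Field R] [Algebra (MvPolynomial (Fin N) ℚ) R]

/-- A polynomial with coefficients in `ℚ⟦α⟧`, as a power series in `α` over a field `R`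
that contains `x_1, …, x_N`. -/
noncomputable def toSeries : MvPolynomial (Fin N) (PowerSeries ℚ) →+* PowerSeries R :=
  eval₂Hom (PowerSeries.map ((algebraMap (MvPolynomial (Fin N) ℚ) R).comp C))
    fun i => PowerSeries.C (algebraMap (MvPolynomial (Fin N) ℚ) R (X i))

theorem toSeries_C (a : PowerSeries ℚ) :
    toSeries R (C a : MvPolynomial (Fin N) (PowerSeries ℚ)) =
      PowerSeries.map ((algebraMap (MvPolynomial (Fin N) ℚ) R).comp C) a := by
  simp [toSeries]

theorem toSeries_X (i : Fin N) : toSeries R (X i) =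
    PowerSeries.C (algebraMap (MvPolynomial (Fin N) ℚ) R (X i)) := by
  simp [toSeries]

theorem constantCoeff_toSeries (f : MvPolynomial (Fin N) (PowerSeries ℚ)) :
    PowerSeries.constantCoeff (toSeries R f) =
      algebraMap (MvPolynomial (Fin N) ℚ) R (map PowerSeries.constantCoeff f) := by
  have : (PowerSeries.constantCoeff (R := R)).comp (toSeries R) =
      (algebraMap (MvPolynomial (Fin N) ℚ) R).comp (map PowerSeries.constantCoeff) := by
    apply MvPolynomial.ringHom_ext
    · intro a
      simp only [RingHom.comp_apply, toSeries_C, map_C, ← PowerSeries.coeff_zero_eq_constantCoeff_apply,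
        PowerSeries.coeff_map]
    · intro i
      simp [toSeries_X]
  exact RingHom.congr_fun this f

theorem X_pow_dvd_toSeries {m : ℕ} {f : MvPolynomial (Fin N) (PowerSeries ℚ)}
    (h : C (PowerSeries.X ^ m) ∣ f) : PowerSeries.X ^ m ∣ toSeries R f := by
  have := map_dvd (toSeries R) h
  rwa [toSeries_C, map_pow, PowerSeries.map_X] at this

variable [IsFractionRing (MvPolynomial (Fin N) ℚ) R]

/-- The constant term in `α` of the image is the polynomial at `α = 0`, embedded injectively in `R`;
factors `α` are split off one by one. -/
theorem dvd_of_X_pow_dvd_toSeries (m : ℕ) {f : MvPolynomial (Fin N) (PowerSeries ℚ)}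
    (h : PowerSeries.X ^ m ∣ toSeries R f) :
    C (PowerSeries.X ^ m) ∣ f := by
  induction m generalizing f with
  | zero => simp
  | succ m ih =>
    have h0 : PowerSeries.X ∣ toSeries R f := (dvd_pow_self _ (Nat.succ_ne_zero m)).trans h
    rw [PowerSeries.X_dvd_iff, constantCoeff_toSeries, map_eq_zero_iff _ (IsFractionRing.injective _ _)]
      at h0
    have h1 : C PowerSeries.X ∣ f := by
      rw [C_dvd_iff_dvd_coeff]
      intro e
      rw [PowerSeries.X_dvd_iff, ← coeff_map, h0, coeff_zero]
    obtain ⟨g, rfl⟩ := h1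
    rw [map_mul, toSeries_C, PowerSeries.map_X, pow_succ',
      mul_dvd_mul_iff_left PowerSeries.X_ne_zero] at h
    rw [pow_succ', C_mul]
    exact mul_dvd_mul_left _ (ih h)

/-- The partial derivatives of rational functions. -/
noncomputable def ratDeriv (i : Fin N) : Derivation ℤ R R :=
  (exists_derivation_isFractionRing (pderiv (R := ℚ) i)).choose

theorem ratDeriv_algebraMap (i : Fin N) (f : MvPolynomial (Fin N) ℚ) :
    ratDeriv R i (algebraMap _ R f) = algebraMap _ R (pderiv i f) :=
  (exists_derivation_isFractionRing (pderiv (R := ℚ) i)).choose_spec f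

theorem coeffwise_toSeries (i : Fin N) (f : MvPolynomial (Fin N) (PowerSeries ℚ)) :
    coeffwise (ratDeriv R i) (toSeries R f) = toSeries R (pderiv i f) := by
  induction f using MvPolynomial.induction_on with
  | C a =>
    rw [pderiv_C, map_zero, toSeries_C]
    ext n
    rw [coeff_coeffwise, PowerSeries.coeff_map, RingHom.comp_apply, ratDeriv_algebraMap]
    simp
  | add p q hp hq => simp only [map_add, hp, hq]
  | mul_X p j hp =>
    rw [map_mul, Derivation.leibniz, hp, pderiv_mul, toSeries_X, coeffwise_C, ratDeriv_algebraMap,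
      map_add, map_mul, map_mul, toSeries_X, smul_eq_mul, smul_eq_mul]
    by_cases hij : j = i
    · subst hij
      simp only [pderiv_X_self, map_one]
      ring
    · simp only [pderiv_X_of_ne hij, map_zero]
      ring

end ToSeries

end Jack

namespace Jack

open Finset MvPolynomial IntPartition

instance charZero_powerSeries : CharZero (PowerSeries ℚ) :=
  charZero_of_injective_ringHom PowerSeries.C_injective

/-! ### The first-order part as a vector field -/

section FirstOrder

variable {N : ℕ} (R : Type*) [Field R] [Algebra (MvPolynomial (Fin N) ℚ) R]

/-- The coefficient of `∂_i` in the Laplace–Beltrami operator. -/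
noncomputable def weight (i : Fin N) : R :=
  ∑ j ∈ univ.erase i, algebraMap (MvPolynomial (Fin N) ℚ) R (X i) ^ 2 *
    (algebraMap (MvPolynomial (Fin N) ℚ) R (X i) - algebraMap (MvPolynomial (Fin N) ℚ) R (X j))⁻¹

variable [IsFractionRing (MvPolynomial (Fin N) ℚ) R]

theorem inv_mul_X_sub_X {i j : Fin N} (hij : i ≠ j) :
    (algebraMap (MvPolynomial (Fin N) ℚ) R (X i) - algebraMap (MvPolynomial (Fin N) ℚ) R (X j))⁻¹ *
      (algebraMap (MvPolynomial (Fin N) ℚ) R (X i) - algebraMap (MvPolynomial (Fin N) ℚ) R (X j)) = 1 := by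
  rw [← map_sub]
  apply inv_mul_cancel₀
  rw [map_ne_zero_iff _ (IsFractionRing.injective _ _)]
  exact X_sub_X_ne_zero hij

theorem sum_weight_mul_pderiv {f : MvPolynomial (Fin N) ℚ} (hf : f.IsSymmetric) :
    ∑ i, weight R i * algebraMap (MvPolynomial (Fin N) ℚ) R (pderiv i f) =
      algebraMap (MvPolynomial (Fin N) ℚ) R (lbOp f) := by
  rw [← sum_mul_pderiv_eq_lbOp (algebraMap (MvPolynomial (Fin N) ℚ) R)
    (fun i j => (algebraMap (MvPolynomial (Fin N) ℚ) R (X i) - algebraMap (MvPolynomial (Fin N) ℚ) R (X j))⁻¹)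
    (fun i j hij => inv_mul_X_sub_X R hij) hf]
  simp only [weight, sum_mul]

theorem sum_weight_mul_pderiv_series {f : MvPolynomial (Fin N) (PowerSeries ℚ)}
    (hf : f.IsSymmetric) :
    ∑ i, PowerSeries.C (weight R i) * toSeries R (pderiv i f) = toSeries R (lbOp f) := by
  rw [← sum_mul_pderiv_eq_lbOp (toSeries R)
    (fun i j => PowerSeries.C (algebraMap (MvPolynomial (Fin N) ℚ) R (X i) -
      algebraMap (MvPolynomial (Fin N) ℚ) R (X j))⁻¹)
    (fun i j hij => by
      rw [toSeries_X, toSeries_X, ← map_sub (PowerSeries.C (R := R)),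
        ← map_mul (PowerSeries.C (R := R)), inv_mul_X_sub_X R hij, map_one]) hf]
  simp only [weight, map_sum, map_mul, map_pow, sum_mul, toSeries_X]

end FirstOrder

/-! ### The Leibniz rule on symmetric polynomials -/

section LbOpMul

variable {N : ℕ}

/-- On symmetric polynomials `lbOp` is the vector field `∑ weight_i ∂_i` over the fraction field,
hence a derivation. -/
theorem lbOp_mul {f g : MvPolynomial (Fin N) ℚ} (hf : f.IsSymmetric) (hg : g.IsSymmetric) :
    lbOp (f * g) = lbOp f * g + f * lbOp g := by
  let R := FractionRing (MvPolynomial (Fin N) ℚ)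
  apply IsFractionRing.injective (MvPolynomial (Fin N) ℚ) R
  rw [map_add, map_mul, map_mul, ← sum_weight_mul_pderiv R hf, ← sum_weight_mul_pderiv R hg,
    ← sum_weight_mul_pderiv R (hf.mul hg), sum_mul, mul_sum, ← sum_add_distrib]
  refine sum_congr rfl fun i _ => ?_
  rw [pderiv_mul, map_add, map_mul, map_mul]
  ring

theorem lbOp_one : lbOp (1 : MvPolynomial (Fin N) ℚ) = 0 := by
  have h := lbOp_mul (N := N) MvPolynomial.IsSymmetric.one MvPolynomial.IsSymmetric.one
  simpa using h

theorem isSymmetric_prod {K ι : Type*} [CommSemiring K] (s : Finset ι)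
    {f : ι → MvPolynomial (Fin N) K} (hf : ∀ i, (f i).IsSymmetric) : (∏ i ∈ s, f i).IsSymmetric := by
  intro σ
  rw [map_prod]
  exact prod_congr rfl fun i _ => hf i σ

theorem lbOp_prod {ι : Type*} (s : Finset ι) (n : ι → ℕ) {f : ι → MvPolynomial (Fin N) ℚ}
    (hf : ∀ i, (f i).IsSymmetric) (h : ∀ i ∈ s, lbOp (f i) = C (n i : ℚ) * f i) :
    lbOp (∏ i ∈ s, f i) = C ((∑ i ∈ s, n i : ℕ) : ℚ) * ∏ i ∈ s, f i := by
  classical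
  induction s using Finset.induction with
  | empty => simp [lbOp_one]
  | insert i s hi ih =>
    rw [prod_insert hi, sum_insert hi, lbOp_mul (hf i) (isSymmetric_prod s hf),
      h i (mem_insert_self i s), ih fun j hj => h j (mem_insert_of_mem hj)]
    push_cast
    rw [map_add]
    ring

end LbOpMul

/-! ### Alternating sums of eigenvalues and of partitions -/

section AltSums

theorem altProd_mul_prod_odd {ι G : Type*} [CommGroup G] (S : Finset ι) (u : Finset ι → G) :
    altProd S u * ∏ I ∈ S.powerset with Odd I.card, u I =
      ∏ I ∈ S.powerset with ¬ Odd I.card, u I := by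
  rw [altProd, ← prod_filter_mul_prod_filter_not S.powerset (fun I => Odd I.card), mul_right_comm,
    ← prod_mul_distrib]
  rw [prod_eq_one, one_mul]
  · refine prod_congr rfl fun I hI => ?_
    rw [(Nat.not_odd_iff_even.1 (mem_filter.1 hI).2).neg_one_pow, zpow_one]
  · intro I hI
    rw [(mem_filter.1 hI).2.neg_one_pow, zpow_neg_one, inv_mul_cancel]

variable {ι : Type*} [DecidableEq ι]

theorem altSum_linear {M : Type*} [AddCommGroup M] {S : Finset ι} (hS : 2 ≤ S.card) (v : ι → M) :
    altSum S (fun I => ∑ i ∈ I, v i) = 0 := by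
  have h : altSum S (fun I => ∑ i ∈ I, v i) = altSum S fun I => ∑ i ∈ S with {i} ⊆ I, v i := by
    refine sum_congr rfl fun I hI => ?_
    congr 1
    refine sum_congr ?_ fun _ _ => rfl
    ext i
    simp only [mem_filter, singleton_subset_iff]
    exact ⟨fun hi => ⟨mem_powerset.1 hI hi, hi⟩, fun hi => hi.2⟩
  rw [h, altSum_sum_subset S S (fun i => {i}) fun i hi => singleton_subset_iff.2 hi, filter_false_of_mem,
    sum_empty]
  rintro i - rfl
  simp at hS

/-- Each product `v i * v j` involves at most two elements, so it cannot use all of `S`. -/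
theorem altSum_sq {K : Type*} [CommRing K] {S : Finset ι} (hS : 3 ≤ S.card) (v : ι → K) :
    altSum S (fun I => (∑ i ∈ I, v i) ^ 2) = 0 := by
  have h : altSum S (fun I => (∑ i ∈ I, v i) ^ 2) =
      altSum S fun I => ∑ p ∈ S ×ˢ S with {p.1, p.2} ⊆ I, v p.1 * v p.2 := by
    refine sum_congr rfl fun I hI => ?_
    congr 1
    beta_reduce
    rw [sq, sum_mul_sum, ← sum_product']
    refine sum_congr ?_ fun _ _ => rfl
    ext p
    simp only [mem_filter, insert_subset_iff, singleton_subset_iff, mem_product]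
    exact ⟨fun hi => ⟨⟨mem_powerset.1 hI hi.1, mem_powerset.1 hI hi.2⟩, hi⟩, fun hi => hi.2⟩
  rw [h, altSum_sum_subset S (S ×ˢ S) (fun p => {p.1, p.2}) fun p hp => by
    rw [mem_product] at hp
    simp [insert_subset_iff, hp.1, hp.2], filter_false_of_mem, sum_empty]
  rintro p - rfl
  have := card_le_two (a := p.1) (b := p.2)
  omega

theorem altSum_eigenZero (N : ℕ) (lam : ι → IntPartition) {S : Finset ι} (hS : 2 ≤ S.card) :
    altSum S (fun I => (eigenZero N (∑ i ∈ I, lam i) : ℤ)) = 0 := by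
  simp_rw [eigenZero_sum, Nat.cast_sum]
  exact altSum_linear hS _

theorem altSum_b {N : ℕ} (lam : ι → IntPartition) (hN : ∀ i, (lam i).length ≤ N) {S : Finset ι}
    (hS : 3 ≤ S.card) : altSum S (fun I => ((∑ i ∈ I, lam i).b : ℤ)) = 0 := by
  -- Doubling replaces the binomial coefficient of `n` by the integral polynomial `n² - n`.
  have h2 : (2 : ℤ) * altSum S (fun I => ((∑ i ∈ I, lam i).b : ℤ)) = 0 := by
    rw [← altSum_const_mul]
    have h (I : Finset ι) : 2 * ((∑ i ∈ I, lam i).b : ℤ) =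
        ∑ k : Fin N, ((∑ i ∈ I, ((lam i).1 k : ℤ)) ^ 2 + -1 * ∑ i ∈ I, ((lam i).1 k : ℤ)) := by
      rw [b_eq (length_sum_le fun i _ => hN i), Nat.cast_sum, mul_sum]
      refine sum_congr rfl fun k _ => ?_
      rw [← natCast_mul_sub_one, coe_sum_apply, Nat.cast_sum]
      ring
    simp_rw [h, altSum_sum, altSum_add, altSum_const_mul, altSum_sq hS,
      altSum_linear (by omega : 2 ≤ S.card)]
    simp
  exact (mul_eq_zero.1 h2).resolve_left two_ne_zero

/-- The linear part dies for `|S| ≥ 2` and the quadratic part for `|S| ≥ 3`; for `|S| = 2` a single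
factor `α` is required, and it is explicit. -/
theorem X_pow_dvd_altSum {K : Type*} [CommRing K] {N : ℕ} (lam : ι → IntPartition)
    (hN : ∀ i, (lam i).length ≤ N) (S : Finset ι) :
    (PowerSeries.X : PowerSeries K) ^ (S.card - 1) ∣ altSum S fun I =>
      PowerSeries.X * ((∑ i ∈ I, lam i).b : PowerSeries K) +
        (eigenZero N (∑ i ∈ I, lam i) : PowerSeries K) := by
  rcases lt_or_ge S.card 2 with h | h
  · rw [show S.card - 1 = 0 by omega, pow_zero]
    exact one_dvd _
  have h1 := map_altSum (Int.castRingHom (PowerSeries K)) S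
    (fun I => (eigenZero N (∑ i ∈ I, lam i) : ℤ))
  rw [altSum_eigenZero N lam h, map_zero] at h1
  simp only [eq_intCast, Int.cast_natCast] at h1
  rw [altSum_add, altSum_const_mul, ← h1, add_zero]
  rcases h.eq_or_lt with h | h
  · rw [← h]
    simp
  have h2 := map_altSum (Int.castRingHom (PowerSeries K)) S
    (fun I => ((∑ i ∈ I, lam i).b : ℤ))
  rw [altSum_b lam hN h, map_zero] at h2
  simp only [eq_intCast, Int.cast_natCast] at h2
  rw [← h2, mul_zero]
  exact dvd_zero _

theorem sum_even_eq_sum_odd (lam : ι → IntPartition) {S : Finset ι} (hS : 2 ≤ S.card) :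
    ∑ I ∈ S.powerset with ¬ Odd I.card, ∑ i ∈ I, lam i =
      ∑ I ∈ S.powerset with Odd I.card, ∑ i ∈ I, lam i := by
  apply Subtype.ext
  ext k
  rw [coe_sum_apply, coe_sum_apply]
  have h := altSum_linear hS fun i => ((lam i).1 k : ℤ)
  rw [altSum, ← sum_filter_add_sum_filter_not S.powerset (fun I => Odd I.card),
    add_eq_zero_iff_neg_eq, ← sum_neg_distrib] at h
  have h1 : ∑ I ∈ S.powerset with Odd I.card, (((∑ i ∈ I, lam i).1 k : ℕ) : ℤ) =
      ∑ I ∈ S.powerset with ¬ Odd I.card, (((∑ i ∈ I, lam i).1 k : ℕ) : ℤ) := by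
    refine (sum_congr rfl fun I hI => ?_).trans (h.trans (sum_congr rfl fun I hI => ?_))
    · rw [(mem_filter.1 hI).2.neg_one_pow, coe_sum_apply]
      simp
    · rw [(Nat.not_odd_iff_even.1 (mem_filter.1 hI).2).neg_one_pow, coe_sum_apply]
      simp
  exact_mod_cast h1.symm

end AltSums

/-! ### Invertibility of Jack polynomials as series in `α` -/

section Units

variable {N : ℕ}

theorem constantCoeff_hookProd_ne_zero (lam : IntPartition) :
    PowerSeries.constantCoeff (hookProd (PowerSeries.X : PowerSeries ℚ) lam) ≠ 0 := by
  rw [map_hookProd, PowerSeries.constantCoeff_X, hookProd, prod_ne_zero_iff]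
  intro s _
  rw [zero_mul, zero_add]
  positivity

/-- At `α = 0` the leading coefficient is the product of the numbers `leg + 1`. -/
theorem map_constantCoeff_jackHatPoly_ne_zero {lam : IntPartition} (h : lam.length ≤ N) :
    map PowerSeries.constantCoeff (jackHatPoly N lam) ≠ 0 := by
  intro h0
  have := congrArg (coeff (expo N lam.1)) h0
  rw [coeff_map, coeff_expo_jackHatPoly h, coeff_zero] at this
  exact constantCoeff_hookProd_ne_zero lam this

variable (R : Type*) [Field R] [Algebra (MvPolynomial (Fin N) ℚ) R]
  [IsFractionRing (MvPolynomial (Fin N) ℚ) R]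

theorem isUnit_toSeries_jackHatPoly {lam : IntPartition} (h : lam.length ≤ N) :
    IsUnit (toSeries R (jackHatPoly N lam)) := by
  rw [PowerSeries.isUnit_iff_constantCoeff, constantCoeff_toSeries, isUnit_iff_ne_zero,
    map_ne_zero_iff _ (IsFractionRing.injective _ _)]
  exact map_constantCoeff_jackHatPoly_ne_zero h

end Units

end Jack

namespace Jack

open Finset MvPolynomial IntPartition

/-! ### Leading coefficients of the even and odd products -/

section Leading

variable {ι : Type*}

/-- The product of the Jack polynomials of the sums over the subsets of even cardinality. -/
noncomputable def evenProd (N : ℕ) (lam : ι → IntPartition) (S : Finset ι) :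
    MvPolynomial (Fin N) (PowerSeries ℚ) :=
  ∏ I ∈ S.powerset with ¬ Odd I.card, jackHatPoly N (∑ i ∈ I, lam i)

/-- The product of the Jack polynomials of the sums over the subsets of odd cardinality. -/
noncomputable def oddProd (N : ℕ) (lam : ι → IntPartition) (S : Finset ι) :
    MvPolynomial (Fin N) (PowerSeries ℚ) :=
  ∏ I ∈ S.powerset with Odd I.card, jackHatPoly N (∑ i ∈ I, lam i)

/-- The sum of the sums over the subsets of odd cardinality. -/
noncomputable def oddSum (lam : ι → IntPartition) (S : Finset ι) : IntPartition :=
  ∑ I ∈ S.powerset with Odd I.card, ∑ i ∈ I, lam i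

variable {N : ℕ} {lam : ι → IntPartition}

theorem isSymmetric_evenProd (S : Finset ι) : (evenProd N lam S).IsSymmetric :=
  isSymmetric_prod _ fun _ => isSymmetric_jackHatPoly

theorem isSymmetric_oddProd (S : Finset ι) : (oddProd N lam S).IsSymmetric :=
  isSymmetric_prod _ fun _ => isSymmetric_jackHatPoly

theorem length_oddSum_le (hN : ∀ i, (lam i).length ≤ N) (S : Finset ι) :
     (oddSum lam S).length ≤ N :=
  length_sum_le fun _ _ => length_sum_le fun i _ => hN i

theorem isBelow_oddProd (hN : ∀ i, (lam i).length ≤ N) (S : Finset ι) :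
     IsBelow (oddSum lam S) (oddProd N lam S) :=
  (IsBelow.prod _ fun _ _ => isBelow_jackHatPoly (length_sum_le fun i _ => hN i)).1

theorem isBelow_evenProd [DecidableEq ι] (hN : ∀ i, (lam i).length ≤ N) {S : Finset ι}
    (hS : 2 ≤ S.card) :
    IsBelow (oddSum lam S) (evenProd N lam S) := by
  rw [oddSum, ← sum_even_eq_sum_odd lam hS]
  exact (IsBelow.prod _ fun _ _ => isBelow_jackHatPoly (length_sum_le fun i _ => hN i)).1

/-- Both products have the same leading partition, and the ratio of their leading coefficients is
the alternating product of the hook products. -/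
theorem X_pow_dvd_coeff_sub [DecidableEq ι] (hN : ∀ i, (lam i).length ≤ N) {S : Finset ι}
    (hS : 2 ≤ S.card) :
    PowerSeries.X ^ (S.card - 1) ∣
      coeff (expo N (oddSum lam S).1) (evenProd N lam S - oddProd N lam S) := by
  have hlen (I : Finset ι) : (∑ i ∈ I, lam i).length ≤ N := length_sum_le fun i _ => hN i
  have hH (I : Finset ι) :
      IsUnit (hookProd (PowerSeries.X : PowerSeries ℚ) (∑ i ∈ I, lam i)) := by
    rw [PowerSeries.isUnit_iff_constantCoeff, isUnit_iff_ne_zero]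
    exact constantCoeff_hookProd_ne_zero _
  have hg (t n : ℕ) : IsUnit ((t : PowerSeries ℚ) + 1 + PowerSeries.X * (n : PowerSeries ℚ)) := by
    rw [PowerSeries.isUnit_iff_constantCoeff, isUnit_iff_ne_zero]
    simp only [map_add, map_natCast, map_one, map_mul, PowerSeries.constantCoeff_X, zero_mul,
      add_zero]
    positivity
  have key := altProd_hook_mem (fun t n => (hg t n).unit) (fun _ _ => rfl) lam
    (card_pos.1 (by omega : 0 < S.card)) (fun I => (hH I).unit) fun _ _ => rfl
  rw [mem_unitsCongrOne] at key
  have hprod := congrArg Units.val (altProd_mul_prod_odd S fun I => (hH I).unit)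
  simp only [Units.val_mul, Units.coe_prod, IsUnit.unit_spec] at hprod
  have hodd : coeff (expo N (oddSum lam S).1) (oddProd N lam S) =
      ∏ I ∈ S.powerset with Odd I.card, hookProd PowerSeries.X (∑ i ∈ I, lam i) :=
    (IsBelow.prod _ fun _ _ => isBelow_jackHatPoly (hlen _)).2.trans
      (prod_congr rfl fun I _ => coeff_expo_jackHatPoly (hlen I))
  have heven : coeff (expo N (oddSum lam S).1) (evenProd N lam S) =
      ∏ I ∈ S.powerset with ¬ Odd I.card, hookProd PowerSeries.X (∑ i ∈ I, lam i) := by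
    rw [oddSum, ← sum_even_eq_sum_odd lam hS]
    exact (IsBelow.prod _ fun _ _ => isBelow_jackHatPoly (hlen _)).2.trans
      (prod_congr rfl fun I _ => coeff_expo_jackHatPoly (hlen I))
  rw [coeff_sub, hodd, heven, ← hprod, ← sub_one_mul]
  exact key.mul_right _

end Leading

/-! ### The eigenvalue equation at `α = 0` -/

section ConstantTerm

variable {N : ℕ} {lam : IntPartition}

theorem lbOp_map_constantCoeff_jackHatPoly (h : lam.length ≤ N) :
    lbOp (MvPolynomial.map PowerSeries.constantCoeff (jackHatPoly N lam)) =
      C (eigenZero N lam : ℚ) * MvPolynomial.map PowerSeries.constantCoeff (jackHatPoly N lam) := by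
  have := congrArg (MvPolynomial.map PowerSeries.constantCoeff) (fullOp_jackHatPoly h)
  rw [map_fullOp, map_mul (MvPolynomial.map _), map_C] at this
  simpa [fullOp] using this

end ConstantTerm

/-! ### The induction on the order of vanishing -/

section Main

variable {ι : Type*} {N : ℕ} (R : Type*) [Field R]
  [Algebra (MvPolynomial (Fin N) ℚ) R] [IsFractionRing (MvPolynomial (Fin N) ℚ) R]
  {lam : ι → IntPartition} (hN : ∀ i, (lam i).length ≤ N)

/-- The Jack polynomial of the sum over `I`, as an invertible power series. -/
noncomputable def jackUnit (I : Finset ι) : (PowerSeries R)ˣ :=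
  (isUnit_toSeries_jackHatPoly R (length_sum_le (s := I) fun i _ => hN i)).unit

theorem altProd_jackUnit_mul (S : Finset ι) :
    ((altProd S (jackUnit R hN) : (PowerSeries R)ˣ) : PowerSeries R) * toSeries R (oddProd N lam S) =
      toSeries R (evenProd N lam S) := by
  have h := congrArg Units.val (altProd_mul_prod_odd S (jackUnit R hN))
  rw [oddProd, evenProd, map_prod, map_prod]
  simpa only [Units.val_mul, Units.coe_prod, jackUnit, IsUnit.unit_spec] using h

/-- Here `u - 1 = (P - Q) / Q` with `Q` a unit. Derivations act well on `u`, whereas symmetry and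
dominance are visible on `P - Q`. -/
theorem X_pow_dvd_altProd_jackUnit_iff (S : Finset ι) (m : ℕ) :
    PowerSeries.X ^ m ∣ ((altProd S (jackUnit R hN) : (PowerSeries R)ˣ) : PowerSeries R) - 1 ↔
      C (PowerSeries.X ^ m) ∣ evenProd N lam S - oddProd N lam S := by
  have hu : IsUnit (toSeries R (oddProd N lam S)) := by
    rw [oddProd, map_prod, IsUnit.prod_iff]
    exact fun I _ => isUnit_toSeries_jackHatPoly R (length_sum_le fun i _ => hN i)
  have h : toSeries R (evenProd N lam S - oddProd N lam S) =
      (↑(altProd S (jackUnit R hN)) - 1) * toSeries R (oddProd N lam S) := by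
    rw [map_sub, ← altProd_jackUnit_mul R hN S, sub_one_mul]
  rw [← hu.dvd_mul_right, ← h]
  exact ⟨dvd_of_X_pow_dvd_toSeries R m, X_pow_dvd_toSeries R⟩

theorem jackUnit_equation (I : Finset ι) :
    ∑ i : Fin N, PowerSeries.C (weight R i) * coeffwise (ratDeriv R i) (jackUnit R hN I : PowerSeries R) +
      PowerSeries.X * ∑ i, PowerSeries.C (algebraMap (MvPolynomial (Fin N) ℚ) R
        (C (1 / 2) * X i ^ 2)) *
          coeffwise (ratDeriv R i) (coeffwise (ratDeriv R i) (jackUnit R hN I : PowerSeries R)) =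
      (PowerSeries.X * ((∑ i ∈ I, lam i).b : PowerSeries R) +
        (eigenZero N (∑ i ∈ I, lam i) : PowerSeries R)) * (jackUnit R hN I : PowerSeries R) := by
  have h := congrArg (toSeries R)
    (fullOp_jackHatPoly (length_sum_le (s := I) fun i _ => hN i))
  rw [fullOp, map_add, ← sum_weight_mul_pderiv_series R isSymmetric_jackHatPoly] at h
  simp only [jackUnit, IsUnit.unit_spec, coeffwise_toSeries]
  simp only [map_mul, map_add, map_natCast, toSeries_C, toSeries_X, PowerSeries.map_X, map_sum,
    map_pow, PowerSeries.map_C, RingHom.comp_apply] at h ⊢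
  rw [← h]
  congr 1
  rw [mul_sum, mul_sum]
  exact sum_congr rfl fun i _ => by ring

/-- Quotient rule for `u = (Q + α^m g) / Q`: each derivation satisfies `D u * Q² = α^m (Q D g - g D
Q)`. The weighted sum yields `lbOp`, and `α^m` cancels. -/
theorem X_dvd_of_X_pow_succ_dvd {S : Finset ι} {m : ℕ} {g : MvPolynomial (Fin N) (PowerSeries ℚ)}
    (hg : evenProd N lam S - oddProd N lam S = C (PowerSeries.X ^ m) * g) (hsymm : g.IsSymmetric)
    (h : PowerSeries.X ^ (m + 1) ∣ ∑ i : Fin N, PowerSeries.C (weight R i) *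
      coeffwise (ratDeriv R i) ((altProd S (jackUnit R hN) : (PowerSeries R)ˣ) : PowerSeries R)) :
    PowerSeries.X ∣ toSeries R (oddProd N lam S * lbOp g - g * lbOp (oddProd N lam S)) := by
  set Q := oddProd N lam S
  set u : PowerSeries R := ((altProd S (jackUnit R hN) : (PowerSeries R)ˣ) : PowerSeries R)
  have hu : u * toSeries R Q = toSeries R Q + PowerSeries.X ^ m * toSeries R g := by
    rw [altProd_jackUnit_mul R hN, ← sub_eq_iff_eq_add', ← map_sub, hg, map_mul, toSeries_C, map_pow,
      PowerSeries.map_X]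
  have hD (i : Fin N) : coeffwise (ratDeriv R i) u * toSeries R Q ^ 2 = PowerSeries.X ^ m *
      (toSeries R Q * toSeries R (pderiv i g) - toSeries R g * toSeries R (pderiv i Q)) := by
    have h1 := congrArg (coeffwise (ratDeriv R i)) hu
    rw [map_add, Derivation.leibniz, Derivation.leibniz, Derivation.leibniz_pow, coeffwise_X,
      coeffwise_toSeries, coeffwise_toSeries] at h1
    simp only [smul_eq_mul, smul_zero, mul_zero, add_zero] at h1
    linear_combination (toSeries R Q) * h1 - toSeries R (pderiv i Q) * hu
  have hsum : (∑ i : Fin N, PowerSeries.C (weight R i) * coeffwise (ratDeriv R i) u) * toSeries R Q ^ 2 =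
      PowerSeries.X ^ m * toSeries R (Q * lbOp g - g * lbOp Q) := by
    rw [map_sub, map_mul, map_mul, ← sum_weight_mul_pderiv_series R hsymm,
      ← sum_weight_mul_pderiv_series R (isSymmetric_oddProd S), sum_mul, mul_sum, mul_sum,
      ← sum_sub_distrib, mul_sum]
    refine sum_congr rfl fun i _ => ?_
    rw [mul_assoc, hD]
    ring
  have h2 := h.mul_right (toSeries R Q ^ 2)
  rw [hsum, pow_succ, mul_dvd_mul_iff_left (pow_ne_zero m PowerSeries.X_ne_zero)] at h2
  exact h2

theorem C_X_pow_succ_dvd [DecidableEq ι] {S : Finset ι} {m : ℕ} (hm : m < S.card - 1)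
    (hS : C (PowerSeries.X ^ m) ∣ evenProd N lam S - oddProd N lam S)
    (h : PowerSeries.X ^ (m + 1) ∣ ∑ i : Fin N, PowerSeries.C (weight R i) *
      coeffwise (ratDeriv R i) ((altProd S (jackUnit R hN) : (PowerSeries R)ˣ) : PowerSeries R)) :
    C (PowerSeries.X ^ (m + 1)) ∣ evenProd N lam S - oddProd N lam S := by
  have hcard : 2 ≤ S.card := by omega
  have hXm : (C (PowerSeries.X ^ m) : MvPolynomial (Fin N) (PowerSeries ℚ)) ≠ 0 := by
    rw [Ne, C_eq_zero]
    exact pow_ne_zero m PowerSeries.X_ne_zero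
  obtain ⟨g, hg⟩ := hS
  have hsymm : g.IsSymmetric := by
    intro s
    have h1 := ((isSymmetric_evenProd S).sub (isSymmetric_oddProd S) :
      (evenProd N lam S - oddProd N lam S).IsSymmetric) s
    rw [hg, map_mul, rename_C] at h1
    exact mul_left_cancel₀ hXm h1
  have h0 := X_dvd_of_X_pow_succ_dvd R hN hg hsymm h
  rw [PowerSeries.X_dvd_iff, constantCoeff_toSeries,
    map_eq_zero_iff _ (IsFractionRing.injective _ _), map_sub, map_mul, map_mul, map_lbOp, map_lbOp]
    at h0
  set g0 := MvPolynomial.map PowerSeries.constantCoeff g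
  set Q0 := MvPolynomial.map PowerSeries.constantCoeff (oddProd N lam S)
  have hlen (I : Finset ι) : (∑ i ∈ I, lam i).length ≤ N := length_sum_le fun i _ => hN i
  have hQ : Q0 = ∏ I ∈ S.powerset with Odd I.card,
      MvPolynomial.map PowerSeries.constantCoeff (jackHatPoly N (∑ i ∈ I, lam i)) := map_prod _ _ _
  have hQ0 : Q0 ≠ 0 := by
    rw [hQ, prod_ne_zero_iff]
    exact fun I _ => map_constantCoeff_jackHatPoly_ne_zero (hlen I)
  have hlbQ : lbOp Q0 = C (eigenZero N (oddSum lam S) : ℚ) * Q0 := by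
    rw [hQ, oddSum, eigenZero_sum]
    exact lbOp_prod _ _ (fun I => isSymmetric_jackHatPoly.map _) fun I _ =>
      lbOp_map_constantCoeff_jackHatPoly (hlen I)
  -- At `α = 0` the relation reads `Q0 * L g0 = g0 * L Q0`, so `g0` inherits the eigenvalue of `Q0`.
  have hlbg : lbOp g0 = C (eigenZero N (oddSum lam S) : ℚ) * g0 := by
    apply mul_left_cancel₀ hQ0
    rw [sub_eq_zero.1 h0, hlbQ]
    ring
  have hcoeff (e : Fin N →₀ ℕ) : coeff e (evenProd N lam S - oddProd N lam S) =
      PowerSeries.X ^ m * coeff e g := by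
    rw [hg, coeff_C_mul]
  -- The factorization of hook products gives order `|S| - 1`, more than the `m` already split off.
  have hlead : coeff (expo N (oddSum lam S).1) g0 = 0 := by
    have h1 := (pow_dvd_pow (PowerSeries.X : PowerSeries ℚ) (by omega : m + 1 ≤ S.card - 1)).trans
      (X_pow_dvd_coeff_sub hN hcard)
    rw [hcoeff, pow_succ, mul_dvd_mul_iff_left (pow_ne_zero m PowerSeries.X_ne_zero),
      PowerSeries.X_dvd_iff] at h1
    rw [coeff_map, h1]
  -- Every partition left in `g0` is strictly dominated and has a smaller eigenvalue.
  have hg0 : g0 = 0 := by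
    refine eq_zero_of_lbOp_eq (hsymm.map _) _ hlbg fun nu hnu hne => ?_
    have hb : Below (oddSum lam S) (expo N nu.1) := by
      refine (isBelow_evenProd hN hcard).sub (isBelow_oddProd hN S) _ ?_
      rw [hcoeff]
      refine mul_ne_zero (pow_ne_zero m PowerSeries.X_ne_zero) fun h1 => hne ?_
      rw [coeff_map, h1, map_zero]
    refine (hb.eigenZero_lt hnu (length_oddSum_le hN S) ?_).ne
    rintro rfl
    exact hne hlead
  rw [hg, pow_succ, C_mul]
  refine mul_dvd_mul_left _ ?_
  rw [C_dvd_iff_dvd_coeff]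
  intro e
  rw [PowerSeries.X_dvd_iff, ← coeff_map]
  change coeff e g0 = 0
  rw [hg0, coeff_zero]

theorem X_pow_dvd_altProd_jackUnit [DecidableEq ι] {S : Finset ι} (hne : S.Nonempty) :
    PowerSeries.X ^ (S.card - 1) ∣
      ((altProd S (jackUnit R hN) : (PowerSeries R)ˣ) : PowerSeries R) - 1 := by
  induction S using Finset.strongInduction with
  | H S ih =>
    have key (m : ℕ) (hm : m ≤ S.card - 1) : PowerSeries.X ^ m ∣
        ((altProd S (jackUnit R hN) : (PowerSeries R)ˣ) : PowerSeries R) - 1 := by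
      induction m with
      | zero => simp
      | succ m ihm =>
        have hS := ihm (by omega)
        rw [X_pow_dvd_altProd_jackUnit_iff]
        refine C_X_pow_succ_dvd R hN (by omega)
          ((X_pow_dvd_altProd_jackUnit_iff R hN S m).1 hS) ?_
        refine dvd_sum_derivation_altProd PowerSeries.X (fun i => coeffwise (ratDeriv R i))
          (fun i => coeffwise_X _) _ _ (jackUnit R hN) _ S
          (fun I _ => jackUnit_equation R hN I) (X_pow_dvd_altSum lam hN S) (fun T hT hT' => ih T hT hT')
          (by omega) hS
    exact key _ le_rfl

end Main

section Polynomials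

variable {ι : Type*} [DecidableEq ι] {N : ℕ} {lam : ι → IntPartition}

theorem C_X_pow_dvd_evenProd_sub_oddProd (hN : ∀ i, (lam i).length ≤ N) {S : Finset ι}
    (hne : S.Nonempty) :
    C (PowerSeries.X ^ (S.card - 1)) ∣ evenProd N lam S - oddProd N lam S :=
  (X_pow_dvd_altProd_jackUnit_iff (FractionRing (MvPolynomial (Fin N) ℚ)) hN S _).1
    (X_pow_dvd_altProd_jackUnit _ hN hne)

end Polynomials

end Jack

namespace Jack

open Finset IntPartition

/-! ### Rational functions in `α` and their expansions at `0` -/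

section Expansion

variable {R : Type*} [Field R]

theorem toLaurent_C (x : R) :
    toLaurent R (RatFunc.C x) = HahnSeries.ofPowerSeries ℤ R (PowerSeries.C x) := by
  rw [← RatFunc.algebraMap_C, toLaurent_algebraMap, Polynomial.coe_C]

theorem toLaurent_eq_iff {f : RatFunc R} {a : PowerSeries R} :
    toLaurent R f = HahnSeries.ofPowerSeries ℤ R a ↔ (f.num : PowerSeries R) = a * f.denom := by
  have hd : toLaurent R (algebraMap _ _ f.denom) ≠ 0 := by
    rw [map_ne_zero]
    exact RatFunc.algebraMap_ne_zero f.denom_ne_zero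
  conv_lhs => rw [← RatFunc.num_div_denom f]
  rw [map_div₀, div_eq_iff hd, toLaurent_algebraMap, toLaurent_algebraMap, ← map_mul]
  exact HahnSeries.ofPowerSeries_injective.eq_iff

/-- If the denominator vanished at `0`, so would the numerator `a * denom`, against coprimality. -/
theorem denom_eval_zero_ne_zero {f : RatFunc R} {a : PowerSeries R}
    (h : toLaurent R f = HahnSeries.ofPowerSeries ℤ R a) : f.denom.eval 0 ≠ 0 := by
  intro h0
  have hnum := congrArg PowerSeries.constantCoeff (toLaurent_eq_iff.1 h)
  have hcc (p : Polynomial R) : PowerSeries.constantCoeff (p : PowerSeries R) = p.eval 0 := by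
    rw [← PowerSeries.coeff_zero_eq_constantCoeff_apply, Polynomial.coeff_coe,
      Polynomial.coeff_zero_eq_eval_zero]
  rw [map_mul, hcc, hcc, h0, mul_zero] at hnum
  obtain ⟨u, v, huv⟩ := f.isCoprime_num_denom
  have := congrArg (Polynomial.eval 0) huv
  simp [hnum, h0] at this

theorem toLaurent_extendScalars [Algebra ℚ R] {q : QAlpha} {a : PowerSeries ℚ}
    (h : toLaurent ℚ q = HahnSeries.ofPowerSeries ℤ ℚ a) :
    toLaurent R (extendScalars R q) =
      HahnSeries.ofPowerSeries ℤ R (PowerSeries.map (algebraMap ℚ R) a) := by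
  have hcoe (p : Polynomial ℚ) : ((p.map (algebraMap ℚ R) : Polynomial R) : PowerSeries R) =
      PowerSeries.map (algebraMap ℚ R) p := by
    ext n
    simp
  have hd : toLaurent R (algebraMap _ _ (q.denom.map (algebraMap ℚ R))) ≠ 0 := by
    rw [map_ne_zero]
    exact RatFunc.algebraMap_ne_zero
      ((Polynomial.map_ne_zero_iff (algebraMap ℚ R).injective).2 q.denom_ne_zero)
  rw [extendScalars, RatFunc.coe_mapRingHom_eq_coe_map, RatFunc.map_apply, map_div₀,
    Polynomial.coe_mapRingHom, div_eq_iff hd, toLaurent_algebraMap, toLaurent_algebraMap, ← map_mul, hcoe, hcoe,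
    toLaurent_eq_iff.1 h, map_mul]

end Expansion

/-! ### Jack series in an arbitrary alphabet -/

section JackSeries

/-- The Jack symmetric function, expanded at `α = 0`, with `m nu` in place of the monomial
symmetric functions. -/
noncomputable def jackSeries {A : Type*} [CommRing A] [Algebra ℚ A] (m : IntPartition → A)
    (lam : IntPartition) : PowerSeries A :=
  (jackHat lam).sum fun nu c => PowerSeries.map (algebraMap ℚ A) c * PowerSeries.C (m nu)

theorem map_jackSeries {A B : Type*} [CommRing A] [Algebra ℚ A] [CommRing B] [Algebra ℚ B]
    (φ : A →+* B) (m : IntPartition → A) (lam : IntPartition) :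
    PowerSeries.map φ (jackSeries m lam) = jackSeries (fun nu => φ (m nu)) lam := by
  rw [jackSeries, Finsupp.sum, map_sum]
  refine sum_congr rfl fun nu _ => ?_
  rw [map_mul, PowerSeries.map_C, ← RingHom.comp_apply (PowerSeries.map φ), ← PowerSeries.map_comp,
    Subsingleton.elim (φ.comp (algebraMap ℚ A)) (algebraMap ℚ B)]

theorem toLaurent_jackIn {R : Type*} [Field R] [Algebra ℚ R] (m : IntPartition → R)
    (lam : IntPartition) :
    toLaurent R (jackIn m lam) = HahnSeries.ofPowerSeries ℤ R (jackSeries m lam) := by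
  classical
  rw [jackIn, jackSeries, Finsupp.sum_of_support_subset _ subset_union_left _ (by simp),
    Finsupp.sum_of_support_subset (jackHat lam) subset_union_right _ (by simp), map_sum, map_sum]
  refine sum_congr rfl fun nu _ => ?_
  rw [map_mul, map_mul, toLaurent_C, toLaurent_extendScalars (ofPowerSeries_jackHat lam nu).symm]

/-- The difference of the product of the Jack series of the sums over the subsets of even
cardinality and the one for odd cardinality. -/
noncomputable def jackDiff {A ι : Type*} [CommRing A] [Algebra ℚ A] (m : IntPartition → A)
    (lam : ι → IntPartition) (S : Finset ι) : PowerSeries A :=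
  ∏ I ∈ S.powerset with ¬ Odd I.card, jackSeries m (∑ i ∈ I, lam i) -
    ∏ I ∈ S.powerset with Odd I.card, jackSeries m (∑ i ∈ I, lam i)

theorem map_jackDiff {A B ι : Type*} [CommRing A] [Algebra ℚ A] [CommRing B] [Algebra ℚ B]
    (φ : A →+* B) (m : IntPartition → A) (lam : ι → IntPartition) (S : Finset ι) :
    PowerSeries.map φ (jackDiff m lam S) = jackDiff (fun nu => φ (m nu)) lam S := by
  simp only [jackDiff, map_sub, map_prod, map_jackSeries]

theorem isBigO_of_dvd_jackDiff {R : Type*} [Field R] [Algebra ℚ R] {m : IntPartition → R} {r : ℕ}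
    (lam : Fin r → IntPartition) (hu : ∀ I : Finset (Fin r), IsUnit (jackSeries m (∑ i ∈ I, lam i)))
    (h : r ≠ 0 → PowerSeries.X ^ (r - 1) ∣ jackDiff m lam univ) :
    IsBigO ((∏ I : Finset (Fin r), jackIn m (∑ i ∈ I, lam i) ^ ((-1 : ℤ) ^ I.card)) - 1)
      ((r : ℤ) - 1) := by
  set U : Finset (Fin r) → (PowerSeries R)ˣ := fun I => (hu I).unit with hU
  set u : PowerSeries R := ((altProd univ U : (PowerSeries R)ˣ) : PowerSeries R)
  have hval : toLaurent R (∏ I : Finset (Fin r), jackIn m (∑ i ∈ I, lam i) ^ ((-1 : ℤ) ^ I.card)) =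
      HahnSeries.ofPowerSeries ℤ R u := by
    have h1 : HahnSeries.ofPowerSeries ℤ R u =
        ((Units.map (HahnSeries.ofPowerSeries ℤ R : PowerSeries R →* LaurentSeries R)
          (altProd univ U) : (LaurentSeries R)ˣ) : LaurentSeries R) := rfl
    rw [h1, altProd, powerset_univ, map_prod, map_prod, Units.coe_prod]
    refine prod_congr rfl fun I _ => ?_
    rw [map_zpow₀, map_zpow, Units.val_zpow_eq_zpow_val, toLaurent_jackIn]
    rfl
  have hdiff : jackDiff m lam univ = (u - 1) * ∏ I ∈ univ.powerset with Odd I.card,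
      jackSeries m (∑ i ∈ I, lam i) := by
    have h1 := congrArg Units.val (altProd_mul_prod_odd univ U)
    simp only [Units.val_mul, Units.coe_prod, hU, IsUnit.unit_spec] at h1
    rw [jackDiff, ← h1, sub_one_mul]
  -- The extra factor `α` also covers `r = 0`, where the exponent `r - 1` is `-1`.
  have hdvd : PowerSeries.X ^ r ∣ PowerSeries.X * (u - 1) := by
    rcases Nat.eq_zero_or_pos r with hr | hr
    · rw [hr, pow_zero]
      exact one_dvd _
    · have h2 := h hr.ne'
      rw [hdiff, (IsUnit.prod_iff.2 fun I _ => hu I).dvd_mul_right] at h2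
      rw [← Nat.sub_add_cancel hr, pow_succ']
      exact mul_dvd_mul_left _ h2
  obtain ⟨w, hw⟩ := hdvd
  refine denom_eval_zero_ne_zero (a := w) ?_
  have hX : toLaurent R RatFunc.X ≠ 0 := by
    rw [map_ne_zero]
    exact RatFunc.X_ne_zero
  rw [map_mul, map_sub, hval, map_one, map_zpow₀, neg_sub, zpow_sub₀ hX, zpow_one, zpow_natCast,
    ← mul_div_assoc, div_eq_iff (pow_ne_zero r hX), toLaurent_X, ← map_one (HahnSeries.ofPowerSeries ℤ R),
    ← map_sub, ← map_mul, ← map_pow, ← map_mul, mul_comm, hw, mul_comm]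

end JackSeries

end Jack

namespace Jack

open Finset MvPolynomial IntPartition

/-! ### Finitely many variables -/

section Polynomials

variable {N : ℕ} (R : Type*) [Field R] [Algebra (MvPolynomial (Fin N) ℚ) R]

theorem toSeries_map_C (f : MvPolynomial (Fin N) ℚ) :
    toSeries R (MvPolynomial.map PowerSeries.C f) =
      PowerSeries.C (algebraMap (MvPolynomial (Fin N) ℚ) R f) := by
  have : (toSeries R).comp (MvPolynomial.map PowerSeries.C) =
      (PowerSeries.C (R := R)).comp (algebraMap (MvPolynomial (Fin N) ℚ) R) := by
    apply MvPolynomial.ringHom_ext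
    · intro a
      rw [RingHom.comp_apply, map_C, toSeries_C, PowerSeries.map_C]
      rfl
    · intro i
      simp [toSeries_X]
  exact RingHom.congr_fun this f

theorem toSeries_jackHatPoly [Algebra ℚ R] (lam : IntPartition) :
    toSeries R (jackHatPoly N lam) =
      jackSeries (fun nu => algebraMap (MvPolynomial (Fin N) ℚ) R (monomialPoly N ℚ nu)) lam := by
  rw [jackHatPoly, jackSeries, Finsupp.sum, map_sum]
  refine sum_congr rfl fun nu _ => ?_
  rw [map_mul, toSeries_C, ← map_monomialPoly PowerSeries.C, toSeries_map_C,
    Subsingleton.elim ((algebraMap (MvPolynomial (Fin N) ℚ) R).comp C) (algebraMap ℚ R)]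

theorem isUnit_jackSeries_monomialPoly [IsFractionRing (MvPolynomial (Fin N) ℚ) R] [Algebra ℚ R]
    {lam : IntPartition} (h : lam.length ≤ N) :
    IsUnit (jackSeries
      (fun nu => algebraMap (MvPolynomial (Fin N) ℚ) R (monomialPoly N ℚ nu)) lam) := by
  rw [← toSeries_jackHatPoly]
  exact isUnit_toSeries_jackHatPoly R h

theorem X_pow_dvd_jackDiff_algebraMap [Algebra ℚ R] {ι : Type*} [DecidableEq ι]
    {lam : ι → IntPartition} (hN : ∀ i, (lam i).length ≤ N) {S : Finset ι} (hne : S.Nonempty) :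
    PowerSeries.X ^ (S.card - 1) ∣ jackDiff
      (fun nu => algebraMap (MvPolynomial (Fin N) ℚ) R (monomialPoly N ℚ nu)) lam S := by
  have h := X_pow_dvd_toSeries R (C_X_pow_dvd_evenProd_sub_oddProd hN hne)
  rw [evenProd, oddProd, map_sub, map_prod, map_prod] at h
  simpa only [jackDiff, toSeries_jackHatPoly] using h

/-- Divisibility by a power of `α` is a condition on coefficients, so it descends from the fraction
field to polynomials, with which restrictions of symmetric functions are compared. -/
theorem X_pow_dvd_jackDiff_monomialPoly {ι : Type*} [DecidableEq ι]
    {lam : ι → IntPartition} (hN : ∀ i, (lam i).length ≤ N) {S : Finset ι} (hne : S.Nonempty) :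
    PowerSeries.X ^ (S.card - 1) ∣ jackDiff (monomialPoly N ℚ) lam S := by
  have h := X_pow_dvd_jackDiff_algebraMap (FractionRing (MvPolynomial (Fin N) ℚ)) hN hne
  rw [← map_jackDiff, PowerSeries.X_pow_dvd_iff] at h
  rw [PowerSeries.X_pow_dvd_iff]
  intro n hn
  have h1 := h n hn
  rwa [PowerSeries.coeff_map, map_eq_zero_iff _ (IsFractionRing.injective _ _)] at h1

theorem constantCoeff_jackSeries_monomialPoly_ne_zero {lam : IntPartition} (h : lam.length ≤ N) :
    PowerSeries.constantCoeff (jackSeries (monomialPoly N ℚ) lam) ≠ 0 := by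
  intro h0
  have h1 := isUnit_jackSeries_monomialPoly (FractionRing (MvPolynomial (Fin N) ℚ)) h
  rw [← map_jackSeries, PowerSeries.isUnit_iff_constantCoeff,
    ← PowerSeries.coeff_zero_eq_constantCoeff_apply, PowerSeries.coeff_map,
    PowerSeries.coeff_zero_eq_constantCoeff_apply, h0, map_zero] at h1
  exact not_isUnit_zero h1

end Polynomials

/-! ### Passage to infinitely many variables -/

section SymmetricFunctions

/-- The restriction of symmetric functions to `N` variables. -/
noncomputable def restrict (N : ℕ) : SymmFun →+* MvPowerSeries (Fin N) ℚ :=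
  (MvPowerSeries.killCompl (R := ℚ) (Fin.valEmbedding (n := N))).toRingHom.comp
    SymmFun.val.toRingHom

theorem coeff_restrict (N : ℕ) (f : SymmFun) (e : Fin N →₀ ℕ) :
    MvPowerSeries.coeff e (restrict N f) =
      MvPowerSeries.coeff (e.embDomain Fin.valEmbedding) f.1 := rfl

theorem restrict_monomialSymm (N : ℕ) (nu : IntPartition) :
    restrict N (monomialSymm nu) = coeToMvPowerSeries.ringHom (monomialPoly N ℚ nu) := by
  classical
  ext e
  rw [coeff_restrict, coeToMvPowerSeries.ringHom_apply, coeff_coe, coeff_monomialPoly, monomialSymm,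
    coeff_monomialSeries, parts_embDomain]

/-- Each monomial involves finitely many variables and is therefore seen by some restriction. -/
theorem eq_zero_of_restrict_eq_zero {f : SymmFun} (n : ℕ) (h : ∀ N, n ≤ N → restrict N f = 0) :
    f = 0 := by
  apply Subtype.ext
  ext e
  obtain ⟨M, hM⟩ := e.support.exists_nat_subset_range
  have he : e ∈ Set.range (Finsupp.embDomain (Fin.valEmbedding (n := max n M))) := by
    rw [Finsupp.mem_range_embDomain_iff]
    intro i hi
    have := mem_range.1 (hM hi)
    exact ⟨⟨i, this.trans_le (le_max_right n M)⟩, rfl⟩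
  obtain ⟨e, rfl⟩ := he
  rw [← coeff_restrict, h _ (le_max_left n M)]
  rfl

theorem X_pow_dvd_jackDiff_monomialSymm {r : ℕ} (lam : Fin r → IntPartition) (hr : r ≠ 0) :
    PowerSeries.X ^ (r - 1) ∣ jackDiff monomialSymm lam univ := by
  rw [PowerSeries.X_pow_dvd_iff]
  intro k hk
  refine eq_zero_of_restrict_eq_zero (univ.sup fun i => (lam i).length) fun N hN => ?_
  have hne : (univ : Finset (Fin r)).Nonempty := by
    rw [← card_pos, card_univ, Fintype.card_fin]
    exact Nat.pos_of_ne_zero hr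
  have h := X_pow_dvd_jackDiff_monomialPoly (N := N) (lam := lam)
    (fun i => (le_sup (f := fun i => (lam i).length) (mem_univ i)).trans hN) hne
  rw [card_univ, Fintype.card_fin, PowerSeries.X_pow_dvd_iff] at h
  rw [← PowerSeries.coeff_map, map_jackDiff]
  simp_rw [restrict_monomialSymm]
  rw [← map_jackDiff, PowerSeries.coeff_map, h k hk, map_zero]

theorem isUnit_jackSeries_monomialSymm (R : Type*) [Field R] [Algebra SymmFun R] [Algebra ℚ R]
    [IsFractionRing SymmFun R] (lam : IntPartition) :
    IsUnit (jackSeries (fun nu => algebraMap SymmFun R (monomialSymm nu)) lam) := by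
  rw [← map_jackSeries, PowerSeries.isUnit_iff_constantCoeff,
    ← PowerSeries.coeff_zero_eq_constantCoeff_apply, PowerSeries.coeff_map, isUnit_iff_ne_zero,
    map_ne_zero_iff _ (IsFractionRing.injective _ _)]
  intro h0
  -- As many variables as `lam` has parts suffice to see the nonzero leading coefficient at `α = 0`.
  have h := congrArg (restrict lam.length) h0
  rw [← PowerSeries.coeff_map, map_jackSeries, map_zero] at h
  simp_rw [restrict_monomialSymm] at h
  rw [← map_jackSeries, PowerSeries.coeff_map, coeToMvPowerSeries.ringHom_apply,
    coe_eq_zero_iff, PowerSeries.coeff_zero_eq_constantCoeff_apply] at h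
  exact constantCoeff_jackSeries_monomialPoly_ne_zero le_rfl h

end SymmetricFunctions

theorem isBigO_jackPoly {r : ℕ} (lam : Fin r → IntPartition) {N : ℕ}
    (hN : ∀ i, (lam i).length ≤ N) :
    IsBigO ((∏ I : Finset (Fin r), jackPoly N (∑ i ∈ I, lam i) ^ ((-1 : ℤ) ^ I.card)) - 1)
      ((r : ℤ) - 1) := by
  refine isBigO_of_dvd_jackDiff lam
    (fun I => isUnit_jackSeries_monomialPoly _ (length_sum_le fun i _ => hN i)) fun hr => ?_
  have hne : (univ : Finset (Fin r)).Nonempty := by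
    rw [← card_pos, card_univ, Fintype.card_fin]
    exact Nat.pos_of_ne_zero hr
  have h := X_pow_dvd_jackDiff_algebraMap (FractionRing (MvPolynomial (Fin N) ℚ)) hN hne
  rwa [card_univ, Fintype.card_fin] at h

theorem isBigO_jackSymm {r : ℕ} (lam : Fin r → IntPartition) :
    IsBigO ((∏ I : Finset (Fin r), jackSymm (∑ i ∈ I, lam i) ^ ((-1 : ℤ) ^ I.card)) - 1)
      ((r : ℤ) - 1) := by
  refine isBigO_of_dvd_jackDiff lam (fun I => isUnit_jackSeries_monomialSymm _ _) fun hr => ?_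
  rw [← map_jackDiff]
  have h := map_dvd (PowerSeries.map (algebraMap SymmFun (FractionRing SymmFun)))
    (X_pow_dvd_jackDiff_monomialSymm lam hr)
  rwa [map_pow, PowerSeries.map_X] at h

end Jack

theorem mainTheorem3 (r : ℕ) (lam : Fin r → Jack.IntPartition) :
    Jack.IsBigO
      ((∏ I : Finset (Fin r), Jack.jackSymm (∑ i ∈ I, lam i) ^ ((-1 : ℤ) ^ I.card)) - 1)
      ((r : ℤ) - 1) ∧
    ∀ N : ℕ, (∀ i, (lam i).length ≤ N) →
      Jack.IsBigO
        ((∏ I : Finset (Fin r), Jack.jackPoly N (∑ i ∈ I, lam i) ^ ((-1 : ℤ) ^ I.card)) - 1)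
        ((r : ℤ) - 1) := by
  exact ⟨Jack.isBigO_jackSymm lam, fun _ hN => Jack.isBigO_jackPoly lam hN⟩
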